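/- **Setting.** Let $(M^m,c)$ be a conformal manifold, let $n$ be an integer with $m>n\ge 1$, and let $N^n\subset M$ be an embedded submanifold with the induced conformal structure. Let $L$ be the weight bundle (a positive section $l$ of $L$ is the same as a metric $g=l^{-2}c$ of the conformal class), $L^k$ its real powers, and $L_N$ the weight bundle of $N$, identified with $L|_N$ by restricting metrics to $N$. A *Weyl structure* is a torsion-free connection $\nabla$ on $TM$ with $\nabla c=0$; it induces connections on all $L^k$. Write $\mathrm{Hess}^\nabla(X,Y)l=\nabla_X\nabla_Yl-\nabla_{\nabla_XY}l$, and let $\mathrm{Hess}^\nabla_0$ be its symmetric trace-free part. A *Möbius structure* on a conformal surface $M$ is a linear operator $\mathcal M:C^\infty(L)\to C^\infty(S^2_0M\otimes L)$ such that $\mathcal M-\mathrm{Hess}_0^\nabla$ is of order zero for some Weyl structure $\nabla$. A *Laplace structure* on $N$ is a linear operator $C^\infty(L_N^{1-n/2})\to C^\infty(L_N^{-1-n/2})$ that differs from $\mathrm{tr}(\mathrm{Hess}^{D})$, for some Weyl structure $D$ on $N$, by multiplication by a smooth section of $L_N^{-2}$. If $m=2$, suppose that $M$ is equipped with a Möbius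 structure $\mathcal M$. For a Weyl structure $\nabla$ on $M$ with curvature $R^\nabla$, put $\mathrm{Ric}^\nabla(X,Y)=\mathrm{tr}(Z\mapsto R^\nabla_{Z,X}Y)$ and $\mathrm{scal}^\nabla=\mathrm{tr}_c\mathrm{Ric}^\nabla$, and let $F^\nabla$ be the curvature of the connection induced on $L$. The Schouten–Weyl tensor of $\nabla$ is $$h^\nabla=h^\nabla_0+\frac{1}{2m(m-1)}\mathrm{scal}^\nabla\,c-\frac12F^\nabla ,$$ where $h_0^\nabla$ is $\frac1{m-2}$ times the symmetric trace-free part of $\mathrm{Ric}^\nabla$ if $m\ge3$, and $h_0^\nabla=\mathcal M-\mathrm{Hess}_0^\nabla$ (on sections of $L$) if $m=2$. Let $(\cdot)^N$ and $(\cdot)^\perp$ be the orthogonal projections of $TM|_N$ onto $TN$ and onto the normal bundle. For $X,Y$ tangent to $N$ let $B^\nabla(X,Y)=(\nabla_XY)^\perp$, let $H^\nabla=\frac1n\mathrm{tr}_{TN}B^\nabla$ be the mean curvature, so that $c(H^\nabla,H^\nabla)$ is a section of $L_N^{-2}$, and let $$\overline{\mathrm{Hess}}^\nabla(X,Y)l=\nabla_X\nabla_Yl-\nabla_{(\nabla_XY)^N}l$$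 be the horizontal Hessian on sections $l$ of powers of $L_N$. **Proposition.** Put $k=1-\frac n2$. For every Weyl structure $\nabla$ on $M$, the formula $$\mathcal L^{ind}l:=\mathrm{tr}_{TN}\big(\overline{\mathrm{Hess}}^\nabla l\big)+k\,\mathrm{tr}_{TN}(h^\nabla)\,l+\frac{kn}{2}\,c(H^\nabla,H^\nabla)\,l$$ gives a well-defined operator $\mathcal L^{ind}:C^\infty(L_N^{1-n/2})\to C^\infty(L_N^{-1-n/2})$, which is a Laplace structure on $N$. It does not depend on the choice of $\nabla$. It is called the induced Laplace structure on $N$. -/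

import Mathlib

open Manifold Bundle
open scoped ContDiff Topology

namespace ConfGeom

noncomputable section

/-! ### Conformal structures and weighted densities

All manifolds are smooth, without boundary, and modelled on `EuclideanSpace ℝ (Fin m)`. -/

section Basics

variable {m : ℕ} {M : Type*} [TopologicalSpace M] [ChartedSpace (EuclideanSpace ℝ (Fin m)) M]
  [IsManifold (𝓡 m) ∞ M]

variable (m M) in
/-- Smooth Riemannian metrics on `M`. -/
abbrev Metric : Type _ :=
  ContMDiffRiemannianMetric (𝓡 m) ∞ (EuclideanSpace ℝ (Fin m)) (TangentSpace (𝓡 m) : M → Type _)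

/-- The `i`-th vector of the coordinate basis of `T_xM`. -/
def coordVec (x : M) (i : Fin m) : TangentSpace (𝓡 m) x :=
  (EuclideanSpace.single i (1 : ℝ) : EuclideanSpace ℝ (Fin m))

/-- The `i`-th coordinate of a tangent vector in the basis `coordVec x`. -/
def coord {x : M} (i : Fin m) (v : TangentSpace (𝓡 m) x) : ℝ :=
  (show EuclideanSpace ℝ (Fin m) from v) i

/-- Gram matrix of a metric in the coordinate basis of `T_xM`. -/
def gram (g : Metric m M) (x : M) : Matrix (Fin m) (Fin m) ℝ :=
  Matrix.of fun i j => g.inner x (coordVec x i) (coordVec x j)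

/-- The `g`-trace of a bilinear form on `T_xM`, possibly vector-valued. -/
def metricTrace {F : Type*} [AddCommGroup F] [Module ℝ F] (g : Metric m M) (x : M)
    (B : TangentSpace (𝓡 m) x → TangentSpace (𝓡 m) x → F) : F :=
  ∑ i, ∑ j, (gram g x)⁻¹ i j • B (coordVec x i) (coordVec x j)

variable (m M) in
/-- A conformal structure, given by the set of its metrics: a full class of smooth Riemannian
metrics modulo multiplication by positive smooth functions. A metric `g` of the class is the same
thing as a positive section `l` of the weight bundle `L`, by `c = g ⊗ l²`. -/
structure ConformalStructure where
  metrics : Set (Metric m M)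
  nonempty : metrics.Nonempty
  mem_iff : ∀ g ∈ metrics, ∀ g' : Metric m M, g' ∈ metrics ↔
    ∃ u : M → ℝ, ContMDiff (𝓡 m) 𝓘(ℝ) ∞ u ∧
      ∀ x (v w : TangentSpace (𝓡 m) x), g'.inner x v w = Real.exp (2 * u x) * g.inner x v w

/-- At the point `x` one has `g' = e^{2t} g`. -/
def ScalesBy (g g' : Metric m M) (x : M) (t : ℝ) : Prop :=
  ∀ v w : TangentSpace (𝓡 m) x, g'.inner x v w = Real.exp (2 * t) * g.inner x v w

/-- The space `C^∞(L^k)` of smooth sections of the weight bundle `L^k`, `k` real. Such a section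
is `s = s_g l^k`, where `l` is the positive section of `L` that corresponds to the metric
`g = l⁻² c`; it is encoded by its coefficients `s_g`. As `e^{2u} g` corresponds to `e^{-u} l`, the
coefficients satisfy `s_{e^{2u} g} = e^{ku} s_g`. -/
def Density (c : ConformalStructure m M) (k : ℝ) : Submodule ℝ (c.metrics → M → ℝ) where
  carrier := {s | (∀ g, ContMDiff (𝓡 m) 𝓘(ℝ) ∞ (s g)) ∧
    ∀ g g' : c.metrics, ∀ x t, ScalesBy g.1 g'.1 x t → s g' x = Real.exp (k * t) * s g x}
  zero_mem' := ⟨fun _ => contMDiff_const, fun _ _ _ _ _ => by simp⟩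
  add_mem' := by
    rintro a b ⟨ha, ha'⟩ ⟨hb, hb'⟩
    refine ⟨fun g => (ha g).add (hb g), fun g g' x t h => ?_⟩
    simp only [Pi.add_apply, ha' g g' x t h, hb' g g' x t h]
    ring
  smul_mem' := by
    rintro r a ⟨ha, ha'⟩
    refine ⟨fun g => contMDiff_const.mul (ha g), fun g g' x t h => ?_⟩
    simp only [Pi.smul_apply, smul_eq_mul, ha' g g' x t h]
    ring

/-- Smoothness of a vector field on `M`. -/
abbrev SmoothField (X : ∀ x : M, TangentSpace (𝓡 m) x) : Prop :=
  ContMDiff (𝓡 m) (𝓡 m).tangent ∞ (fun z => (⟨z, X z⟩ : TangentBundle (𝓡 m) M))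

/-- Differentiability of a vector field at a point. -/
abbrev DiffFieldAt (X : ∀ x : M, TangentSpace (𝓡 m) x) (x : M) : Prop :=
  MDifferentiableAt (𝓡 m) (𝓡 m).tangent (fun z => (⟨z, X z⟩ : TangentBundle (𝓡 m) M)) x

/-- Smooth sections of `S²_0 M ⊗ L^k`: symmetric bilinear forms on `TM`, trace-free with respect
to the conformal structure, with values in `L^k`; encoded, as for densities, by the coefficients in
the metrics of the class. -/
def TraceFreeForm (c : ConformalStructure m M) (k : ℝ) :
    Submodule ℝ (c.metrics → ∀ x : M, TangentSpace (𝓡 m) x →ₗ[ℝ] TangentSpace (𝓡 m) x →ₗ[ℝ] ℝ) where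
  carrier := {b |
    (∀ g, ∀ X Y : ∀ x : M, TangentSpace (𝓡 m) x, SmoothField X → SmoothField Y →
      ContMDiff (𝓡 m) 𝓘(ℝ) ∞ (fun x => b g x (X x) (Y x))) ∧
    (∀ g x v w, b g x v w = b g x w v) ∧
    (∀ g x, metricTrace g.1 x (fun v w => b g x v w) = 0) ∧
    ∀ g g' : c.metrics, ∀ x t, ScalesBy g.1 g'.1 x t →
      ∀ v w, b g' x v w = Real.exp (k * t) * b g x v w}
  zero_mem' := ⟨fun _ _ _ _ _ => contMDiff_const, fun _ _ _ _ => rfl,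
    fun _ _ => by simp [metricTrace], fun _ _ _ _ _ _ _ => by simp⟩
  add_mem' := by
    rintro a b ⟨ha, ha1, ha2, ha3⟩ ⟨hb, hb1, hb2, hb3⟩
    refine ⟨fun g X Y hX hY => (ha g X Y hX hY).add (hb g X Y hX hY), fun g x v w => ?_,
      fun g x => ?_, fun g g' x t h v w => ?_⟩
    · simp [ha1 g x v w, hb1 g x v w]
    · have h1 := ha2 g x
      have h2 := hb2 g x
      simp only [metricTrace, smul_eq_mul] at h1 h2
      simp [metricTrace, mul_add, Finset.sum_add_distrib, h1, h2]
    · simp [ha3 g g' x t h v w, hb3 g g' x t h v w, mul_add]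
  smul_mem' := by
    rintro r a ⟨ha, ha1, ha2, ha3⟩
    refine ⟨fun g X Y hX hY => contMDiff_const.mul (ha g X Y hX hY), fun g x v w => ?_,
      fun g x => ?_, fun g g' x t h v w => ?_⟩
    · simp [ha1 g x v w]
    · have h1 := ha2 g x
      simp only [metricTrace, smul_eq_mul] at h1
      simp [metricTrace, mul_left_comm _ r, ← Finset.mul_sum, h1]
    · simp [ha3 g g' x t h v w, mul_left_comm]

/-- The pointwise factor `g' / g` of two conformal metrics. -/
def confRatio (g g' : Metric m M) (x : M) : ℝ :=
  (∑ i, g'.inner x (coordVec x i) (coordVec x i)) / ∑ i, g.inner x (coordVec x i) (coordVec x i)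

lemma confRatio_nonneg (g g' : Metric m M) (x : M) : 0 ≤ confRatio g g' x := by
  have h : ∀ (g : Metric m M) (v : TangentSpace (𝓡 m) x), 0 ≤ g.inner x v v := fun g v => by
    by_cases hv : v = 0
    · simp [hv]
    · exact (g.pos x v hv).le
  exact div_nonneg (Finset.sum_nonneg fun i _ => h _ _) (Finset.sum_nonneg fun i _ => h _ _)

lemma confRatio_scale (g g' g'' : Metric m M) (x : M) (t : ℝ) (h : ScalesBy g' g'' x t) :
    confRatio g g'' x = Real.exp (2 * t) * confRatio g g' x := by
  simp only [confRatio, h _ _, ← Finset.mul_sum, mul_div_assoc]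

lemma confRatio_self [NeZero m] (g : Metric m M) (x : M) : confRatio g g x = 1 := by
  refine div_self (ne_of_gt (Finset.sum_pos (fun i _ => g.pos x _ ?_) Finset.univ_nonempty))
  intro h
  have : (EuclideanSpace.single i (1 : ℝ) : EuclideanSpace ℝ (Fin m)) = 0 := h
  simp at this

/-- The section `l^k` of `L^k`, where `l` is the positive section of `L` that corresponds to `g`:
its coefficient in the metric `g` is the constant `1`. -/
def unitDensity {c : ConformalStructure m M} (g : c.metrics) (k : ℝ) : Density c k :=
  ⟨fun g' x => confRatio g.1 g'.1 x ^ (k / 2), by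
    refine ⟨fun g' => ?_, fun g' g'' x t h => ?_⟩
    · obtain ⟨u, hu, hu'⟩ := (c.mem_iff g.1 g.2 g'.1).1 g'.2
      have h : ∀ x, confRatio g.1 g'.1 x = Real.exp (2 * u x) * confRatio g.1 g.1 x :=
        fun x => confRatio_scale _ _ _ x _ (hu' x)
      rcases Nat.eq_zero_or_pos m with rfl | hm
      · have : (fun x => confRatio g.1 g'.1 x ^ (k / 2)) = fun _ => (0 : ℝ) ^ (k / 2) := by
          funext x; simp [confRatio]
        show ContMDiff _ _ _ (fun x => confRatio g.1 g'.1 x ^ (k / 2))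
        rw [this]; exact contMDiff_const
      · have : NeZero m := ⟨hm.ne'⟩
        have : (fun x => confRatio g.1 g'.1 x ^ (k / 2)) = fun x => Real.exp (k * u x) := by
          funext x
          rw [h, confRatio_self, mul_one, ← Real.exp_mul]; ring_nf
        show ContMDiff _ _ _ (fun x => confRatio g.1 g'.1 x ^ (k / 2))
        rw [this]
        exact Real.contDiff_exp.contMDiff.comp (contMDiff_const.mul hu)
    · show confRatio g.1 g''.1 x ^ (k / 2) = Real.exp (k * t) * confRatio g.1 g'.1 x ^ (k / 2)
      rw [confRatio_scale _ _ _ x t h, Real.mul_rpow (Real.exp_pos _).le (confRatio_nonneg _ _ _),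
        ← Real.exp_mul]
      ring_nf⟩

/-! ### Weyl structures, Hessians and curvature -/

/-- A Weyl structure: a smooth torsion-free connection on `TM` with `∇c = 0`. The field `lee` is
the induced connection on `L`: if `l` is the section of `L` that corresponds to the metric
`g = l⁻² c`, then `∇l = lee g ⊗ l`, so that `∇c = 0` says `∇g = -2 lee g ⊗ g`. This equation
determines `lee g`, so the connection `conn` is the only datum. -/
structure WeylStructure (c : ConformalStructure m M) where
  conn : CovariantDerivative (𝓡 m) (EuclideanSpace ℝ (Fin m)) (TangentSpace (𝓡 m) : M → Type _)
  smooth : conn.ContMDiffCovariantDerivative ∞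
  torsion_free : ∀ (X Y : ∀ x : M, TangentSpace (𝓡 m) x) (x : M),
    DiffFieldAt X x → DiffFieldAt Y x →
      conn Y x (X x) - conn X x (Y x) = VectorField.mlieBracket (𝓡 m) X Y x
  lee : c.metrics → ∀ x : M, TangentSpace (𝓡 m) x →L[ℝ] ℝ
  conformal : ∀ (g : c.metrics) (Y Z : ∀ x : M, TangentSpace (𝓡 m) x) (x : M),
    DiffFieldAt Y x → DiffFieldAt Z x → ∀ v : TangentSpace (𝓡 m) x,
      mvfderiv (𝓡 m) (fun z => g.1.inner z (Y z) (Z z)) x v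
        - g.1.inner x (conn Y x v) (Z x) - g.1.inner x (Y x) (conn Z x v)
      = -2 * lee g x v * g.1.inner x (Y x) (Z x)

/-- A vector field that is smooth near `x`, with value `v` at `x` (and constant coefficients in the
standard trivialization of `TM` at `x`). -/
abbrev ext {x : M} (v : TangentSpace (𝓡 m) x) : ∀ z : M, TangentSpace (𝓡 m) z :=
  FiberBundle.extend (EuclideanSpace ℝ (Fin m)) v

namespace WeylStructure

variable {c : ConformalStructure m M} (D : WeylStructure c)

/-- `∇_v s` for a section `s` of `L^k` with coefficient `f` in the metric `g`; the result is the
coefficient in `g` again. -/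
def deriv (g : c.metrics) (k : ℝ) (f : M → ℝ) (x : M) (v : TangentSpace (𝓡 m) x) : ℝ :=
  mvfderiv (𝓡 m) f x v + k * D.lee g x v * f x

/-- The Hessian `∇_X ∇_Y s - ∇_{∇_X Y} s` of a section `s` of `L^k` with coefficient `f` in the
metric `g`; the result is the coefficient in `g` again. -/
def hess (g : c.metrics) (k : ℝ) (f : M → ℝ) (x : M) (X Y : TangentSpace (𝓡 m) x) : ℝ :=
  D.deriv g k (fun z => D.deriv g k f z (ext Y z)) x X - D.deriv g k f x (D.conn (ext Y) x X)

/-- The component of the Hessian in `S²_0 M`: its symmetric trace-free part. -/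
def hessZero (g : c.metrics) (k : ℝ) (f : M → ℝ) (x : M) (X Y : TangentSpace (𝓡 m) x) : ℝ :=
  (D.hess g k f x X Y + D.hess g k f x Y X) / 2
    - metricTrace g.1 x (D.hess g k f x) / m * g.1.inner x X Y

/-- The curvature `R_{X,Y} Z = ∇_X ∇_Y Z - ∇_Y ∇_X Z - ∇_{[X,Y]} Z`. -/
def curv (x : M) (X Y Z : TangentSpace (𝓡 m) x) : TangentSpace (𝓡 m) x :=
  D.conn (fun z => D.conn (ext Z) z (ext Y z)) x X
    - D.conn (fun z => D.conn (ext Z) z (ext X z)) x Y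
    - D.conn (ext Z) x (VectorField.mlieBracket (𝓡 m) (ext X) (ext Y) x)

/-- The Ricci tensor `Ric(X, Y) = tr (Z ↦ R_{Z,X} Y)`. -/
def ricci (x : M) (X Y : TangentSpace (𝓡 m) x) : ℝ :=
  ∑ i, coord i (D.curv x (coordVec x i) X Y)

/-- The Faraday form, i.e. the curvature of the connection induced on `L`; `R_{X,Y}` is the sum of
a skew-symmetric endomorphism and of `F(X, Y)` times the identity. -/
def faraday (x : M) (X Y : TangentSpace (𝓡 m) x) : ℝ :=
  (∑ i, coord i (D.curv x X Y (coordVec x i))) / m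

/-- The scalar curvature (a section of `L⁻²`), in the metric `g`. -/
def scal (g : c.metrics) (x : M) : ℝ := metricTrace g.1 x (D.ricci x)

end WeylStructure

/-- A Möbius structure: a linear operator `C^∞(L) → C^∞(S²_0 M ⊗ L)` that differs from the
trace-free Hessian of some Weyl structure by an operator of order zero, i.e. by a section of
`S²_0 M`. -/
structure MobiusStructure (c : ConformalStructure m M) where
  op : Density c 1 →ₗ[ℝ] TraceFreeForm c 1
  isMobius : ∃ (D : WeylStructure c) (h : TraceFreeForm c 0), ∀ (l : Density c 1) (g : c.metrics)
    (x : M) (X Y : TangentSpace (𝓡 m) x),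
    (op l).1 g x X Y = D.hessZero g 1 (l.1 g) x X Y + h.1 g x X Y * l.1 g x

/-- A Laplace structure: a linear operator `C^∞(L^{1-m/2}) → C^∞(L^{-1-m/2})` that differs from the
trace of the Hessian of some Weyl structure by an operator of order zero, i.e. by a section of
`L⁻²`. -/
structure LaplaceStructure (c : ConformalStructure m M) where
  op : Density c (1 - m / 2) →ₗ[ℝ] Density c (-1 - m / 2)
  isLaplace : ∃ (D : WeylStructure c) (σ : Density c (-2)), ∀ (l : Density c (1 - m / 2))
    (g : c.metrics) (x : M),
    (op l).1 g x = metricTrace g.1 x (D.hess g (1 - m / 2) (l.1 g) x) + σ.1 g x * l.1 g x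

variable {c : ConformalStructure m M}

/-- The trace-free symmetric tensor `𝓜 - Hess_0` of order zero of a Möbius structure, relative to a
Weyl structure. It is evaluated on a section of `L` whose coefficient in `g` is `1`. -/
def MobiusStructure.schoutenZero (P : MobiusStructure c) (D : WeylStructure c) (g : c.metrics)
    (x : M) (X Y : TangentSpace (𝓡 m) x) : ℝ :=
  (P.op (unitDensity g 1)).1 g x X Y - D.hessZero g 1 ((unitDensity g 1).1 g) x X Y

/-- The symmetric trace-free part of the Schouten-Weyl tensor: `1/(m-2)` times that of the Ricci
tensor if `m ≥ 3`; on a surface it is the one that is provided by the Möbius structure. -/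
def schoutenZero (P : m = 2 → MobiusStructure c) (D : WeylStructure c) (g : c.metrics)
    (x : M) (X Y : TangentSpace (𝓡 m) x) : ℝ :=
  if h : m = 2 then (P h).schoutenZero D g x X Y
  else 1 / ((m : ℝ) - 2) *
    ((D.ricci x X Y + D.ricci x Y X) / 2 - D.scal g x / m * g.1.inner x X Y)

/-- The Schouten-Weyl tensor, for `m ≥ 3` and for Möbius surfaces: the sum of its symmetric
trace-free part, its trace part `scal / (2m(m-1)) c` and its skew part `-F/2`. -/
def schouten (P : m = 2 → MobiusStructure c) (D : WeylStructure c) (g : c.metrics)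
    (x : M) (X Y : TangentSpace (𝓡 m) x) : ℝ :=
  schoutenZero P D g x X Y + D.scal g x / (2 * m * (m - 1)) * g.1.inner x X Y
    - D.faraday x X Y / 2

end Basics

/-! ### Submanifolds -/

section Submanifold

variable {m n : ℕ} {M N : Type*}
  [TopologicalSpace M] [ChartedSpace (EuclideanSpace ℝ (Fin m)) M] [IsManifold (𝓡 m) ∞ M]
  [TopologicalSpace N] [ChartedSpace (EuclideanSpace ℝ (Fin n)) N] [IsManifold (𝓡 n) ∞ N]

/-- The metric `gN` on `N` is the pull-back `ι^* g`. -/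
def IsPullback (ι : N → M) (g : Metric m M) (gN : Metric n N) : Prop :=
  ∀ y (v w : TangentSpace (𝓡 n) y),
    gN.inner y v w = g.inner (ι y) (mfderiv (𝓡 n) (𝓡 m) ι y v) (mfderiv (𝓡 n) (𝓡 m) ι y w)

/-- `ι` embeds `(N, cN)` as a conformal submanifold of `(M, c)`: it is a smooth embedding, and `cN`
is the conformal structure that is induced by `c`. -/
structure IsConformalSubmanifold (c : ConformalStructure m M) (cN : ConformalStructure n N)
    (ι : N → M) : Prop where
  isSmoothEmbedding : IsSmoothEmbedding (𝓡 n) (𝓡 m) ∞ ι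
  induced : ∀ g ∈ c.metrics, ∃ gN ∈ cN.metrics, IsPullback ι g gN

/-- The component in `T_yN` of a vector of `T_{ι y}M`, for the orthogonal splitting of `T_{ι y}M`
into the tangent and the normal space of `N`; here `gN = ι^* g`. -/
def tangentPart (ι : N → M) (g : Metric m M) (gN : Metric n N) (y : N)
    (w : TangentSpace (𝓡 m) (ι y)) : TangentSpace (𝓡 n) y :=
  ∑ i, ∑ j, ((gram gN y)⁻¹ i j * g.inner (ι y) w (mfderiv (𝓡 n) (𝓡 m) ι y (coordVec y i))) •
    coordVec y j

/-- The normal component of a vector of `T_{ι y}M`. -/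
def normalPart (ι : N → M) (g : Metric m M) (gN : Metric n N) (y : N)
    (w : TangentSpace (𝓡 m) (ι y)) : TangentSpace (𝓡 m) (ι y) :=
  w - mfderiv (𝓡 n) (𝓡 m) ι y (tangentPart ι g gN y w)

namespace WeylStructure

variable {c : ConformalStructure m M} (D : WeylStructure c)

/-- `∇_X V` for a vector field `V` of `M` along `ι`, i.e. the pulled-back connection. In the local
frame `(e_a)` of `TM` that is constant in the standard trivialization at `ι y`, and with
`V = ∑ V^a e_a`, it is `∑ dV^a(X) e_a + ∑ V^a ∇_{dι(X)} e_a`. -/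
def along (ι : N → M) (V : ∀ z : N, TangentSpace (𝓡 m) (ι z)) (y : N)
    (X : TangentSpace (𝓡 n) y) : TangentSpace (𝓡 m) (ι y) :=
  let t := trivializationAt (EuclideanSpace ℝ (Fin m)) (TangentSpace (𝓡 m) : M → Type _) (ι y)
  t.symm (ι y) (mvfderiv (𝓡 n) (fun z => (t ⟨ι z, V z⟩).2) y X)
    + D.conn (ext (V y)) (ι y) (mfderiv (𝓡 n) (𝓡 m) ι y X)

/-- `∇_X Y` at a point of `N`, for `X, Y` tangent to `N`. -/
def alongTangent (ι : N → M) (y : N) (X Y : TangentSpace (𝓡 n) y) : TangentSpace (𝓡 m) (ι y) :=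
  D.along ι (fun z => mfderiv (𝓡 n) (𝓡 m) ι z (ext Y z)) y X

/-- The fundamental form `B(X, Y) = (∇_X Y)^⊥`. -/
def fundForm (ι : N → M) (g : Metric m M) (gN : Metric n N) (y : N)
    (X Y : TangentSpace (𝓡 n) y) : TangentSpace (𝓡 m) (ι y) :=
  normalPart ι g gN y (D.alongTangent ι y X Y)

/-- The mean curvature `H = (1/n) tr B`, as a normal vector by means of the metric `g`. -/
def meanCurv (ι : N → M) (g : Metric m M) (gN : Metric n N) (y : N) : TangentSpace (𝓡 m) (ι y) :=
  (1 / n : ℝ) • metricTrace gN y (D.fundForm ι g gN y)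

/-- `∇_v s` for `v` tangent to `N` and a section `s` of `L^k` along `N`, with coefficient `f` in
the metric `g`. -/
def derivAlong (ι : N → M) (g : c.metrics) (k : ℝ) (f : N → ℝ) (y : N)
    (v : TangentSpace (𝓡 n) y) : ℝ :=
  mvfderiv (𝓡 n) f y v + k * D.lee g (ι y) (mfderiv (𝓡 n) (𝓡 m) ι y v) * f y

/-- The horizontal Hessian `∇_X ∇_Y s - ∇_{(∇_X Y)^N} s`, for `X, Y` tangent to `N`, of a section
`s` of `L^k` along `N` with coefficient `f` in the metric `g`. -/
def horizontalHess (ι : N → M) (g : c.metrics) (gN : Metric n N) (k : ℝ) (f : N → ℝ) (y : N)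
    (X Y : TangentSpace (𝓡 n) y) : ℝ :=
  D.derivAlong ι g k (fun z => D.derivAlong ι g k f z (ext Y z)) y X
    - D.derivAlong ι g k f y (tangentPart ι g.1 gN y (D.alongTangent ι y X Y))

/-- The operator
`tr_N (horizontal Hessian) l + k (tr_N h) l + (k n / 2) c(H, H) l`, `k = 1 - n/2`, on a section `l`
of `L_N^k` with coefficient `f` in the metric `gN = ι^* g`; the result is the coefficient in `gN`
of a section of `L_N^{k-2}`. -/
def indLaplace (P : m = 2 → MobiusStructure c) (ι : N → M) (g : c.metrics) (gN : Metric n N)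
    (f : N → ℝ) (y : N) : ℝ :=
  let k : ℝ := 1 - n / 2
  let H := D.meanCurv ι g.1 gN y
  metricTrace gN y (D.horizontalHess ι g gN k f y)
    + k * metricTrace gN y (fun X Y => schouten P D g (ι y)
        (mfderiv (𝓡 n) (𝓡 m) ι y X) (mfderiv (𝓡 n) (𝓡 m) ι y Y)) * f y
    + k * n / 2 * g.1.inner (ι y) H H * f y

/-- The Laplace structure `Λ` on `N` is the operator defined by means of the Weyl structure `D`. -/
def Induces (P : m = 2 → MobiusStructure c) (ι : N → M) {cN : ConformalStructure n N}
    (Λ : LaplaceStructure cN) : Prop :=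
  ∀ (g : c.metrics) (gN : cN.metrics), IsPullback ι g.1 gN.1 →
    ∀ (l : Density cN (1 - n / 2)) (y : N),
      (Λ.op l).1 gN y = D.indLaplace P ι g gN.1 (l.1 gN) y

end WeylStructure

end Submanifold

end

end ConfGeom

/-!
The proof rests on the Weyl structure `(∇_X Y)^N` that a Weyl structure `∇` of `M` induces on `N`.
Its Lee form is the pull-back of that of `∇` and its Hessian on sections of `L_N^k` is the
horizontal Hessian (`WeylStructure.induced`, `WeylStructure.induced_hess`). So the operator of the
proposition is `tr Hess` of a Weyl structure of `N` plus multiplication by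
`k tr_N h + (kn/2) c(H, H)`, which is smooth and is a section of `L_N⁻²`. This is a Laplace
structure (`WeylStructure.exists_unique_induces`).

For independence, let `∇'` be another Weyl structure, and let `γ` be the difference of the
connections on `L`, so that `∇'_X Y = ∇_X Y + γ(X) Y + γ(Y) X - c(X, Y) γ^♯`
(`WeylStructure.conn_eq`). Put `b = ∇γ - γ ⊗ γ + ½ |γ|² c`.

* The curvature changes by the Kulkarni-Nomizu product with `b`, up to multiples of the identity
  (`WeylStructure.inner_curv`). Hence `h^{∇'} = h^∇ - b` (`schouten_change`). On a Möbius surface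
  the same holds for the trace-free part, since `Hess_0` changes by the trace-free part of `b`.
* On sections of `L_N^k` with `k = 1 - n/2` the trace of the Hessian of the induced Weyl structure
  changes by `k tr b_N`, where `b_N` is made from the restriction of `γ` to `N`; the terms of order
  one cancel exactly for this weight (`WeylStructure.metricTrace_hess_change`).
* The covariant derivatives of `γ` on `M` and of its restriction to `N` differ by `γ(B)`
  (`WeylStructure.covForm_induced`), so `tr b_N - tr_N b = n γ(H) - (n/2) |γ^⊥|²`.
* The mean curvature changes by `-(γ^♯)^⊥` (`WeylStructure.meanCurv_change`), so `c(H, H)` changes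
  by `-2 γ(H) + |γ^⊥|²`.

The sum of these changes, weighted as in the operator, is zero (`WeylStructure.indLaplace_change`).

Since `N` and `M` carry densities as families of coefficients, and smoothness is that of global
objects, tensors are evaluated on global smooth fields `sext v` with given value at a point, and
tensoriality is proved for operations on such fields (`tensorial_eq_sum`).
-/

namespace ConfGeom

noncomputable section

set_option linter.unusedSectionVars false

/-! ### Traces and musical isomorphisms of a metric at a point -/

section LinearAlgebra

variable {m : ℕ} {M : Type*} [TopologicalSpace M] [ChartedSpace (EuclideanSpace ℝ (Fin m)) M]
  [IsManifold (𝓡 m) ∞ M]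

lemma coord_add {x : M} (i : Fin m) (v w : TangentSpace (𝓡 m) x) :
    coord i (v + w) = coord i v + coord i w := rfl

lemma coord_smul {x : M} (i : Fin m) (a : ℝ) (v : TangentSpace (𝓡 m) x) :
    coord i (a • v) = a * coord i v := rfl

lemma coord_coordVec (x : M) (i j : Fin m) :
    coord i (coordVec x j) = if i = j then 1 else 0 := by
  change (EuclideanSpace.single j (1 : ℝ) : EuclideanSpace ℝ (Fin m)) i = _
  simp

lemma sum_coord {x : M} (v : TangentSpace (𝓡 m) x) : ∑ i, coord i v • coordVec x i = v := by
  have h := (EuclideanSpace.basisFun (Fin m) ℝ).sum_repr (show EuclideanSpace ℝ (Fin m) from v)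
  simp only [EuclideanSpace.basisFun_apply] at h
  exact h

lemma linearMap_eq_sum_coord {F : Type*} [AddCommGroup F] [Module ℝ F] {x : M}
    (L : TangentSpace (𝓡 m) x →ₗ[ℝ] F) (v : TangentSpace (𝓡 m) x) :
    L v = ∑ i, coord i v • L (coordVec x i) := by
  conv_lhs => rw [← sum_coord v]
  simp

variable (g : Metric m M) (x : M)

lemma inner_symm' (v w : TangentSpace (𝓡 m) x) : g.inner x v w = g.inner x w v := g.symm x v w

lemma gram_apply (i j : Fin m) : gram g x i j = g.inner x (coordVec x i) (coordVec x j) := rfl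

lemma gram_transpose : (gram g x).transpose = gram g x := by
  ext i j
  exact g.symm x _ _

lemma inner_eq_sum_coord (v w : TangentSpace (𝓡 m) x) :
    g.inner x v w = ∑ i, ∑ j, coord i v * coord j w * gram g x i j := by
  rw [show g.inner x v w = (g.inner x).toLinearMap v w from rfl, linearMap_eq_sum_coord]
  simp only [ContinuousLinearMap.coe_coe]
  simp only [FunLike.coe_sum, Finset.sum_apply, FunLike.coe_smul, Pi.smul_apply,
    smul_eq_mul]
  refine Finset.sum_congr rfl fun i _ => ?_
  rw [show g.inner x (coordVec x i) w = (g.inner x (coordVec x i)).toLinearMap w from rfl,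
    linearMap_eq_sum_coord, Finset.mul_sum]
  exact Finset.sum_congr rfl fun j _ => by
    simp only [ContinuousLinearMap.coe_coe, smul_eq_mul, gram_apply]; ring

/-- The metric at a point as a bilinear map, without topology. -/
def innerL : TangentSpace (𝓡 m) x →ₗ[ℝ] TangentSpace (𝓡 m) x →ₗ[ℝ] ℝ :=
  (ContinuousLinearMap.coeLM ℝ).comp (g.inner x).toLinearMap

lemma innerL_apply (v w : TangentSpace (𝓡 m) x) : innerL g x v w = g.inner x v w := rfl

lemma eq_zero_of_inner_self_eq_zero {v : TangentSpace (𝓡 m) x} (h : g.inner x v v = 0) : v = 0 := by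
  by_contra hv
  exact (g.pos x v hv).ne' h

lemma eq_of_inner_eq {v w : TangentSpace (𝓡 m) x} (h : ∀ z, g.inner x v z = g.inner x w z) :
    v = w := by
  refine sub_eq_zero.1 (eq_zero_of_inner_self_eq_zero g x ?_)
  have h1 := h (v - w)
  rw [map_sub (g.inner x)]
  change g.inner x v (v - w) - g.inner x w (v - w) = 0
  rw [h1, sub_self]

lemma isUnit_det_gram : IsUnit (gram g x).det := by
  rw [isUnit_iff_ne_zero]
  intro h
  obtain ⟨c, hc, hc'⟩ := Matrix.exists_mulVec_eq_zero_iff.2 h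
  apply hc
  have hv : ∀ i, coord i
      (show TangentSpace (𝓡 m) x from (WithLp.toLp 2 c : EuclideanSpace ℝ
        (Fin m))) = c i := fun i => rfl
  have h0 : (show TangentSpace (𝓡 m) x from (WithLp.toLp 2 c : EuclideanSpace ℝ (Fin m))) = 0 := by
    apply eq_zero_of_inner_self_eq_zero g x
    rw [inner_eq_sum_coord]
    simp only [hv]
    have : ∀ i, ∑ j, c i * c j * gram g x i j = c i * ((gram g x).mulVec c) i := fun i => by
      simp only [Matrix.mulVec, dotProduct, Finset.mul_sum]
      exact Finset.sum_congr rfl fun j _ => by ring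
    simp [this, hc']
  funext i
  rw [← hv, h0]
  rfl

lemma gram_inv_mul : (gram g x)⁻¹ * gram g x = 1 := Matrix.nonsing_inv_mul _ (isUnit_det_gram g x)

lemma gram_inv_symm (i j : Fin m) : (gram g x)⁻¹ i j = (gram g x)⁻¹ j i := by
  have h := Matrix.transpose_nonsing_inv (gram g x)
  rw [gram_transpose] at h
  exact congrFun (congrFun h j) i

/-- The vector `α^♯` that represents a linear form `α` by means of the metric. -/
def sharp (α : TangentSpace (𝓡 m) x → ℝ) : TangentSpace (𝓡 m) x :=
  ∑ i, ∑ j, ((gram g x)⁻¹ i j * α (coordVec x i)) • coordVec x j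

variable {g x}

lemma inner_sharp (α : TangentSpace (𝓡 m) x →ₗ[ℝ] ℝ) (w : TangentSpace (𝓡 m) x) :
    g.inner x (sharp g x α) w = α w := by
  have h : ∀ k, g.inner x (sharp g x α) (coordVec x k) = α (coordVec x k) := fun k => by
    rw [show g.inner x (sharp g x α) (coordVec x k)
      = (innerL g x).flip (coordVec x k) (sharp g x α) from rfl]
    simp only [sharp, map_sum, map_smul, LinearMap.flip_apply, smul_eq_mul, innerL_apply]
    have : ∀ i, ∑ j, (gram g x)⁻¹ i j * α (coordVec x i) * g.inner x (coordVec x j) (coordVec x k)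
        = α (coordVec x i) * ((gram g x)⁻¹ * gram g x) i k := fun i => by
      rw [Matrix.mul_apply, Finset.mul_sum]
      exact Finset.sum_congr rfl fun j _ => by rw [gram_apply]; ring
    rw [Finset.sum_congr rfl fun i _ => this i]
    simp [gram_inv_mul, Matrix.one_apply]
  rw [linearMap_eq_sum_coord α, show g.inner x (sharp g x α) w
    = (g.inner x (sharp g x α)).toLinearMap w from rfl, linearMap_eq_sum_coord]
  simp only [ContinuousLinearMap.coe_coe, h]

lemma metricTrace_congr {F : Type*} [AddCommGroup F] [Module ℝ F]
    {B B' : TangentSpace (𝓡 m) x → TangentSpace (𝓡 m) x → F}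
    (h : ∀ i j, B (coordVec x i) (coordVec x j) = B' (coordVec x i) (coordVec x j)) :
    metricTrace g x B = metricTrace g x B' := by
  simp only [metricTrace, h]

lemma metricTrace_add {F : Type*} [AddCommGroup F] [Module ℝ F]
    (B B' : TangentSpace (𝓡 m) x → TangentSpace (𝓡 m) x → F) :
    metricTrace g x (fun v w => B v w + B' v w) = metricTrace g x B + metricTrace g x B' := by
  simp only [metricTrace, smul_add, Finset.sum_add_distrib]

lemma metricTrace_sub {F : Type*} [AddCommGroup F] [Module ℝ F]
    (B B' : TangentSpace (𝓡 m) x → TangentSpace (𝓡 m) x → F) :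
    metricTrace g x (fun v w => B v w - B' v w) = metricTrace g x B - metricTrace g x B' := by
  simp only [metricTrace, smul_sub, Finset.sum_sub_distrib]

lemma metricTrace_map {F F' : Type*} [AddCommGroup F] [Module ℝ F] [AddCommGroup F'] [Module ℝ F']
    (L : F →ₗ[ℝ] F') (B : TangentSpace (𝓡 m) x → TangentSpace (𝓡 m) x → F) :
    metricTrace g x (fun v w => L (B v w)) = L (metricTrace g x B) := by
  simp only [metricTrace, map_sum, map_smul]

lemma metricTrace_smul {F : Type*} [AddCommGroup F] [Module ℝ F] (a : ℝ)
    (B : TangentSpace (𝓡 m) x → TangentSpace (𝓡 m) x → F) :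
    metricTrace g x (fun v w => a • B v w) = a • metricTrace g x B := by
  simp only [metricTrace, Finset.smul_sum, smul_comm a]

lemma metricTrace_const_mul (a : ℝ) (B : TangentSpace (𝓡 m) x → TangentSpace (𝓡 m) x → ℝ) :
    metricTrace g x (fun v w => a * B v w) = a * metricTrace g x B :=
  metricTrace_smul a B

lemma metricTrace_smul_const {F : Type*} [AddCommGroup F] [Module ℝ F] (a : F)
    (B : TangentSpace (𝓡 m) x → TangentSpace (𝓡 m) x → ℝ) :
    metricTrace g x (fun v w => B v w • a) = metricTrace g x B • a :=
  metricTrace_map (LinearMap.toSpanSingleton ℝ F a) B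

/-- The metric trace sees only the symmetric part of a bilinear form. -/
lemma metricTrace_swap {F : Type*} [AddCommGroup F] [Module ℝ F]
    (B : TangentSpace (𝓡 m) x → TangentSpace (𝓡 m) x → F) :
    metricTrace g x (fun v w => B w v) = metricTrace g x B := by
  simp only [metricTrace]
  rw [Finset.sum_comm]
  exact Finset.sum_congr rfl fun i _ => Finset.sum_congr rfl fun j _ => by rw [gram_inv_symm]

/-- The trace of `α ⊗ L` is `L(α^♯)`. -/
lemma metricTrace_tmul {F : Type*} [AddCommGroup F] [Module ℝ F]
    (α : TangentSpace (𝓡 m) x → ℝ) (L : TangentSpace (𝓡 m) x →ₗ[ℝ] F) :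
    metricTrace g x (fun v w => α v • L w) = L (sharp g x α) := by
  simp only [metricTrace, sharp, map_sum, map_smul, mul_smul]

lemma metricTrace_mul (α : TangentSpace (𝓡 m) x → ℝ) (β : TangentSpace (𝓡 m) x →ₗ[ℝ] ℝ) :
    metricTrace g x (fun v w => α v * β w) = β (sharp g x α) :=
  metricTrace_tmul α β

/-- The trace of an endomorphism is the metric trace of the corresponding bilinear form. -/
lemma metricTrace_inner (A : TangentSpace (𝓡 m) x → TangentSpace (𝓡 m) x) :
    metricTrace g x (fun v w => g.inner x (A v) w) = ∑ i, coord i (A (coordVec x i)) := by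
  simp only [metricTrace, smul_eq_mul]
  refine Finset.sum_congr rfl fun i _ => ?_
  have h : ∀ j, g.inner x (A (coordVec x i)) (coordVec x j)
      = ∑ k, coord k (A (coordVec x i)) * gram g x k j := fun j => by
    rw [inner_eq_sum_coord]
    simp [coord_coordVec]
  have h2 : ∀ k, ∑ j, (gram g x)⁻¹ i j * gram g x k j = if i = k then 1 else 0 := fun k => by
    rw [← Matrix.one_apply, ← gram_inv_mul g x, Matrix.mul_apply]
    exact Finset.sum_congr rfl fun j _ => by
      rw [← gram_transpose g x, Matrix.transpose_apply, gram_transpose]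
  simp only [h, Finset.mul_sum]
  rw [Finset.sum_comm]
  have h3 : ∀ k, ∑ j, (gram g x)⁻¹ i j * (coord k (A (coordVec x i)) * gram g x k j)
      = coord k (A (coordVec x i)) * if i = k then 1 else 0 := fun k => by
    rw [← h2, Finset.mul_sum]
    exact Finset.sum_congr rfl fun j _ => by ring
  simp [h3]

lemma metricTrace_metric : metricTrace g x (fun v w => g.inner x v w) = m := by
  rw [metricTrace_inner (fun v => v)]
  simp [coord_coordVec]

section Scaling

variable {g' : Metric m M} {t : ℝ}

lemma ScalesBy.gram_eq (h : ScalesBy g g' x t) : gram g' x = Real.exp (2 * t) • gram g x := by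
  ext i j
  simp only [gram_apply, Matrix.smul_apply, smul_eq_mul, h _ _]

lemma ScalesBy.gram_inv_eq (h : ScalesBy g g' x t) :
    (gram g' x)⁻¹ = Real.exp (-2 * t) • (gram g x)⁻¹ := by
  rw [h.gram_eq]
  apply Matrix.inv_eq_left_inv
  rw [Matrix.smul_mul, Matrix.mul_smul, gram_inv_mul, smul_smul, ← Real.exp_add]
  simp

lemma ScalesBy.metricTrace_eq {F : Type*} [AddCommGroup F] [Module ℝ F] (h : ScalesBy g g' x t)
    (B : TangentSpace (𝓡 m) x → TangentSpace (𝓡 m) x → F) :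
    metricTrace g' x B = Real.exp (-2 * t) • metricTrace g x B := by
  simp only [metricTrace, h.gram_inv_eq, Finset.smul_sum, Matrix.smul_apply, smul_assoc]

lemma ScalesBy.sharp_eq (h : ScalesBy g g' x t) (α : TangentSpace (𝓡 m) x → ℝ) :
    sharp g' x α = Real.exp (-2 * t) • sharp g x α := by
  simp only [sharp, h.gram_inv_eq, Finset.smul_sum, Matrix.smul_apply, smul_eq_mul, smul_smul,
    mul_assoc]

end Scaling

variable (g) in
/-- Change of basis for the metric trace: the coordinate basis can be replaced by any family with
invertible Gram matrix. -/
lemma metricTrace_eq_of_frame (B : TangentSpace (𝓡 m) x →ₗ[ℝ] TangentSpace (𝓡 m) x →ₗ[ℝ] ℝ)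
    (e : Fin m → TangentSpace (𝓡 m) x)
    (he : IsUnit (Matrix.of fun i j => g.inner x (e i) (e j)).det) :
    metricTrace g x (fun v w => B v w)
      = ∑ i, ∑ j, (Matrix.of fun i j => g.inner x (e i) (e j))⁻¹ i j * B (e i) (e j) := by
  set P : Matrix (Fin m) (Fin m) ℝ := Matrix.of fun i j => coord j (e i) with hP
  set Q : Matrix (Fin m) (Fin m) ℝ := Matrix.of fun i j => B (coordVec x i) (coordVec x j) with hQ
  have expand : ∀ (C : TangentSpace (𝓡 m) x →ₗ[ℝ] TangentSpace (𝓡 m) x →ₗ[ℝ] ℝ),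
      (Matrix.of fun i j => C (e i) (e j))
        = P * (Matrix.of fun i j => C (coordVec x i) (coordVec x j)) * P.transpose := by
    intro C
    ext i j
    simp only [Matrix.of_apply, Matrix.mul_apply, Matrix.transpose_apply, hP, Finset.sum_mul]
    rw [linearMap_eq_sum_coord (C (e i))]
    refine Finset.sum_congr rfl fun k _ => ?_
    rw [smul_eq_mul, show C (e i) (coordVec x k) = C.flip (coordVec x k) (e i) from rfl,
      linearMap_eq_sum_coord, Finset.mul_sum]
    exact Finset.sum_congr rfl fun l _ => by simp only [LinearMap.flip_apply, smul_eq_mul]; ring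
  have hG : (Matrix.of fun i j => g.inner x (e i) (e j)) = P * gram g x * P.transpose :=
    expand (innerL g x)
  have hPu : IsUnit P.det := by
    rw [hG, Matrix.det_mul, Matrix.det_mul] at he
    exact isUnit_of_mul_isUnit_left (isUnit_of_mul_isUnit_left he)
  have hPt : IsUnit P.transpose.det := by rwa [Matrix.det_transpose]
  have tr : ∀ A C : Matrix (Fin m) (Fin m) ℝ, ∑ i, ∑ j, A i j * C i j
      = (A * C.transpose).trace := fun A C => by
    simp [Matrix.trace, Matrix.mul_apply]
  have h1 : ∑ i, ∑ j, (Matrix.of fun i j => g.inner x (e i) (e j))⁻¹ i j * B (e i) (e j)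
      = ((Matrix.of fun i j => g.inner x (e i) (e j))⁻¹ *
        (Matrix.of fun i j => B (e i) (e j)).transpose).trace := by
    rw [← tr]; rfl
  have h2 : metricTrace g x (fun v w => B v w) = ((gram g x)⁻¹ * Q.transpose).trace := by
    rw [← tr]; rfl
  rw [h1, h2, hG, expand B, ← hQ, Matrix.mul_inv_rev, Matrix.mul_inv_rev]
  have h3 : (P * Q * P.transpose).transpose = P * (Q.transpose * P.transpose) := by
    simp [Matrix.transpose_mul, Matrix.mul_assoc]
  have h4 : P.transpose⁻¹ * ((gram g x)⁻¹ * P⁻¹) * (P * (Q.transpose * P.transpose))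
      = P.transpose⁻¹ * ((gram g x)⁻¹ * Q.transpose) * P.transpose := by
    simp only [Matrix.mul_assoc]
    rw [Matrix.nonsing_inv_mul_cancel_left _ _ hPu]
  rw [h3, h4, Matrix.trace_mul_comm (P.transpose⁻¹ * _), ← Matrix.mul_assoc,
    Matrix.mul_nonsing_inv _ hPt, Matrix.one_mul]

end LinearAlgebra

/-! ### Smooth vector fields, local frames and tensoriality -/

section Fields

variable {m n : ℕ} {M N : Type*}
  [TopologicalSpace M] [ChartedSpace (EuclideanSpace ℝ (Fin m)) M] [IsManifold (𝓡 m) ∞ M]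
  [TopologicalSpace N] [ChartedSpace (EuclideanSpace ℝ (Fin n)) N] [IsManifold (𝓡 n) ∞ N]

/-- Smoothness of a vector field of `M` along a map `ι : N → M`. -/
abbrev SmoothAlong (n : ℕ) {N : Type*} [TopologicalSpace N]
    [ChartedSpace (EuclideanSpace ℝ (Fin n)) N] (ι : N → M)
    (V : ∀ z : N, TangentSpace (𝓡 m) (ι z)) : Prop :=
  ContMDiff (𝓡 n) (𝓡 m).tangent ∞ (fun z => (⟨ι z, V z⟩ : TangentBundle (𝓡 m) M))

/-- Differentiability at a point of a vector field of `M` along a map `ι : N → M`. -/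
abbrev DiffAlongAt (n : ℕ) {N : Type*} [TopologicalSpace N]
    [ChartedSpace (EuclideanSpace ℝ (Fin n)) N] (ι : N → M)
    (V : ∀ z : N, TangentSpace (𝓡 m) (ι z)) (y : N) : Prop :=
  MDifferentiableAt (𝓡 n) (𝓡 m).tangent (fun z => (⟨ι z, V z⟩ : TangentBundle (𝓡 m) M)) y

/-- Smooth real functions. -/
abbrev SmoothFun (m : ℕ) {M : Type*} [TopologicalSpace M]
    [ChartedSpace (EuclideanSpace ℝ (Fin m)) M] (f : M → ℝ) : Prop := ContMDiff (𝓡 m) 𝓘(ℝ) ∞ f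

lemma SmoothFun.mdiffAt {f : M → ℝ} (hf : SmoothFun m f) (x : M) :
    MDifferentiableAt (𝓡 m) 𝓘(ℝ) f x := hf.mdifferentiable (by simp) x

lemma SmoothField.diffAt {X : ∀ x : M, TangentSpace (𝓡 m) x} (hX : SmoothField X) (x : M) :
    DiffFieldAt X x := hX.mdifferentiable (by simp) x

lemma SmoothAlong.diffAt {ι : N → M} {V : ∀ z : N, TangentSpace (𝓡 m) (ι z)}
    (hV : SmoothAlong n ι V) (y : N) : DiffAlongAt n ι V y := hV.mdifferentiable (by simp) y

lemma SmoothField.add {X Y : ∀ x : M, TangentSpace (𝓡 m) x} (hX : SmoothField X)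
    (hY : SmoothField Y) : SmoothField (X + Y) := ContMDiff.add_section hX hY

lemma SmoothField.smul {f : M → ℝ} {X : ∀ x : M, TangentSpace (𝓡 m) x} (hf : SmoothFun m f)
    (hX : SmoothField X) : SmoothField (f • X) := ContMDiff.smul_section hf hX

lemma SmoothField.sum {ι : Type*} {s : Finset ι} {X : ι → ∀ x : M, TangentSpace (𝓡 m) x}
    (hX : ∀ i ∈ s, SmoothField (X i)) : SmoothField (fun x => ∑ i ∈ s, X i x) :=
  ContMDiff.sum_section hX

lemma SmoothField.along {ι : N → M} (hι : ContMDiff (𝓡 n) (𝓡 m) ∞ ι)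
    {X : ∀ x : M, TangentSpace (𝓡 m) x} (hX : SmoothField X) : SmoothAlong n ι (fun z => X (ι z)) :=
  ContMDiff.comp hX hι

lemma SmoothField.mfderiv {ι : N → M} (hι : ContMDiff (𝓡 n) (𝓡 m) ∞ ι)
    {X : ∀ x : N, TangentSpace (𝓡 n) x} (hX : SmoothField X) :
    SmoothAlong n ι (fun z => mfderiv (𝓡 n) (𝓡 m) ι z (X z)) :=
  ContMDiff.comp (hι.contMDiff_tangentMap (by simp)) hX

lemma DiffFieldAt.mfderiv {ι : N → M} (hι : ContMDiff (𝓡 n) (𝓡 m) ∞ ι)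
    {X : ∀ x : N, TangentSpace (𝓡 n) x} {y : N} (hX : DiffFieldAt X y) :
    DiffAlongAt n ι (fun z => mfderiv (𝓡 n) (𝓡 m) ι z (X z)) y :=
  MDifferentiableAt.comp y
    (((hι.contMDiff_tangentMap (m := ∞) (by simp)).mdifferentiable (by simp)) _) hX

lemma SmoothFun.deriv {f : M → ℝ} (hf : SmoothFun m f) {X : ∀ x : M, TangentSpace (𝓡 m) x}
    (hX : SmoothField X) : SmoothFun m (fun x => mvfderiv (𝓡 m) f x (X x)) := by
  have h1 := ContMDiff.comp (hf.contMDiff_tangentMap (m := ∞) (by simp)) hX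
  exact ContMDiff.comp (contMDiff_snd_tangentBundle_modelSpace ℝ 𝓘(ℝ)) h1

lemma smoothFun_inner_along (g : Metric m M) {ι : N → M}
    {V W : ∀ z : N, TangentSpace (𝓡 m) (ι z)} (hV : SmoothAlong n ι V) (hW : SmoothAlong n ι W) :
    SmoothFun n (fun z => g.inner (ι z) (V z) (W z)) := by
  let _ : RiemannianBundle (TangentSpace (𝓡 m) : M → Type _) := ⟨g.toRiemannianMetric⟩
  exact ContMDiff.inner_bundle (b := ι) hV hW

lemma smoothFun_inner (g : Metric m M) {V W : ∀ z : M, TangentSpace (𝓡 m) z} (hV : SmoothField V)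
    (hW : SmoothField W) : SmoothFun m (fun z => g.inner z (V z) (W z)) :=
  smoothFun_inner_along (ι := id) g hV hW

lemma diffAt_inner_along (g : Metric m M) {ι : N → M}
    {V W : ∀ z : N, TangentSpace (𝓡 m) (ι z)} {y : N} (hV : DiffAlongAt n ι V y)
    (hW : DiffAlongAt n ι W y) :
    MDifferentiableAt (𝓡 n) 𝓘(ℝ) (fun z => g.inner (ι z) (V z) (W z)) y := by
  let _ : RiemannianBundle (TangentSpace (𝓡 m) : M → Type _) := ⟨g.toRiemannianMetric⟩
  exact MDifferentiableAt.inner_bundle (b := ι) hV hW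

lemma ext_apply_self {x : M} (v : TangentSpace (𝓡 m) x) : ext v x = v :=
  FiberBundle.extend_apply_self _ v

lemma diffFieldAt_ext {x : M} (v : TangentSpace (𝓡 m) x) : DiffFieldAt (ext v) x :=
  FiberBundle.mdifferentiableAt_extend _ _ v

lemma mem_baseSet (x : M) :
    x ∈ (trivializationAt (EuclideanSpace ℝ (Fin m)) (TangentSpace (𝓡 m) : M → Type _) x).baseSet :=
  FiberBundle.mem_baseSet_trivializationAt' x

lemma contMDiffOn_ext {x : M} (v : TangentSpace (𝓡 m) x) :
    ContMDiffOn (𝓡 m) (𝓡 m).tangent ∞ (fun z => (⟨z, ext v z⟩ : TangentBundle (𝓡 m) M))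
      (trivializationAt (EuclideanSpace ℝ (Fin m))
        (TangentSpace (𝓡 m) : M → Type _) x).baseSet := by
  set t := trivializationAt (EuclideanSpace ℝ (Fin m)) (TangentSpace (𝓡 m) : M → Type _) x
  refine (t.contMDiffOn_section_baseSet_iff).2 ?_
  refine (contMDiffOn_const (c := (t ⟨x, v⟩).2)).congr fun z hz => ?_
  change (t ⟨z, t.symm z _⟩).2 = _
  rw [t.apply_mk_symm hz]

lemma triv_self {x : M} (v : TangentSpace (𝓡 m) x) :
    (trivializationAt (EuclideanSpace ℝ (Fin m)) (TangentSpace (𝓡 m) : M → Type _) x ⟨x, v⟩).2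
      = v := by
  rw [TangentBundle.trivializationAt_apply]
  exact tangentCoordChange_self (I := 𝓡 m) (x := x) (z := x) (mem_extChartAt_source x)

lemma ext_eq_symmL {x : M} (v : TangentSpace (𝓡 m) x) {z : M}
    (hz : z ∈ (trivializationAt (EuclideanSpace ℝ (Fin m))
      (TangentSpace (𝓡 m) : M → Type _) x).baseSet) :
    ext v z = (trivializationAt (EuclideanSpace ℝ (Fin m))
      (TangentSpace (𝓡 m) : M → Type _) x).symmₗ ℝ z v := by
  have h := triv_self v
  simp only [FiberBundle.extend]
  rw [h, Trivialization.coe_symmₗ _ hz]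

lemma ext_add {x : M} (v w : TangentSpace (𝓡 m) x) :
    ∀ᶠ z in 𝓝 x, ext (v + w) z = ext v z + ext w z := by
  filter_upwards [(trivializationAt (EuclideanSpace ℝ (Fin m))
    (TangentSpace (𝓡 m) : M → Type _) x).open_baseSet.mem_nhds (mem_baseSet x)] with z hz
  simp only [ext_eq_symmL _ hz]
  exact map_add _ _ _

lemma ext_smul {x : M} (a : ℝ) (v : TangentSpace (𝓡 m) x) :
    ∀ᶠ z in 𝓝 x, ext (a • v) z = a • ext v z := by
  filter_upwards [(trivializationAt (EuclideanSpace ℝ (Fin m))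
    (TangentSpace (𝓡 m) : M → Type _) x).open_baseSet.mem_nhds (mem_baseSet x)] with z hz
  simp only [ext_eq_symmL _ hz]
  exact map_smul _ _ _

end Fields

section Cutoff

variable {m n : ℕ} {M N : Type*}
  [TopologicalSpace M] [T2Space M] [ChartedSpace (EuclideanSpace ℝ (Fin m)) M]
  [IsManifold (𝓡 m) ∞ M]
  [TopologicalSpace N] [T2Space N] [ChartedSpace (EuclideanSpace ℝ (Fin n)) N]
  [IsManifold (𝓡 n) ∞ N]

lemma exists_cutoff {x : M} {U : Set M} (hU : U ∈ 𝓝 x) :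
    ∃ χ : M → ℝ, SmoothFun m χ ∧ (∀ᶠ z in 𝓝 x, χ z = 1) ∧ tsupport χ ⊆ U := by
  obtain ⟨f, -, hf⟩ := (SmoothBumpFunction.nhds_basis_tsupport (I := 𝓡 m) x).mem_iff.1 hU
  exact ⟨f, f.contMDiff, f.eventuallyEq_one, hf⟩

lemma smoothFun_mul_of_tsupport {χ f : M → ℝ} {U : Set M} (hU : IsOpen U) (hχ : SmoothFun m χ)
    (hs : tsupport χ ⊆ U) (hf : ContMDiffOn (𝓡 m) 𝓘(ℝ) ∞ f U) : SmoothFun m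
      (fun z => χ z * f z) := by
  refine contMDiff_of_tsupport fun x hx => ?_
  have hx' : x ∈ U := hs (tsupport_mul_subset_left hx)
  exact (hχ x).mul ((hf x hx').contMDiffAt (hU.mem_nhds hx'))

/-- The field `ext v` is smooth only near `x`; a cut-off function extends its germ to all of `M`. -/
lemma exists_smoothField_ext {x : M} (v : TangentSpace (𝓡 m) x) :
    ∃ X : ∀ z : M, TangentSpace (𝓡 m) z, SmoothField X ∧ ∀ᶠ z in 𝓝 x, X z = ext v z := by
  set t := trivializationAt (EuclideanSpace ℝ (Fin m)) (TangentSpace (𝓡 m) : M → Type _) x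
  obtain ⟨χ, hχ, hχ1, hs⟩ := exists_cutoff (m := m) (t.open_baseSet.mem_nhds (mem_baseSet x))
  refine ⟨χ • ext v, ContMDiffOn.smul_section_of_tsupport hχ.contMDiffOn t.open_baseSet hs
    (contMDiffOn_ext v), hχ1.mono fun z hz => ?_⟩
  simp [hz]

/-- A smooth vector field on `M` that agrees near `x` with the field `ext v`. -/
def sext {x : M} (v : TangentSpace (𝓡 m) x) : ∀ z : M, TangentSpace (𝓡 m) z :=
  (exists_smoothField_ext v).choose

lemma smoothField_sext {x : M} (v : TangentSpace (𝓡 m) x) : SmoothField (sext v) :=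
  (exists_smoothField_ext v).choose_spec.1

lemma sext_eventuallyEq {x : M} (v : TangentSpace (𝓡 m) x) : ∀ᶠ z in 𝓝 x, sext v z = ext v z :=
  (exists_smoothField_ext v).choose_spec.2

lemma sext_apply_self {x : M} (v : TangentSpace (𝓡 m) x) : sext v x = v := by
  rw [(sext_eventuallyEq v).self_of_nhds, ext_apply_self]

lemma exists_smoothField {x : M} (v : TangentSpace (𝓡 m) x) :
    ∃ X : ∀ z : M, TangentSpace (𝓡 m) z, SmoothField X ∧ X x = v :=
  ⟨sext v, smoothField_sext v, sext_apply_self v⟩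

lemma eq_sum_triv_ext {ι : N → M} (V : ∀ z : N, TangentSpace (𝓡 m) (ι z)) {x : M} {z : N}
    (hz : ι z ∈ (trivializationAt (EuclideanSpace ℝ (Fin m))
      (TangentSpace (𝓡 m) : M → Type _) x).baseSet) :
    V z = ∑ i, ((trivializationAt (EuclideanSpace ℝ (Fin m)) (TangentSpace (𝓡 m) : M → Type _) x
      ⟨ι z, V z⟩).2) i • ext (coordVec x i) (ι z) := by
  set t := trivializationAt (EuclideanSpace ℝ (Fin m)) (TangentSpace (𝓡 m) : M → Type _) x with ht
  have h2 : V z = t.symmₗ ℝ (ι z) (t ⟨ι z, V z⟩).2 := by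
    rw [Trivialization.coe_symmₗ _ hz]
    exact (t.symm_proj_apply ⟨ι z, V z⟩ hz).symm
  have h3 : (t ⟨ι z, V z⟩).2 = ∑ i, ((t ⟨ι z, V z⟩).2) i • (EuclideanSpace.single i (1 : ℝ)) := by
    have := (EuclideanSpace.basisFun (Fin m) ℝ).sum_repr (t ⟨ι z, V z⟩).2
    simpa using this.symm
  rw [h2]
  conv_lhs => rw [h3]
  rw [map_sum]
  refine Finset.sum_congr rfl fun i _ => ?_
  rw [map_smul, ext_eq_symmL _ hz, ← h2]
  rfl

/-- Near a point, a smooth vector field along a smooth map is a combination, with smooth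
coefficients, of the global smooth fields `sext (coordVec x i)`. -/
lemma SmoothAlong.exists_coeff {ι : N → M} (hι : ContMDiff (𝓡 n) (𝓡 m) ∞ ι)
    {V : ∀ z : N, TangentSpace (𝓡 m) (ι z)} (hV : SmoothAlong n ι V) (y : N) :
    ∃ a : Fin m → N → ℝ, (∀ i, SmoothFun n (a i)) ∧ (∀ i, a i y = coord i (V y)) ∧
      ∀ᶠ z in 𝓝 y, V z = ∑ i, a i z • sext (coordVec (ι y) i) (ι z) := by
  set t := trivializationAt (EuclideanSpace ℝ (Fin m)) (TangentSpace (𝓡 m) : M → Type _) (ι y)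
    with ht
  have hUo : IsOpen (ι ⁻¹' t.baseSet) := t.open_baseSet.preimage hι.continuous
  have hy : y ∈ ι ⁻¹' t.baseSet := mem_baseSet (ι y)
  obtain ⟨χ, hχ, hχ1, hs⟩ := exists_cutoff (m := n) (hUo.mem_nhds hy)
  have hc : ContMDiffOn (𝓡 n) 𝓘(ℝ, EuclideanSpace ℝ (Fin m)) ∞ (fun z => (t ⟨ι z, V z⟩).2)
      (ι ⁻¹' t.baseSet) := by
    refine ((t.contMDiffOn_iff (IB := 𝓡 m) (n := ∞) ?_).1 (hV.contMDiffOn)).2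
    intro z hz
    exact t.mem_source.2 hz
  have hci : ∀ i, ContMDiffOn (𝓡 n) 𝓘(ℝ) ∞ (fun z => (t ⟨ι z, V z⟩).2 i) (ι ⁻¹' t.baseSet) :=
    fun i => (EuclideanSpace.proj (𝕜 := ℝ) i :
      EuclideanSpace ℝ (Fin m) →L[ℝ] ℝ).contMDiff.comp_contMDiffOn hc
  refine ⟨fun i z => χ z * (t ⟨ι z, V z⟩).2 i, fun i => smoothFun_mul_of_tsupport hUo hχ hs (hci i),
    fun i => ?_, ?_⟩
  · show χ y * (t ⟨ι y, V y⟩).2 i = _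
    rw [hχ1.self_of_nhds, one_mul, ht, triv_self]
    rfl
  · have h1 : ∀ᶠ z in 𝓝 y, ∀ i,
        sext (m := m) (coordVec (ι y) i) (ι z) = ext (coordVec (ι y) i) (ι z) :=
      Filter.eventually_all.2 fun i => hι.continuous.continuousAt.eventually (sext_eventuallyEq _)
    filter_upwards [h1, hχ1, hUo.mem_nhds hy] with z hz1 hz2 hz3
    rw [eq_sum_triv_ext V hz3]
    refine Finset.sum_congr rfl fun i _ => ?_
    rw [hz1, hz2, one_mul, ← eq_sum_triv_ext V hz3]

lemma SmoothField.exists_coeff {X : ∀ z : M, TangentSpace (𝓡 m) z} (hX : SmoothField X) (x : M) :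
    ∃ a : Fin m → M → ℝ, (∀ i, SmoothFun m (a i)) ∧ (∀ i, a i x = coord i (X x)) ∧
      ∀ᶠ z in 𝓝 x, X z = ∑ i, a i z • sext (coordVec x i) z :=
  SmoothAlong.exists_coeff (ι := id) contMDiff_id hX x

/-- The tensoriality criterion: an operation on global smooth vector fields that is additive, and
homogeneous over the smooth functions at `x`, depends only on the value of the field at `x`.
Multiplying the field by a cut-off function turns its local expansion in a frame into a global one.
-/
lemma tensorial_eq_sum {A : Type*} [AddCommGroup A] [Module ℝ A] {x : M}
    {Φ : (∀ z : M, TangentSpace (𝓡 m) z) → A}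
    (hadd : ∀ X Y, SmoothField X → SmoothField Y → Φ (X + Y) = Φ X + Φ Y)
    (hsmul : ∀ (f : M → ℝ) X, SmoothFun m f → SmoothField X → Φ (f • X) = f x • Φ X)
    {X : ∀ z : M, TangentSpace (𝓡 m) z} (hX : SmoothField X) :
    Φ X = ∑ i, coord i (X x) • Φ (sext (coordVec x i)) := by
  obtain ⟨a, ha, hax, heq⟩ := hX.exists_coeff x
  obtain ⟨U, hU, hUo, hxU⟩ := eventually_nhds_iff.1 heq
  obtain ⟨χ, hχ, hχ1, hs⟩ := exists_cutoff (m := m) (hUo.mem_nhds hxU)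
  have h0 : Φ 0 = 0 := by
    have h := hsmul 0 X contMDiff_const hX
    simpa using h
  have hsum : ∀ (s : Finset (Fin m)) (Y : Fin m → ∀ z : M, TangentSpace (𝓡 m) z),
      (∀ i, SmoothField (Y i)) → Φ (∑ i ∈ s, Y i) = ∑ i ∈ s, Φ (Y i) := by
    intro s Y hY
    have hS : ∀ s : Finset (Fin m), SmoothField (∑ i ∈ s, Y i) := fun s => by
      have := SmoothField.sum (s := s) (fun i _ => hY i)
      convert this using 3
      simp
    classical
    induction s using Finset.induction_on with
    | empty => simpa using h0
    | insert i s hi ih => rw [Finset.sum_insert hi, Finset.sum_insert hi, hadd _ _ (hY i) (hS s),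
        ih]
  have key : χ • X = ∑ i, ((χ * a i) • sext (coordVec x i)) := by
    funext z
    by_cases hz : z ∈ U
    · simp [hU z hz, Finset.smul_sum, mul_smul]
    · have : χ z = 0 := image_eq_zero_of_notMem_tsupport fun h => hz (hs h)
      simp [this]
  have h1 : Φ X = Φ (χ • X) := by rw [hsmul _ _ hχ hX, hχ1.self_of_nhds, one_smul]
  rw [h1, key, hsum _ _ fun i => SmoothField.smul (hχ.mul (ha i)) (smoothField_sext _)]
  refine Finset.sum_congr rfl fun i _ => ?_
  rw [hsmul _ _ (hχ.mul (ha i)) (smoothField_sext _), Pi.mul_apply, hχ1.self_of_nhds, one_mul, hax]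

lemma tensorial_congr {A : Type*} [AddCommGroup A] [Module ℝ A] {x : M}
    {Φ : (∀ z : M, TangentSpace (𝓡 m) z) → A}
    (hadd : ∀ X Y, SmoothField X → SmoothField Y → Φ (X + Y) = Φ X + Φ Y)
    (hsmul : ∀ (f : M → ℝ) X, SmoothFun m f → SmoothField X → Φ (f • X) = f x • Φ X)
    {X Y : ∀ z : M, TangentSpace (𝓡 m) z} (hX : SmoothField X) (hY : SmoothField Y)
    (h : X x = Y x) : Φ X = Φ Y := by
  rw [tensorial_eq_sum hadd hsmul hX, tensorial_eq_sum hadd hsmul hY, h]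

lemma smoothFun_of_eventuallyEq {f : M → ℝ}
    (h : ∀ x, ∃ f' : M → ℝ, ContMDiffAt (𝓡 m) 𝓘(ℝ) ∞ f' x ∧ ∀ᶠ z in 𝓝 x, f z = f' z) :
    SmoothFun m f := fun x => by
  obtain ⟨f', h1, h2⟩ := h x
  exact h1.congr_of_eventuallyEq h2

lemma smoothFun_sum {ι : Type*} {s : Finset ι} {f : ι → M → ℝ} (h : ∀ i ∈ s, SmoothFun m (f i)) :
    SmoothFun m (fun x => ∑ i ∈ s, f i x) := contMDiff_finsetSum h

/-- A bilinear form on `TM` that is smooth on smooth vector fields is smooth on smooth vector fields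
along a map. -/
lemma smoothFun_form_along {ι : N → M} (hι : ContMDiff (𝓡 n) (𝓡 m) ∞ ι)
    {B : ∀ x : M, TangentSpace (𝓡 m) x →ₗ[ℝ] TangentSpace (𝓡 m) x →ₗ[ℝ] ℝ}
    (hB : ∀ X Y, SmoothField X → SmoothField Y → SmoothFun m (fun x => B x (X x) (Y x)))
    {V W : ∀ z : N, TangentSpace (𝓡 m) (ι z)} (hV : SmoothAlong n ι V) (hW : SmoothAlong n ι W) :
    SmoothFun n (fun z => B (ι z) (V z) (W z)) := by
  refine smoothFun_of_eventuallyEq fun y => ?_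
  obtain ⟨a, ha, -, hVa⟩ := hV.exists_coeff hι y
  obtain ⟨b, hb, -, hWb⟩ := hW.exists_coeff hι y
  refine ⟨fun z => ∑ i, ∑ j, a i z * (b j z * B (ι z) (sext (coordVec (ι y) i) (ι z))
    (sext (coordVec (ι y) j) (ι z))), ?_, ?_⟩
  · refine smoothFun_sum (fun i _ => smoothFun_sum fun j _ => (ha i).mul ((hb j).mul ?_)) y
    exact (hB _ _ (smoothField_sext (coordVec (ι y) i))
      (smoothField_sext (coordVec (ι y) j))).comp hι
  · filter_upwards [hVa, hWb] with z h1 h2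
    rw [h1, h2]
    simp only [map_sum, map_smul, LinearMap.coe_sum, Finset.sum_apply, LinearMap.smul_apply,
      smul_eq_mul, Finset.mul_sum]
    rw [Finset.sum_comm]
    exact Finset.sum_congr rfl fun i _ => Finset.sum_congr rfl fun j _ => by ring

/-- A linear form on `TM` that is smooth on smooth vector fields is smooth on smooth vector fields
along a map. -/
lemma smoothFun_oneForm_along {ι : N → M} (hι : ContMDiff (𝓡 n) (𝓡 m) ∞ ι)
    {α : ∀ x : M, TangentSpace (𝓡 m) x →L[ℝ] ℝ}
    (hα : ∀ X, SmoothField X → SmoothFun m (fun x => α x (X x)))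
    {V : ∀ z : N, TangentSpace (𝓡 m) (ι z)} (hV : SmoothAlong n ι V) :
    SmoothFun n (fun z => α (ι z) (V z)) := by
  refine smoothFun_of_eventuallyEq fun y => ?_
  obtain ⟨a, ha, -, hVa⟩ := hV.exists_coeff hι y
  refine ⟨fun z => ∑ i, a i z * α (ι z) (sext (coordVec (ι y) i) (ι z)), ?_, ?_⟩
  · exact smoothFun_sum (fun i _ => (ha i).mul
      ((hα _ (smoothField_sext (coordVec (ι y) i))).comp hι)) y
  · filter_upwards [hVa] with z h1
    rw [h1]
    simp

lemma contMDiff_matrix_det {k : ℕ} {A : M → Matrix (Fin k) (Fin k) ℝ}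
    (hA : ∀ i j, SmoothFun m (fun x => A x i j)) : SmoothFun m (fun x => (A x).det) := by
  simp only [Matrix.det_apply']
  refine smoothFun_sum fun σ _ => contMDiff_const.mul ?_
  intro x
  have : ∀ s : Finset (Fin k), ContMDiffAt (𝓡 m) 𝓘(ℝ) ∞ (fun x => ∏ i ∈ s, A x (σ i) i) x := by
    intro s
    classical
    induction s using Finset.induction_on with
    | empty => simpa using contMDiffAt_const
    | insert i s hi ih =>
      simp only [Finset.prod_insert hi]
      exact (hA _ _ x).mul ih
  exact this _

/-- The entries of the inverse matrix are smooth by Cramer's rule. -/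
lemma contMDiffAt_matrix_inv {k : ℕ} {A : M → Matrix (Fin k) (Fin k) ℝ}
    (hA : ∀ i j, SmoothFun m (fun x => A x i j)) {x : M} (hx : IsUnit (A x).det) (i j : Fin k) :
    ContMDiffAt (𝓡 m) 𝓘(ℝ) ∞ (fun z => (A z)⁻¹ i j) x := by
  simp only [Matrix.inv_def, Ring.inverse_eq_inv', Matrix.smul_apply, smul_eq_mul]
  refine ContMDiffAt.mul ?_ ?_
  · exact ContDiffAt.comp_contMDiffAt (g := fun t : ℝ => t⁻¹) (contDiffAt_inv ℝ hx.ne_zero)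
      (contMDiff_matrix_det hA x)
  · simp only [Matrix.adjugate_apply]
    refine contMDiff_matrix_det (A := fun z => (A z).updateRow j (Pi.single i 1)) (fun a b => ?_) x
    simp only [Matrix.updateRow_apply]
    split_ifs
    · exact contMDiff_const
    · exact hA a b

/-- The coordinate basis `coordVec x` does not depend smoothly on `x`, so the trace is computed in a
smooth local frame. -/
lemma smoothFun_metricTrace (g : Metric m M)
    {B : ∀ x : M, TangentSpace (𝓡 m) x →ₗ[ℝ] TangentSpace (𝓡 m) x →ₗ[ℝ] ℝ}
    (hB : ∀ X Y, SmoothField X → SmoothField Y → SmoothFun m (fun x => B x (X x) (Y x))) :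
    SmoothFun m (fun x => metricTrace g x (fun v w => B x v w)) := by
  refine smoothFun_of_eventuallyEq fun x => ?_
  set E : Fin m → ∀ z : M, TangentSpace (𝓡 m) z := fun i => sext (coordVec x i) with hE
  have hEs : ∀ i, SmoothField (E i) := fun i => smoothField_sext _
  set A : M → Matrix (Fin m) (Fin m) ℝ :=
    fun z => Matrix.of fun i j => g.inner z (E i z) (E j z) with hA
  have hAs : ∀ i j, SmoothFun m (fun z => A z i j) := fun i j => smoothFun_inner g (hEs i) (hEs j)
  have hAx : A x = gram g x := by
    ext i j
    simp [hA, hE, sext_apply_self, gram_apply]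
  have hu : IsUnit (A x).det := by rw [hAx]; exact isUnit_det_gram g x
  refine ⟨fun z => ∑ i, ∑ j, (A z)⁻¹ i j * B z (E i z) (E j z), ?_, ?_⟩
  · have h : ∀ i j, ContMDiffAt (𝓡 m) 𝓘(ℝ) ∞
        (fun z => (A z)⁻¹ i j * B z (E i z) (E j z)) x := fun i j =>
      (contMDiffAt_matrix_inv hAs hu i j).mul (hB _ _ (hEs i) (hEs j) x)
    exact contMDiffAt_finsetSum fun i _ => contMDiffAt_finsetSum fun j _ => h i j
  · have hne : ∀ᶠ z in 𝓝 x, (A z).det ≠ 0 :=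
      (contMDiff_matrix_det hAs).continuous.continuousAt.eventually_ne hu.ne_zero
    filter_upwards [hne] with z hz
    exact metricTrace_eq_of_frame g (B z) (fun i => E i z) (isUnit_iff_ne_zero.2 hz)

end Cutoff

/-! ### Derivatives of functions and Lie brackets -/

section Derivatives

variable {m n : ℕ} {M N : Type*}
  [TopologicalSpace M] [ChartedSpace (EuclideanSpace ℝ (Fin m)) M] [IsManifold (𝓡 m) ∞ M]
  [TopologicalSpace N] [ChartedSpace (EuclideanSpace ℝ (Fin n)) N] [IsManifold (𝓡 n) ∞ N]

lemma dfun_add {f f' : M → ℝ} {x : M} (hf : MDifferentiableAt (𝓡 m) 𝓘(ℝ) f x)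
    (hf' : MDifferentiableAt (𝓡 m) 𝓘(ℝ) f' x) (v : TangentSpace (𝓡 m) x) :
    mvfderiv (𝓡 m) (fun z => f z + f' z) x v = mvfderiv (𝓡 m) f x v + mvfderiv (𝓡 m) f' x v := by
  rw [mvfderiv_fun_add hf hf']; rfl

lemma dfun_mul {f f' : M → ℝ} {x : M} (hf : MDifferentiableAt (𝓡 m) 𝓘(ℝ) f x)
    (hf' : MDifferentiableAt (𝓡 m) 𝓘(ℝ) f' x) (v : TangentSpace (𝓡 m) x) :
    mvfderiv (𝓡 m) (fun z => f z * f' z) x v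
      = f x * mvfderiv (𝓡 m) f' x v + f' x * mvfderiv (𝓡 m) f x v := by
  rw [mvfderiv_fun_mul hf hf']; rfl

lemma dfun_const (a : ℝ) {x : M} (v : TangentSpace (𝓡 m) x) :
    mvfderiv (𝓡 m) (fun _ : M => a) x v = 0 := by
  rw [mvfderiv_const]; rfl

lemma dfun_const_mul {f : M → ℝ} {x : M} (a : ℝ) (hf : MDifferentiableAt (𝓡 m) 𝓘(ℝ) f x)
    (v : TangentSpace (𝓡 m) x) :
    mvfderiv (𝓡 m) (fun z => a * f z) x v = a * mvfderiv (𝓡 m) f x v := by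
  rw [dfun_mul mdifferentiableAt_const hf, dfun_const]; ring

lemma dfun_congr {f f' : M → ℝ} {x : M} (h : ∀ᶠ z in 𝓝 x, f z = f' z)
    (v : TangentSpace (𝓡 m) x) : mvfderiv (𝓡 m) f x v = mvfderiv (𝓡 m) f' x v := by
  simp only [mvfderiv, ContinuousLinearMap.comp_apply]
  rw [Filter.EventuallyEq.mfderiv_eq h]
  rfl

lemma dfun_exp {f : M → ℝ} {x : M} (hf : MDifferentiableAt (𝓡 m) 𝓘(ℝ) f x)
    (v : TangentSpace (𝓡 m) x) :
    mvfderiv (𝓡 m) (fun z => Real.exp (f z)) x v = Real.exp (f x) * mvfderiv (𝓡 m) f x v := by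
  have h := mvfderiv_comp_apply x (g := Real.exp) (f := f) (I := 𝓘(ℝ)) (I' := 𝓡 m)
    Real.differentiableAt_exp.mdifferentiableAt hf v
  have h2 : ∀ w : ℝ, mvfderiv 𝓘(ℝ) Real.exp (f x) w = Real.exp (f x) * w := fun w => by
    simp only [mvfderiv, mfderiv_eq_fderiv]
    change fderiv ℝ Real.exp (f x) w = _
    rw [← toSpanSingleton_deriv]
    simp [mul_comm]
  exact h.trans (h2 _)

lemma dfun_comp {ι : N → M} {f : M → ℝ} {y : N} (hf : MDifferentiableAt (𝓡 m) 𝓘(ℝ) f (ι y))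
    (hι : MDifferentiableAt (𝓡 n) (𝓡 m) ι y) (v : TangentSpace (𝓡 n) y) :
    mvfderiv (𝓡 n) (fun z => f (ι z)) y v
      = mvfderiv (𝓡 m) f (ι y) (mfderiv (𝓡 n) (𝓡 m) ι y v) :=
  mvfderiv_comp_apply y hf hι v

lemma dfun_sum {ι : Type*} {s : Finset ι} {f : ι → M → ℝ} {x : M}
    (hf : ∀ i ∈ s, MDifferentiableAt (𝓡 m) 𝓘(ℝ) (f i) x) (v : TangentSpace (𝓡 m) x) :
    mvfderiv (𝓡 m) (fun z => ∑ i ∈ s, f i z) x v = ∑ i ∈ s, mvfderiv (𝓡 m) (f i) x v := by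
  classical
  have h : MDifferentiableAt (𝓡 m) 𝓘(ℝ) (fun z => ∑ i ∈ s, f i z) x ∧
    mvfderiv (𝓡 m) (fun z => ∑ i ∈ s, f i z) x v = ∑ i ∈ s, mvfderiv (𝓡 m) (f i) x v := by
    induction s using Finset.induction_on with
    | empty => simpa using ⟨mdifferentiableAt_const, dfun_const 0 v⟩
    | insert a s ha ih =>
      obtain ⟨h1, h2⟩ := ih fun i hi => hf i (Finset.mem_insert_of_mem hi)
      simp only [Finset.sum_insert ha]
      exact ⟨(hf a (Finset.mem_insert_self _ _)).add h1, by
        rw [dfun_add (hf a (Finset.mem_insert_self _ _)) h1, h2]⟩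
  exact h.2

/-- Expansion of a vector in a frame by means of the inverse Gram matrix, in weak form. -/
lemma inner_expand (g : Metric m M) {x : M} (e : Fin m → TangentSpace (𝓡 m) x)
    (he : IsUnit (Matrix.of fun i j => g.inner x (e i) (e j)).det) (v w : TangentSpace (𝓡 m) x) :
    g.inner x v w = g.inner x (∑ i, ∑ j,
      ((Matrix.of fun i j => g.inner x (e i) (e j))⁻¹ i j * g.inner x v (e j)) • e i) w := by
  have h := metricTrace_eq_of_frame g (B := LinearMap.mk₂ ℝ
    (fun a b => g.inner x v b * g.inner x a w)
    (fun a b c => by simp [mul_add]) (fun c a b => by simp; ring)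
    (fun a b c => by simp [add_mul]) (fun c a b => by simp; ring)) e he
  have h2 : metricTrace g x (fun a b => g.inner x a w * g.inner x v b) = g.inner x v w := by
    have h3 := metricTrace_mul (g := g) (fun a => g.inner x a w) ((g.inner x v).toLinearMap)
    refine h3.trans ?_
    have h4 : g.inner x (sharp g x fun a => g.inner x a w) v = g.inner x w v := by
      have := inner_sharp (g := g) ((innerL g x).flip w) v
      exact this.trans (inner_symm' g x v w)
    rw [inner_symm', ← h4, inner_symm']
    rfl
  simp only [LinearMap.mk₂_apply] at h
  simp only [mul_comm (g.inner x v _)] at h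
  rw [h2] at h
  rw [h, show g.inner x (∑ i, ∑ j, ((Matrix.of fun i j => g.inner x (e i) (e j))⁻¹ i j
    * g.inner x v (e j)) • e i) w = (innerL g x).flip w (∑ i, ∑ j,
      ((Matrix.of fun i j => g.inner x (e i) (e j))⁻¹ i j * g.inner x v (e j)) • e i) from rfl]
  simp only [map_sum, map_smul, LinearMap.flip_apply, innerL_apply, smul_eq_mul]
  exact Finset.sum_congr rfl fun i _ => Finset.sum_congr rfl fun j _ => by ring

lemma smoothField_mlieBracket {X Y : ∀ z : M, TangentSpace (𝓡 m) z} (hX : SmoothField X)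
    (hY : SmoothField Y) : SmoothField (VectorField.mlieBracket (𝓡 m) X Y) := fun x =>
  haveI : IsManifold (𝓡 m) (minSmoothness ℝ 2) M := by
    rw [minSmoothness_of_isRCLikeNormedField]; infer_instance
  haveI : IsManifold (𝓡 m) (∞ + 1) M := inferInstanceAs (IsManifold (𝓡 m) ∞ M)
  ContMDiffAt.mlieBracket_vectorField (m := ⊤) (n := ⊤) (hX x) (hY x) (by simp)

end Derivatives

section Brackets

variable {m n : ℕ} {M N : Type*}
  [TopologicalSpace M] [T2Space M] [ChartedSpace (EuclideanSpace ℝ (Fin m)) M]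
  [IsManifold (𝓡 m) ∞ M]
  [TopologicalSpace N] [T2Space N] [ChartedSpace (EuclideanSpace ℝ (Fin n)) N]
  [IsManifold (𝓡 n) ∞ N]

/-- The Lie bracket acts on functions as a commutator. Comparing the Jacobi identities of `X`, `Y`,
`f • Z` and of `X`, `Y`, `Z` isolates the coefficient of `Z`. -/
lemma dfun_mlieBracket {X Y : ∀ z : M, TangentSpace (𝓡 m) z} (hX : SmoothField X)
    (hY : SmoothField Y) {f : M → ℝ} (hf : SmoothFun m f) (x : M) :
    mvfderiv (𝓡 m) f x (VectorField.mlieBracket (𝓡 m) X Y x)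
      = mvfderiv (𝓡 m) (fun z => mvfderiv (𝓡 m) f z (Y z)) x (X x)
        - mvfderiv (𝓡 m) (fun z => mvfderiv (𝓡 m) f z (X z)) x (Y x) := by
  rcases subsingleton_or_nontrivial (EuclideanSpace ℝ (Fin m)) with hs | hs
  · have : ∀ v : TangentSpace (𝓡 m) x, v = 0 := fun v =>
      Subsingleton.elim (α := EuclideanSpace ℝ (Fin m)) v 0
    rw [this (VectorField.mlieBracket (𝓡 m) X Y x), this (X x), this (Y x)]
    simp
  · obtain ⟨v, hv⟩ := exists_ne (0 : EuclideanSpace ℝ (Fin m))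
    obtain ⟨Z, hZ, hZv⟩ := exists_smoothField (x := x) (show TangentSpace (𝓡 m) x from v)
    have hZ0 : Z x ≠ 0 := by rw [hZv]; exact hv
    have two_le : minSmoothness ℝ 2 ≤ ∞ := by
      rw [minSmoothness_of_isRCLikeNormedField]
      exact WithTop.coe_le_coe.2 le_top
    have jac : ∀ W : ∀ z : M, TangentSpace (𝓡 m) z, SmoothField W →
        VectorField.mlieBracket (𝓡 m) X (VectorField.mlieBracket (𝓡 m) Y W) x
          = VectorField.mlieBracket (𝓡 m) (VectorField.mlieBracket (𝓡 m) X Y) W x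
            + VectorField.mlieBracket (𝓡 m) Y (VectorField.mlieBracket (𝓡 m) X W) x :=
      fun W hW =>
        haveI : IsManifold (𝓡 m) (minSmoothness ℝ 3) M := by
          rw [minSmoothness_of_isRCLikeNormedField]; infer_instance
        VectorField.leibniz_identity_mlieBracket_apply
        ((hX x).of_le two_le) ((hY x).of_le two_le) ((hW x).of_le two_le)
    have br : ∀ U : ∀ z : M, TangentSpace (𝓡 m) z,
        VectorField.mlieBracket (𝓡 m) U (f • Z)
          = (fun z => mvfderiv (𝓡 m) f z (U z)) • Z + f • VectorField.mlieBracket (𝓡 m) U Z := by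
      intro U
      funext z
      exact VectorField.mlieBracket_smul_right (hf.mdiffAt z) (hZ.diffAt z)
    have br2 : ∀ U V : ∀ z : M, TangentSpace (𝓡 m) z, SmoothField U → SmoothField V →
        VectorField.mlieBracket (𝓡 m) U (VectorField.mlieBracket (𝓡 m) V (f • Z)) x
          = mvfderiv (𝓡 m) (fun z => mvfderiv (𝓡 m) f z (V z)) x (U x) • Z x
            + mvfderiv (𝓡 m) f x (V x) • VectorField.mlieBracket (𝓡 m) U Z x
            + (mvfderiv (𝓡 m) f x (U x) • VectorField.mlieBracket (𝓡 m) V Z x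
            + f x • VectorField.mlieBracket (𝓡 m) U (VectorField.mlieBracket (𝓡 m) V Z) x) := by
      intro U V hU hV
      have h1 := smoothField_mlieBracket hV hZ
      rw [br V, VectorField.mlieBracket_add_right
        ((SmoothField.smul (hf.deriv hV) hZ).diffAt x) ((SmoothField.smul hf h1).diffAt x),
        VectorField.mlieBracket_smul_right ((hf.deriv hV).mdiffAt x) (hZ.diffAt x),
        VectorField.mlieBracket_smul_right (hf.mdiffAt x) (h1.diffAt x)]
    have j1 := jac (f • Z) (SmoothField.smul hf hZ)
    have j2 := jac Z hZ
    rw [br2 X Y hX hY, br2 Y X hY hX, br, Pi.add_apply, Pi.smul_apply', Pi.smul_apply', j2] at j1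
    have key : (mvfderiv (𝓡 m) f x (VectorField.mlieBracket (𝓡 m) X Y x)
      - (mvfderiv (𝓡 m) (fun z => mvfderiv (𝓡 m) f z (Y z)) x (X x)
        - mvfderiv (𝓡 m) (fun z => mvfderiv (𝓡 m) f z (X z)) x (Y x))) • Z x = 0 := by
      rw [sub_smul, sub_smul, sub_eq_zero]
      have e := j1
      rw [smul_add] at e
      rw [← sub_eq_zero] at e ⊢
      rw [← neg_eq_zero, ← e]
      abel
    rcases smul_eq_zero.1 key with h | h
    · exact sub_eq_zero.1 h
    · exact absurd h hZ0

/-- A tangent vector is determined by the derivatives of smooth functions: cut-off coordinates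
suffice. -/
lemma eq_of_dfun_eq {x : M} {v w : TangentSpace (𝓡 m) x}
    (h : ∀ f : M → ℝ, SmoothFun m f → mvfderiv (𝓡 m) f x v = mvfderiv (𝓡 m) f x w) : v = w := by
  have key : ∀ i, coord i v = coord i w := by
    intro i
    obtain ⟨χ, hχ, hχ1, hs⟩ := exists_cutoff (m := m)
      ((chartAt (EuclideanSpace ℝ (Fin m)) x).open_source.mem_nhds (mem_chart_source _ x))
    have hc : ContMDiffOn (𝓡 m) 𝓘(ℝ, EuclideanSpace ℝ (Fin m)) ∞ (extChartAt (𝓡 m) x)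
      (chartAt (EuclideanSpace ℝ (Fin m)) x).source := contMDiffOn_extChartAt
    have hci : ContMDiffOn (𝓡 m) 𝓘(ℝ) ∞ (fun z => extChartAt (𝓡 m) x z i)
        (chartAt (EuclideanSpace ℝ (Fin m)) x).source :=
      (EuclideanSpace.proj (𝕜 := ℝ) i :
        EuclideanSpace ℝ (Fin m) →L[ℝ] ℝ).contMDiff.comp_contMDiffOn hc
    have hf := smoothFun_mul_of_tsupport
      (chartAt (EuclideanSpace ℝ (Fin m)) x).open_source hχ hs hci
    have hd : ∀ u : TangentSpace (𝓡 m) x,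
        mvfderiv (𝓡 m) (fun z => χ z * extChartAt (𝓡 m) x z i) x u = coord i u := by
      intro u
      rw [dfun_congr (f' := fun z => extChartAt (𝓡 m) x z i)
        (hχ1.mono fun z hz => by rw [hz, one_mul])]
      have h1 := mvfderiv_comp_apply x (I := 𝓘(ℝ, EuclideanSpace ℝ (Fin m))) (I' := 𝓡 m)
        (g := (EuclideanSpace.proj (𝕜 := ℝ) i : EuclideanSpace ℝ (Fin m) →L[ℝ] ℝ))
        (f := extChartAt (𝓡 m) x)
        (ContinuousLinearMap.differentiableAt _).mdifferentiableAt
        (mdifferentiableAt_extChartAt (mem_chart_source _ x)) u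
      refine h1.trans ?_
      rw [mfderiv_extChartAt_self]
      simp only [mvfderiv, mfderiv_eq_fderiv, ContinuousLinearMap.fderiv]
      rfl
    rw [← hd v, ← hd w]
    exact h _ hf
  rw [← sum_coord v, ← sum_coord w]
  simp only [key]

/-- A vector field is smooth as soon as its products with smooth fields are. -/
lemma smoothField_of_inner (g : Metric m M) {V : ∀ z : M, TangentSpace (𝓡 m) z}
    (h : ∀ W, SmoothField W → SmoothFun m (fun z => g.inner z (V z) (W z))) :
    SmoothField V := by
  intro x
  set E : Fin m → ∀ z : M, TangentSpace (𝓡 m) z := fun i => sext (coordVec x i) with hE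
  have hEs : ∀ i, SmoothField (E i) := fun i => smoothField_sext _
  set A : M → Matrix (Fin m) (Fin m) ℝ :=
    fun z => Matrix.of fun i j => g.inner z (E i z) (E j z) with hA
  have hAs : ∀ i j, SmoothFun m (fun z => A z i j) := fun i j =>
    smoothFun_inner g (hEs i) (hEs j)
  have hAx : A x = gram g x := by
    ext i j
    simp [hA, hE, sext_apply_self, gram_apply]
  have hu : IsUnit (A x).det := by rw [hAx]; exact isUnit_det_gram g _
  have hne : ∀ᶠ z in 𝓝 x, (A z).det ≠ 0 :=
    (contMDiff_matrix_det hAs).continuous.continuousAt.eventually_ne hu.ne_zero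
  have hs : ContMDiffAt (𝓡 m) (𝓡 m).tangent ∞ (fun z => (⟨z, ∑ i, ∑ j,
      ((A z)⁻¹ i j * g.inner z (V z) (E j z)) • E i z⟩ : TangentBundle (𝓡 m) M)) x := by
    refine ContMDiffAt.sum_section (t := fun i z => ∑ j,
      ((A z)⁻¹ i j * g.inner z (V z) (E j z)) • E i z) fun i _ => ?_
    refine ContMDiffAt.sum_section (t := fun j z =>
      ((A z)⁻¹ i j * g.inner z (V z) (E j z)) • E i z) fun j _ => ?_
    exact ContMDiffAt.smul_section (s := E i)
      ((contMDiffAt_matrix_inv hAs hu i j).mul (h (E j) (hEs j) x)) (hEs i x)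
  refine hs.congr_of_eventuallyEq ?_
  filter_upwards [hne] with z hz
  congr 1
  refine eq_of_inner_eq g z fun w => ?_
  have hE' := inner_expand g (fun i => E i z) (isUnit_iff_ne_zero.2 hz) (V z) w
  exact hE'

end Brackets

/-! ### Calculus of a Weyl structure -/

namespace WeylStructure

variable {m : ℕ} {M : Type*} [TopologicalSpace M] [T2Space M]
  [ChartedSpace (EuclideanSpace ℝ (Fin m)) M] [IsManifold (𝓡 m) ∞ M]
  {c : ConformalStructure m M} (D : WeylStructure c)

/-- The vector field `∇_X Y`. -/
def nab (X Y : ∀ z : M, TangentSpace (𝓡 m) z) : ∀ z : M, TangentSpace (𝓡 m) z :=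
  fun z => D.conn Y z (X z)

lemma conn_add {Y Y' : ∀ z : M, TangentSpace (𝓡 m) z} {x : M} (hY : DiffFieldAt Y x)
    (hY' : DiffFieldAt Y' x) (v : TangentSpace (𝓡 m) x) :
    D.conn (Y + Y') x v = D.conn Y x v + D.conn Y' x v := by
  rw [D.conn.isCovariantDerivativeOn.add hY hY']; rfl

lemma conn_smul {f : M → ℝ} {Y : ∀ z : M, TangentSpace (𝓡 m) z} {x : M}
    (hf : MDifferentiableAt (𝓡 m) 𝓘(ℝ) f x) (hY : DiffFieldAt Y x) (v : TangentSpace (𝓡 m) x) :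
    D.conn (f • Y) x v = f x • D.conn Y x v + mvfderiv (𝓡 m) f x v • Y x := by
  rw [D.conn.isCovariantDerivativeOn.leibniz hY hf]; rfl

lemma conn_congr {Y Y' : ∀ z : M, TangentSpace (𝓡 m) z} {x : M} (hY : DiffFieldAt Y x)
    (h : ∀ᶠ z in 𝓝 x, Y z = Y' z) : D.conn Y x = D.conn Y' x := by
  refine D.conn.isCovariantDerivativeOn.congr_of_eventuallyEq hY ?_ Filter.univ_mem h
  refine hY.congr_of_eventuallyEq ?_
  filter_upwards [h] with z hz
  rw [hz]

lemma smoothField_nab {X Y : ∀ z : M, TangentSpace (𝓡 m) z} (hX : SmoothField X)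
    (hY : SmoothField Y) : SmoothField (D.nab X Y) := by
  have h := D.smooth.contMDiff.contMDiff (σ := Y) (contMDiffOn_univ.2 hY)
  exact ContMDiff.clm_bundle_apply (b := id) (contMDiffOn_univ.1 h) hX

lemma nab_add_left (X X' Y : ∀ z : M, TangentSpace (𝓡 m) z) :
    D.nab (X + X') Y = D.nab X Y + D.nab X' Y := by
  funext z; simp [nab]

lemma nab_smul_left (f : M → ℝ) (X Y : ∀ z : M, TangentSpace (𝓡 m) z) :
    D.nab (f • X) Y = f • D.nab X Y := by
  funext z; simp [nab]

lemma nab_add_right (X : ∀ z : M, TangentSpace (𝓡 m) z) {Y Y' : ∀ z : M, TangentSpace (𝓡 m) z}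
    (hY : SmoothField Y) (hY' : SmoothField Y') : D.nab X (Y + Y') = D.nab X Y + D.nab X Y' := by
  funext z; exact D.conn_add (hY.diffAt z) (hY'.diffAt z) _

lemma nab_smul_right {f : M → ℝ} (hf : SmoothFun m f) (X : ∀ z : M, TangentSpace (𝓡 m) z)
    {Y : ∀ z : M, TangentSpace (𝓡 m) z} (hY : SmoothField Y) :
    D.nab X (f • Y) = f • D.nab X Y + (fun z => mvfderiv (𝓡 m) f z (X z)) • Y := by
  funext z; exact D.conn_smul (hf.mdiffAt z) (hY.diffAt z) _

lemma mlieBracket_eq {X Y : ∀ z : M, TangentSpace (𝓡 m) z} {x : M} (hX : DiffFieldAt X x)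
    (hY : DiffFieldAt Y x) : VectorField.mlieBracket (𝓡 m) X Y x
      = D.conn Y x (X x) - D.conn X x (Y x) := (D.torsion_free X Y x hX hY).symm

lemma dfun_inner (g : c.metrics) {Y Z : ∀ z : M, TangentSpace (𝓡 m) z} {x : M}
    (hY : DiffFieldAt Y x) (hZ : DiffFieldAt Z x) (v : TangentSpace (𝓡 m) x) :
    mvfderiv (𝓡 m) (fun z => g.1.inner z (Y z) (Z z)) x v
      = g.1.inner x (D.conn Y x v) (Z x) + g.1.inner x (Y x) (D.conn Z x v)
        - 2 * D.lee g x v * g.1.inner x (Y x) (Z x) := by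
  have := D.conformal g Y Z x hY hZ v
  linarith

/-- A Lee form can be recovered from `∇` and `g(Y, Y)` for a field `Y` without zeros, hence it is
smooth. -/
lemma smoothFun_lee (g : c.metrics) {X : ∀ z : M, TangentSpace (𝓡 m) z} (hX : SmoothField X) :
    SmoothFun m (fun z => D.lee g z (X z)) := by
  refine smoothFun_of_eventuallyEq fun x => ?_
  rcases subsingleton_or_nontrivial (EuclideanSpace ℝ (Fin m)) with hs | hs
  · refine ⟨fun _ => 0, contMDiffAt_const, Filter.Eventually.of_forall fun z => ?_⟩
    rw [show X z = 0 from Subsingleton.elim (α := EuclideanSpace ℝ (Fin m)) _ _, map_zero]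
  · obtain ⟨v, hv⟩ := exists_ne (0 : EuclideanSpace ℝ (Fin m))
    obtain ⟨Y, hY, hYv⟩ := exists_smoothField (x := x) (show TangentSpace (𝓡 m) x from v)
    have hY0 : Y x ≠ 0 := by rw [hYv]; exact hv
    have hg := smoothFun_inner g.1 hY hY
    have hg0 : g.1.inner x (Y x) (Y x) ≠ 0 := (g.1.pos x _ hY0).ne'
    refine ⟨fun z => (g.1.inner z (D.nab X Y z) (Y z)
      - 1 / 2 * mvfderiv (𝓡 m) (fun z => g.1.inner z (Y z) (Y z)) z (X z))
        * (g.1.inner z (Y z) (Y z))⁻¹, ?_, ?_⟩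
    · refine ContMDiffAt.mul ((smoothFun_inner g.1 (D.smoothField_nab hX hY) hY).sub
        (contMDiff_const.mul (hg.deriv hX)) x) ?_
      exact ContDiffAt.comp_contMDiffAt (g := fun t : ℝ => t⁻¹) (contDiffAt_inv ℝ hg0) (hg x)
    · filter_upwards [hg.continuous.continuousAt.eventually_ne hg0] with z hz
      rw [D.dfun_inner g (hY.diffAt z) (hY.diffAt z) (X z), nab]
      rw [inner_symm' g.1 z (Y z) (D.conn Y z (X z))]
      field_simp
      ring

/-- The Lee form in the metric `e^{2u} g` is that in `g` minus `du`, since `e^{2u} g` corresponds to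
the section `e^{-u} l` of `L`. -/
lemma lee_gauge {g g' : c.metrics} {u : M → ℝ} (hu : SmoothFun m u)
    (h : ∀ x, ScalesBy g.1 g'.1 x (u x)) (x : M) (v : TangentSpace (𝓡 m) x) :
    D.lee g' x v = D.lee g x v - mvfderiv (𝓡 m) u x v := by
  by_cases hv : v = 0
  · simp [hv]
  obtain ⟨Y, hY, hYv⟩ := exists_smoothField v
  have h1 := D.dfun_inner g (hY.diffAt x) (hY.diffAt x) v
  have h2 := D.dfun_inner g' (hY.diffAt x) (hY.diffAt x) v
  have he : MDifferentiableAt (𝓡 m) 𝓘(ℝ) (fun z => 2 * u z) x :=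
    SmoothFun.mdiffAt (contMDiff_const.mul hu) x
  have he' : MDifferentiableAt (𝓡 m) 𝓘(ℝ) (fun z => Real.exp (2 * u z)) x :=
    SmoothFun.mdiffAt (Real.contDiff_exp.contMDiff.comp (contMDiff_const.mul hu)) x
  simp only [h _ _ _] at h2
  rw [dfun_mul he' ((smoothFun_inner g.1 hY hY).mdiffAt x), dfun_exp he,
    dfun_const_mul 2 (hu.mdiffAt x), h1] at h2
  have hpos : g.1.inner x (Y x) (Y x) ≠ 0 := (g.1.pos x _ (by rwa [hYv])).ne'
  have hexp := (Real.exp_pos (2 * u x)).ne'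
  have h3 : (Real.exp (2 * u x) * g.1.inner x (Y x) (Y x))
      * (D.lee g' x v - (D.lee g x v - mvfderiv (𝓡 m) u x v)) = 0 := by
    linear_combination (1 / 2 : ℝ) * h2
  rcases mul_eq_zero.1 h3 with h4 | h4
  · exact absurd h4 (mul_ne_zero hexp hpos)
  · linarith

/-! ### Covariant derivatives of one-forms and Hessians -/

/-- The covariant derivative `(∇_v α)(w)` of a one-form `α`. It is defined by linear extension in
`w` from the smooth fields `sext (coordVec x i)`, so that bilinearity is built in; `covForm_apply`
is the usual formula. -/
def covForm (α : ∀ z : M, TangentSpace (𝓡 m) z →L[ℝ] ℝ) (x : M) :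
    TangentSpace (𝓡 m) x →ₗ[ℝ] TangentSpace (𝓡 m) x →ₗ[ℝ] ℝ :=
  LinearMap.mk₂ ℝ (fun v w => ∑ i, coord i w *
    (mvfderiv (𝓡 m) (fun z => α z (sext (coordVec x i) z)) x v
      - α x (D.conn (sext (coordVec x i)) x v)))
    (fun v v' w => by
      rw [← Finset.sum_add_distrib]
      exact Finset.sum_congr rfl fun i _ => by simp only [map_add]; ring)
    (fun a v w => by
      rw [Finset.smul_sum]
      exact Finset.sum_congr rfl fun i _ => by simp only [map_smul, smul_eq_mul]; ring)
    (fun v w w' => by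
      rw [← Finset.sum_add_distrib]
      exact Finset.sum_congr rfl fun i _ => by rw [coord_add]; ring)
    (fun a v w => by
      rw [Finset.smul_sum]
      exact Finset.sum_congr rfl fun i _ => by rw [coord_smul, smul_eq_mul]; ring)

/-- One-forms that are smooth, in the sense that they send smooth fields to smooth functions. -/
abbrev _root_.ConfGeom.SmoothForm (α : ∀ z : M, TangentSpace (𝓡 m) z →L[ℝ] ℝ) : Prop :=
  ∀ X, SmoothField X → SmoothFun m (fun z => α z (X z))

lemma covForm_apply {α : ∀ z : M, TangentSpace (𝓡 m) z →L[ℝ] ℝ} (hα : SmoothForm α)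
    {x : M} (v : TangentSpace (𝓡 m) x) {Y : ∀ z : M, TangentSpace (𝓡 m) z} (hY : SmoothField Y) :
    D.covForm α x v (Y x)
      = mvfderiv (𝓡 m) (fun z => α z (Y z)) x v - α x (D.conn Y x v) := by
  refine (tensorial_eq_sum (x := x)
    (Φ := fun Y => mvfderiv (𝓡 m) (fun z => α z (Y z)) x v - α x (D.conn Y x v)) ?_ ?_ hY).symm
  · intro X Y hX hY
    simp only [Pi.add_apply, map_add]
    rw [dfun_add ((hα X hX).mdiffAt x) ((hα Y hY).mdiffAt x),
      D.conn_add (hX.diffAt x) (hY.diffAt x), map_add]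
    ring
  · intro f X hf hX
    simp only [Pi.smul_apply', map_smul, smul_eq_mul]
    rw [dfun_mul (hf.mdiffAt x) ((hα X hX).mdiffAt x), D.conn_smul (hf.mdiffAt x) (hX.diffAt x),
      map_add, map_smul, map_smul, smul_eq_mul, smul_eq_mul]
    ring

lemma conn_sext {x : M} (w : TangentSpace (𝓡 m) x) : D.conn (ext w) x = D.conn (sext w) x :=
  D.conn_congr (diffFieldAt_ext w) ((sext_eventuallyEq w).mono fun _ h => h.symm)

lemma covForm_ext {α : ∀ z : M, TangentSpace (𝓡 m) z →L[ℝ] ℝ} (hα : SmoothForm α)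
    {x : M} (v w : TangentSpace (𝓡 m) x) :
    D.covForm α x v w
      = mvfderiv (𝓡 m) (fun z => α z (ext w z)) x v - α x (D.conn (ext w) x v) := by
  have h := D.covForm_apply hα v (smoothField_sext w)
  rw [sext_apply_self] at h
  rw [h, conn_sext, dfun_congr ((sext_eventuallyEq w).mono fun z hz => by rw [hz])]

lemma smoothFun_covForm {α : ∀ z : M, TangentSpace (𝓡 m) z →L[ℝ] ℝ} (hα : SmoothForm α)
    {X Y : ∀ z : M, TangentSpace (𝓡 m) z} (hX : SmoothField X) (hY : SmoothField Y) :
    SmoothFun m (fun x => D.covForm α x (X x) (Y x)) := by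
  simp only [fun x => D.covForm_apply hα (X x) hY]
  exact ((hα Y hY).deriv hX).sub (hα _ (D.smoothField_nab hX hY))

lemma smoothForm_lee (g : c.metrics) : SmoothForm (D.lee g) := fun _ hX => D.smoothFun_lee g hX

lemma _root_.ConfGeom.smoothForm_mvfderiv {f : M → ℝ} (hf : SmoothFun m f) :
    SmoothForm (mvfderiv (𝓡 m) f) := fun _ hX => hf.deriv hX

/-- The covariant derivative of a section of `L^k` as a one-form. -/
def derivL (g : c.metrics) (k : ℝ) (f : M → ℝ) (x : M) : TangentSpace (𝓡 m) x →L[ℝ] ℝ :=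
  mvfderiv (𝓡 m) f x + (k * f x) • D.lee g x

lemma derivL_apply (g : c.metrics) (k : ℝ) (f : M → ℝ) (x : M) (v : TangentSpace (𝓡 m) x) :
    D.derivL g k f x v = D.deriv g k f x v := by
  simp only [derivL, deriv, _root_.add_apply, _root_.smul_apply,
    smul_eq_mul]
  ring

lemma smoothForm_derivL (g : c.metrics) (k : ℝ) {f : M → ℝ} (hf : SmoothFun m f) :
    SmoothForm (D.derivL g k f) := fun X hX => by
  have h : (fun z => D.derivL g k f z (X z))
    = fun z => mvfderiv (𝓡 m) f z (X z) + k * f z * D.lee g z (X z) := rfl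
  rw [h]
  exact (hf.deriv hX).add ((contMDiff_const.mul hf).mul (D.smoothFun_lee g hX))

/-- The Hessian as the covariant derivative of the one-form `∇s`, the values of which are in `L^k`.
-/
lemma hess_eq (g : c.metrics) (k : ℝ) {f : M → ℝ} (hf : SmoothFun m f) (x : M)
    (v w : TangentSpace (𝓡 m) x) :
    D.hess g k f x v w = D.covForm (D.derivL g k f) x v w
      + k * D.lee g x v * D.deriv g k f x w := by
  rw [D.covForm_ext (D.smoothForm_derivL g k hf)]
  simp only [derivL_apply, hess]
  conv_lhs => rw [deriv]
  rw [ext_apply_self]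
  ring

/-- The Hessian of a function is symmetric. -/
lemma covForm_dfun_symm {f : M → ℝ} (hf : SmoothFun m f) (x : M) (v w : TangentSpace (𝓡 m) x) :
    D.covForm (mvfderiv (𝓡 m) f) x v w = D.covForm (mvfderiv (𝓡 m) f) x w v := by
  have h1 := D.covForm_apply (smoothForm_mvfderiv hf) v (smoothField_sext w)
  have h2 := D.covForm_apply (smoothForm_mvfderiv hf) w (smoothField_sext v)
  have h3 := dfun_mlieBracket (smoothField_sext v) (smoothField_sext w) hf x
  rw [D.mlieBracket_eq ((smoothField_sext v).diffAt x) ((smoothField_sext w).diffAt x),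
    map_sub] at h3
  simp only [sext_apply_self] at h1 h2 h3
  rw [h1, h2]
  linarith

end WeylStructure

/-! ### Curvature is a tensor -/

namespace WeylStructure

variable {m : ℕ} {M : Type*} [TopologicalSpace M] [T2Space M]
  [ChartedSpace (EuclideanSpace ℝ (Fin m)) M] [IsManifold (𝓡 m) ∞ M]
  {c : ConformalStructure m M} (D : WeylStructure c)

/-- The curvature operator `R_{X,Y} Z` on vector fields. -/
def curvField (X Y Z : ∀ z : M, TangentSpace (𝓡 m) z) (x : M) : TangentSpace (𝓡 m) x :=
  D.conn (D.nab Y Z) x (X x) - D.conn (D.nab X Z) x (Y x)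
    - D.conn Z x (VectorField.mlieBracket (𝓡 m) X Y x)

variable {X X' Y Z Z' : ∀ z : M, TangentSpace (𝓡 m) z} {f : M → ℝ} {x : M}

lemma curvField_swap (X Y Z : ∀ z : M, TangentSpace (𝓡 m) z) (x : M) :
    D.curvField X Y Z x = - D.curvField Y X Z x := by
  have h : VectorField.mlieBracket (𝓡 m) X Y x = - VectorField.mlieBracket (𝓡 m) Y X x :=
    VectorField.mlieBracket_swap_apply
  simp only [curvField, h, map_neg]
  abel

lemma curvField_add_left (hX : SmoothField X) (hX' : SmoothField X') (hZ : SmoothField Z) :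
    D.curvField (X + X') Y Z x = D.curvField X Y Z x + D.curvField X' Y Z x := by
  simp only [curvField, nab_add_left]
  rw [D.conn_add ((D.smoothField_nab hX hZ).diffAt x) ((D.smoothField_nab hX' hZ).diffAt x),
    VectorField.mlieBracket_add_left (hX.diffAt x) (hX'.diffAt x)]
  simp only [Pi.add_apply, map_add]
  abel

lemma curvField_smul_left (hf : SmoothFun m f) (hX : SmoothField X) (hZ : SmoothField Z) :
    D.curvField (f • X) Y Z x = f x • D.curvField X Y Z x := by
  simp only [curvField, nab_smul_left]
  rw [D.conn_smul (hf.mdiffAt x) ((D.smoothField_nab hX hZ).diffAt x),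
    VectorField.mlieBracket_smul_left (hf.mdiffAt x) (hX.diffAt x)]
  simp only [Pi.smul_apply', map_add, map_smul, nab, neg_smul, map_neg]
  module

lemma curvField_add_right (hX : SmoothField X) (hY : SmoothField Y) (hZ : SmoothField Z)
    (hZ' : SmoothField Z') :
    D.curvField X Y (Z + Z') x = D.curvField X Y Z x + D.curvField X Y Z' x := by
  simp only [curvField, D.nab_add_right _ hZ hZ']
  rw [D.conn_add ((D.smoothField_nab hY hZ).diffAt x) ((D.smoothField_nab hY hZ').diffAt x),
    D.conn_add ((D.smoothField_nab hX hZ).diffAt x) ((D.smoothField_nab hX hZ').diffAt x),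
    D.conn_add (hZ.diffAt x) (hZ'.diffAt x)]
  abel

lemma curvField_smul_right (hf : SmoothFun m f) (hX : SmoothField X) (hY : SmoothField Y)
    (hZ : SmoothField Z) : D.curvField X Y (f • Z) x = f x • D.curvField X Y Z x := by
  simp only [curvField, D.nab_smul_right hf _ hZ]
  have h : ∀ {U V : ∀ z : M, TangentSpace (𝓡 m) z} (hU : SmoothField U) (hV : SmoothField V),
      D.conn (f • D.nab V Z + (fun z => mvfderiv (𝓡 m) f z (V z)) • Z) x (U x)
        = f x • D.conn (D.nab V Z) x (U x) + mvfderiv (𝓡 m) f x (U x) • D.conn Z x (V x)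
        + (mvfderiv (𝓡 m) f x (V x) • D.conn Z x (U x)
          + mvfderiv (𝓡 m) (fun z => mvfderiv (𝓡 m) f z (V z)) x (U x) • Z x) := by
    intro U V hU hV
    have hVZ := D.smoothField_nab hV hZ
    rw [D.conn_add ((SmoothField.smul hf hVZ).diffAt x)
      ((SmoothField.smul (hf.deriv hV) hZ).diffAt x), D.conn_smul (hf.mdiffAt x) (hVZ.diffAt x),
      D.conn_smul ((hf.deriv hV).mdiffAt x) (hZ.diffAt x)]
    rfl
  rw [h hX hY, h hY hX, D.conn_smul (hf.mdiffAt x) (hZ.diffAt x), dfun_mlieBracket hX hY hf x]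
  module

lemma curv_eq_curvField (v w u : TangentSpace (𝓡 m) x) :
    D.curv x v w u = D.curvField (sext v) (sext w) (sext u) x := by
  have h : ∀ a b : TangentSpace (𝓡 m) x,
      D.conn (fun z => D.conn (ext a) z (ext b z)) x = D.conn (D.nab (sext b) (sext a)) x := by
    intro a b
    refine (D.conn_congr ((D.smoothField_nab (smoothField_sext b) (smoothField_sext a)).diffAt x)
      ?_).symm
    filter_upwards [(sext_eventuallyEq a).eventually_nhds, sext_eventuallyEq b] with z h1 h2
    rw [nab, h2, D.conn_congr ((smoothField_sext a).diffAt z) h1]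
  have hb : VectorField.mlieBracket (𝓡 m) (ext v) (ext w) x
      = VectorField.mlieBracket (𝓡 m) (sext v) (sext w) x :=
    Filter.EventuallyEq.mlieBracket_vectorField_eq
      ((sext_eventuallyEq v).mono fun _ h => h.symm) ((sext_eventuallyEq w).mono fun _ h => h.symm)
  simp only [curv, curvField, h, hb, sext_apply_self, conn_sext]

/-- Tensoriality of the curvature. -/
lemma curv_apply (hX : SmoothField X) (hY : SmoothField Y) (hZ : SmoothField Z) :
    D.curv x (X x) (Y x) (Z x) = D.curvField X Y Z x := by
  have hl : ∀ {X X' Y Z : ∀ z : M, TangentSpace (𝓡 m) z}, SmoothField X → SmoothField X' →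
      SmoothField Z → X x = X' x → D.curvField X Y Z x = D.curvField X' Y Z x :=
    fun {X X' Y Z} hX hX' hZ h => tensorial_congr (Φ := fun U => D.curvField U Y Z x)
      (fun _ _ h1 h2 => D.curvField_add_left h1 h2 hZ)
      (fun _ _ h1 h2 => D.curvField_smul_left h1 h2 hZ) hX hX' h
  rw [curv_eq_curvField, hl (smoothField_sext _) hX (smoothField_sext _) (sext_apply_self _),
    curvField_swap, hl (smoothField_sext _) hY (smoothField_sext _) (sext_apply_self _),
    ← curvField_swap]
  exact tensorial_congr (Φ := fun U => D.curvField X Y U x)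
    (fun _ _ h1 h2 => D.curvField_add_right hX hY h1 h2)
    (fun _ _ h1 h2 => D.curvField_smul_right h1 hX hY h2) (smoothField_sext _) hZ
    (sext_apply_self _)

lemma curv_swap (v w u : TangentSpace (𝓡 m) x) : D.curv x v w u = - D.curv x w v u := by
  rw [curv_eq_curvField, curvField_swap, ← curv_eq_curvField]

lemma curv_add_left (v v' w u : TangentSpace (𝓡 m) x) :
    D.curv x (v + v') w u = D.curv x v w u + D.curv x v' w u := by
  have h := D.curv_apply (x := x) (SmoothField.add (smoothField_sext v) (smoothField_sext v'))
    (smoothField_sext w) (smoothField_sext u)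
  rw [D.curvField_add_left (smoothField_sext v) (smoothField_sext v') (smoothField_sext u)] at h
  simpa only [Pi.add_apply, sext_apply_self, ← curv_eq_curvField] using h

lemma curv_smul_left (a : ℝ) (v w u : TangentSpace (𝓡 m) x) :
    D.curv x (a • v) w u = a • D.curv x v w u := by
  have h := D.curv_apply (x := x) (SmoothField.smul (f := fun _ => a) contMDiff_const
    (smoothField_sext v)) (smoothField_sext w) (smoothField_sext u)
  rw [D.curvField_smul_left contMDiff_const (smoothField_sext v) (smoothField_sext u)] at h
  simpa only [Pi.smul_apply', sext_apply_self, ← curv_eq_curvField] using h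

lemma curv_add_middle (v w w' u : TangentSpace (𝓡 m) x) :
    D.curv x v (w + w') u = D.curv x v w u + D.curv x v w' u := by
  rw [curv_swap, curv_add_left, neg_add, ← curv_swap, ← curv_swap]

lemma curv_smul_middle (a : ℝ) (v w u : TangentSpace (𝓡 m) x) :
    D.curv x v (a • w) u = a • D.curv x v w u := by
  rw [curv_swap, curv_smul_left, ← smul_neg, ← curv_swap]

lemma curv_add_right (v w u u' : TangentSpace (𝓡 m) x) :
    D.curv x v w (u + u') = D.curv x v w u + D.curv x v w u' := by
  have h := D.curv_apply (x := x) (smoothField_sext v) (smoothField_sext w)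
    (SmoothField.add (smoothField_sext u) (smoothField_sext u'))
  rw [D.curvField_add_right (smoothField_sext v) (smoothField_sext w) (smoothField_sext u)
    (smoothField_sext u')] at h
  simpa only [Pi.add_apply, sext_apply_self, ← curv_eq_curvField] using h

lemma curv_smul_right (a : ℝ) (v w u : TangentSpace (𝓡 m) x) :
    D.curv x v w (a • u) = a • D.curv x v w u := by
  have h := D.curv_apply (x := x) (smoothField_sext v) (smoothField_sext w)
    (SmoothField.smul (f := fun _ => a) contMDiff_const (smoothField_sext u))
  rw [D.curvField_smul_right contMDiff_const (smoothField_sext v) (smoothField_sext w)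
    (smoothField_sext u)] at h
  simpa only [Pi.smul_apply', sext_apply_self, ← curv_eq_curvField] using h

/-- The curvature as a trilinear map. -/
def curvL (x : M) : TangentSpace (𝓡 m) x →ₗ[ℝ] TangentSpace (𝓡 m) x →ₗ[ℝ]
    TangentSpace (𝓡 m) x →ₗ[ℝ] TangentSpace (𝓡 m) x :=
  LinearMap.mk₂ ℝ (fun v w => ⟨⟨D.curv x v w, D.curv_add_right v w⟩,
    fun a u => D.curv_smul_right a v w u⟩)
    (fun v v' w => LinearMap.ext fun u => D.curv_add_left v v' w u)
    (fun a v w => LinearMap.ext fun u => D.curv_smul_left a v w u)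
    (fun v w w' => LinearMap.ext fun u => D.curv_add_middle v w w' u)
    (fun a v w => LinearMap.ext fun u => D.curv_smul_middle a v w u)

lemma smoothField_curv (hX : SmoothField X) (hY : SmoothField Y) (hZ : SmoothField Z) :
    SmoothField (fun z => D.curv z (X z) (Y z) (Z z)) := by
  have h : (fun z => D.curv z (X z) (Y z) (Z z)) = D.nab X (D.nab Y Z) + (-1 : M → ℝ) •
      D.nab Y (D.nab X Z) + (-1 : M → ℝ) • D.nab (VectorField.mlieBracket (𝓡 m) X Y) Z := by
    funext z
    rw [D.curv_apply hX hY hZ]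
    simp only [curvField, nab, Pi.add_apply, Pi.smul_apply', Pi.neg_apply, Pi.one_apply]
    module
  rw [h]
  have hc : SmoothFun m (-1 : M → ℝ) := contMDiff_const (c := (-1 : ℝ))
  exact ((D.smoothField_nab hX (D.smoothField_nab hY hZ)).add
    (SmoothField.smul hc (D.smoothField_nab hY (D.smoothField_nab hX hZ)))).add
    (SmoothField.smul hc (D.smoothField_nab (smoothField_mlieBracket hX hY) hZ))

/-- The Ricci tensor as a bilinear map. -/
def ricciL (x : M) : TangentSpace (𝓡 m) x →ₗ[ℝ] TangentSpace (𝓡 m) x →ₗ[ℝ] ℝ :=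
  LinearMap.mk₂ ℝ (D.ricci x)
    (fun v w u => by simp only [ricci, curv_add_middle, coord_add, Finset.sum_add_distrib])
    (fun a v u => by
      simp only [ricci, curv_smul_middle, coord_smul, smul_eq_mul, Finset.mul_sum])
    (fun v w u => by simp only [ricci, curv_add_right, coord_add, Finset.sum_add_distrib])
    (fun a v u => by
      simp only [ricci, curv_smul_right, coord_smul, smul_eq_mul, Finset.mul_sum])

/-- The Faraday form as a bilinear map. -/
def faradayL (x : M) : TangentSpace (𝓡 m) x →ₗ[ℝ] TangentSpace (𝓡 m) x →ₗ[ℝ] ℝ :=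
  LinearMap.mk₂ ℝ (D.faraday x)
    (fun v w u => by
      simp only [faraday, curv_add_left, coord_add, Finset.sum_add_distrib, add_div])
    (fun a v u => by
      simp only [faraday, curv_smul_left, coord_smul, smul_eq_mul, ← Finset.mul_sum, mul_div_assoc])
    (fun v w u => by
      simp only [faraday, curv_add_middle, coord_add, Finset.sum_add_distrib, add_div])
    (fun a v u => by
      simp only [faraday, curv_smul_middle, coord_smul, smul_eq_mul, ← Finset.mul_sum,
        mul_div_assoc])

/-- The Ricci tensor as a metric trace, for any metric. -/
lemma ricci_eq (g : Metric m M) (v w : TangentSpace (𝓡 m) x) :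
    D.ricci x v w = metricTrace g x (fun a b => g.inner x (D.curv x a v w) b) :=
  (metricTrace_inner (g := g) (fun a => D.curv x a v w)).symm

lemma faraday_eq (g : Metric m M) (v w : TangentSpace (𝓡 m) x) :
    D.faraday x v w = metricTrace g x (fun a b => g.inner x (D.curv x v w a) b) / m := by
  rw [metricTrace_inner]; rfl

lemma smoothFun_ricci (g : Metric m M) (hX : SmoothField X) (hY : SmoothField Y) :
    SmoothFun m (fun x => D.ricci x (X x) (Y x)) := by
  simp only [D.ricci_eq g]
  exact smoothFun_metricTrace g (B := fun x => (innerL g x).comp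
    (((D.curvL x).flip (X x)).flip (Y x)))
    fun U V hU hV => smoothFun_inner g (D.smoothField_curv hU hX hY) hV

lemma smoothFun_faraday (g : Metric m M) (hX : SmoothField X) (hY : SmoothField Y) :
    SmoothFun m (fun x => D.faraday x (X x) (Y x)) := by
  simp only [D.faraday_eq g, div_eq_mul_inv]
  exact (smoothFun_metricTrace g (B := fun x => (innerL g x).comp (D.curvL x (X x) (Y x)))
    fun U V hU hV => smoothFun_inner g (D.smoothField_curv hX hY hU) hV).mul contMDiff_const

lemma smoothFun_scal (g : c.metrics) : SmoothFun m (D.scal g) :=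
  smoothFun_metricTrace g.1 (B := D.ricciL) fun _ _ hU hV => D.smoothFun_ricci g.1 hU hV

end WeylStructure

/-! ### Change of the Weyl structure -/

namespace WeylStructure

variable {m : ℕ} {M : Type*} [TopologicalSpace M] [T2Space M]
  [ChartedSpace (EuclideanSpace ℝ (Fin m)) M] [IsManifold (𝓡 m) ∞ M]
  {c : ConformalStructure m M} (D D' : WeylStructure c) (g : c.metrics)

/-- The one-form `γ = D' - D` that is the difference of the connections induced on `L`. It does not
depend on the metric, see `leeDiff_eq`. -/
def leeDiff (x : M) : TangentSpace (𝓡 m) x →L[ℝ] ℝ := D'.lee g x - D.lee g x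

lemma leeDiff_apply (x : M) (v : TangentSpace (𝓡 m) x) :
    D.leeDiff D' g x v = D'.lee g x v - D.lee g x v := rfl

lemma leeDiff_eq (g g' : c.metrics) (x : M) : D.leeDiff D' g' x = D.leeDiff D' g x := by
  obtain ⟨u, hu, h⟩ := (c.mem_iff g.1 g.2 g'.1).1 g'.2
  ext v
  rw [leeDiff_apply, leeDiff_apply, D.lee_gauge hu h, D'.lee_gauge hu h]
  ring

lemma smoothForm_leeDiff : SmoothForm (D.leeDiff D' g) := fun _ hX =>
  (D'.smoothFun_lee g hX).sub (D.smoothFun_lee g hX)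

/-- The vector field `γ^♯`. -/
def leeSharp (x : M) : TangentSpace (𝓡 m) x := sharp g.1 x (D.leeDiff D' g x)

lemma inner_leeSharp (x : M) (v : TangentSpace (𝓡 m) x) :
    g.1.inner x (D.leeSharp D' g x) v = D.leeDiff D' g x v :=
  inner_sharp (D.leeDiff D' g x).toLinearMap v

lemma inner_leeSharp' (x : M) (v : TangentSpace (𝓡 m) x) :
    g.1.inner x v (D.leeSharp D' g x) = D.leeDiff D' g x v := by
  rw [inner_symm', inner_leeSharp]

lemma smoothField_leeSharp : SmoothField (D.leeSharp D' g) :=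
  smoothField_of_inner g.1 fun W hW => by
    simp only [inner_leeSharp]
    exact D.smoothForm_leeDiff D' g W hW

/-- The fundamental formula of Weyl geometry: both connections are determined by their Lee forms, by
the argument of Koszul. -/
lemma inner_conn {Y : ∀ z : M, TangentSpace (𝓡 m) z} {x : M} (hY : DiffFieldAt Y x)
    (v w : TangentSpace (𝓡 m) x) :
    g.1.inner x (D'.conn Y x v) w = g.1.inner x (D.conn Y x v) w
      + D.leeDiff D' g x v * g.1.inner x (Y x) w + D.leeDiff D' g x (Y x) * g.1.inner x v w
      - g.1.inner x v (Y x) * D.leeDiff D' g x w := by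
  have hX := diffFieldAt_ext v
  have hZ := diffFieldAt_ext w
  have tor : ∀ {U V : ∀ z : M, TangentSpace (𝓡 m) z}, DiffFieldAt U x → DiffFieldAt V x →
      ∀ z, g.1.inner x (D'.conn V x (U x)) z - g.1.inner x (D'.conn U x (V x)) z
        = g.1.inner x (D.conn V x (U x)) z - g.1.inner x (D.conn U x (V x)) z := by
    intro U V hU hV z
    have h := (D'.torsion_free U V x hU hV).trans (D.torsion_free U V x hU hV).symm
    have h2 := congrArg (fun a => innerL g.1 x a z) h
    simpa only [map_sub, LinearMap.sub_apply, innerL_apply] using h2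
  have met : ∀ {U V : ∀ z : M, TangentSpace (𝓡 m) z}, DiffFieldAt U x → DiffFieldAt V x →
      ∀ z, g.1.inner x (D'.conn U x z) (V x) + g.1.inner x (D'.conn V x z) (U x)
        = g.1.inner x (D.conn U x z) (V x) + g.1.inner x (D.conn V x z) (U x)
        + 2 * D.leeDiff D' g x z * g.1.inner x (U x) (V x) := by
    intro U V hU hV z
    have h1 := D.dfun_inner g hU hV z
    have h2 := D'.dfun_inner g hU hV z
    rw [inner_symm' g.1 x (U x) (D.conn V x z)] at h1
    rw [inner_symm' g.1 x (U x) (D'.conn V x z)] at h2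
    rw [leeDiff_apply]
    linarith
  -- the Koszul combination of metric compatibility and vanishing torsion
  have e1 := met hY hZ v
  have e2 := met hZ hX (Y x)
  have e3 := met hX hY w
  have t1 := tor hX hY w
  have t2 := tor hY hZ v
  have t3 := tor hX hZ (Y x)
  simp only [ext_apply_self] at e1 e2 e3 t1 t2 t3
  rw [inner_symm' g.1 x w v] at e2
  linarith

/-- `∇'_v Y = ∇_v Y + γ(v) Y + γ(Y) v - g(v, Y) γ^♯`. -/
lemma conn_eq {Y : ∀ z : M, TangentSpace (𝓡 m) z} {x : M} (hY : DiffFieldAt Y x)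
    (v : TangentSpace (𝓡 m) x) :
    D'.conn Y x v = D.conn Y x v + D.leeDiff D' g x v • Y x + D.leeDiff D' g x (Y x) • v
      - g.1.inner x v (Y x) • D.leeSharp D' g x := by
  refine eq_of_inner_eq g.1 x fun w => ?_
  rw [D.inner_conn D' g hY]
  simp only [map_add, map_sub, map_smul, _root_.add_apply, _root_.sub_apply, _root_.smul_apply,
    smul_eq_mul, inner_leeSharp]

/-- The tensor `∇γ - γ ⊗ γ + ½ |γ|² c` by which the Schouten-Weyl tensors of two Weyl structures
differ. -/
def schoutenDiff (x : M) : TangentSpace (𝓡 m) x →ₗ[ℝ] TangentSpace (𝓡 m) x →ₗ[ℝ] ℝ :=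
  LinearMap.mk₂ ℝ (fun v w => D.covForm (D.leeDiff D' g) x v w
    - D.leeDiff D' g x v * D.leeDiff D' g x w
    + 1 / 2 * D.leeDiff D' g x (D.leeSharp D' g x) * g.1.inner x v w)
    (fun v v' w => by simp; ring) (fun a v w => by simp; ring)
    (fun v w w' => by simp; ring) (fun a v w => by simp; ring)

lemma schoutenDiff_apply (x : M) (v w : TangentSpace (𝓡 m) x) :
    D.schoutenDiff D' g x v w = D.covForm (D.leeDiff D' g) x v w
    - D.leeDiff D' g x v * D.leeDiff D' g x w
    + 1 / 2 * D.leeDiff D' g x (D.leeSharp D' g x) * g.1.inner x v w := rfl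

lemma smoothFun_schoutenDiff {X Y : ∀ z : M, TangentSpace (𝓡 m) z} (hX : SmoothField X)
    (hY : SmoothField Y) : SmoothFun m (fun x => D.schoutenDiff D' g x (X x) (Y x)) := by
  simp only [schoutenDiff_apply]
  have hγ := D.smoothForm_leeDiff D' g
  exact ((D.smoothFun_covForm hγ hX hY).sub ((hγ X hX).mul (hγ Y hY))).add
    ((contMDiff_const.mul (hγ _ (D.smoothField_leeSharp D' g))).mul (smoothFun_inner g.1 hX hY))

lemma inner_conn_leeSharp (x : M) (v w : TangentSpace (𝓡 m) x) :
    g.1.inner x (D.conn (D.leeSharp D' g) x v) w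
      = D.covForm (D.leeDiff D' g) x v w + 2 * D.lee g x v * D.leeDiff D' g x w := by
  have hW := smoothField_sext w
  have h1 := D.dfun_inner g ((D.smoothField_leeSharp D' g).diffAt x) (hW.diffAt x) v
  have h2 := D.covForm_apply (D.smoothForm_leeDiff D' g) v hW
  simp only [inner_leeSharp, sext_apply_self] at h1 h2
  linarith

/-- The second covariant derivative `∇'_X ∇'_Y Z`, expressed by means of `∇` and `γ`. -/
lemma inner_conn_nab {X Y Z : ∀ z : M, TangentSpace (𝓡 m) z} (_hX : SmoothField X)
    (hY : SmoothField Y) (hZ : SmoothField Z) (x : M) (z : TangentSpace (𝓡 m) x) :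
    g.1.inner x (D'.conn (D'.nab Y Z) x (X x)) z
      = g.1.inner x (D.conn (D.nab Y Z) x (X x)) z
        + (D.covForm (D.leeDiff D' g) x (X x) (Y x) + D.leeDiff D' g x (D.conn Y x (X x)))
          * g.1.inner x (Z x) z
        + D.leeDiff D' g x (Y x) * g.1.inner x (D.conn Z x (X x)) z
        + (D.covForm (D.leeDiff D' g) x (X x) (Z x) + D.leeDiff D' g x (D.conn Z x (X x)))
          * g.1.inner x (Y x) z
        + D.leeDiff D' g x (Z x) * g.1.inner x (D.conn Y x (X x)) z
        - (g.1.inner x (D.conn Y x (X x)) (Z x) + g.1.inner x (D.conn Z x (X x)) (Y x)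
          - 2 * D.lee g x (X x) * g.1.inner x (Y x) (Z x)) * D.leeDiff D' g x z
        - g.1.inner x (Y x) (Z x) *
          (D.covForm (D.leeDiff D' g) x (X x) z + 2 * D.lee g x (X x) * D.leeDiff D' g x z)
        + D.leeDiff D' g x (X x) * g.1.inner x (D'.nab Y Z x) z
        + D.leeDiff D' g x (D'.nab Y Z x) * g.1.inner x (X x) z
        - g.1.inner x (D'.nab Y Z x) (X x) * D.leeDiff D' g x z := by
  have hγ := D.smoothForm_leeDiff D' g
  have hG := D.smoothField_leeSharp D' g
  have hn : D'.nab Y Z = D.nab Y Z + (fun z => D.leeDiff D' g z (Y z)) • Z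
      + (fun z => D.leeDiff D' g z (Z z)) • Y
      + (fun z => - g.1.inner z (Y z) (Z z)) • D.leeSharp D' g := by
    funext z
    simp only [nab, Pi.add_apply, Pi.smul_apply', D.conn_eq D' g (hZ.diffAt z)]
    module
  have hYZ := smoothFun_inner g.1 hY hZ
  have s0 := D.smoothField_nab hY hZ
  have s1 := SmoothField.smul (hγ Y hY) hZ
  have s2 := SmoothField.smul (hγ Z hZ) hY
  have hYZ' : SmoothFun m (fun z => - g.1.inner z (Y z) (Z z)) := hYZ.neg
  have s3 := SmoothField.smul hYZ' hG
  have c1 := D.covForm_apply hγ (X x) hY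
  have c2 := D.covForm_apply hγ (X x) hZ
  have c3 := D.dfun_inner g (hY.diffAt x) (hZ.diffAt x) (X x)
  have c4 := D.inner_conn_leeSharp D' g x (X x) z
  have c5 : mvfderiv (𝓡 m) (fun z => - g.1.inner z (Y z) (Z z)) x (X x)
      = - mvfderiv (𝓡 m) (fun z => g.1.inner z (Y z) (Z z)) x (X x) := by
    rw [mvfderiv_fun_neg]; rfl
  rw [D.inner_conn D' g ((D'.smoothField_nab hY hZ).diffAt x),
    inner_symm' g.1 x (X x) (D'.nab Y Z x)]
  rw [inner_symm' g.1 x (Y x) (D.conn Z x (X x))] at c3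
  have c6 : g.1.inner x (D.conn (D'.nab Y Z) x (X x)) z
      = g.1.inner x (D.conn (D.nab Y Z) x (X x)) z
      + (D.leeDiff D' g x (Y x) * g.1.inner x (D.conn Z x (X x)) z
        + mvfderiv (𝓡 m) (fun z => D.leeDiff D' g z (Y z)) x (X x) * g.1.inner x (Z x) z)
      + (D.leeDiff D' g x (Z x) * g.1.inner x (D.conn Y x (X x)) z
        + mvfderiv (𝓡 m) (fun z => D.leeDiff D' g z (Z z)) x (X x) * g.1.inner x (Y x) z)
      + (- g.1.inner x (Y x) (Z x) * g.1.inner x (D.conn (D.leeSharp D' g) x (X x)) z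
        + mvfderiv (𝓡 m) (fun z => - g.1.inner z (Y z) (Z z)) x (X x)
          * D.leeDiff D' g x z) := by
    rw [hn, D.conn_add (((s0.add s1).add s2).diffAt x) (s3.diffAt x),
      D.conn_add ((s0.add s1).diffAt x) (s2.diffAt x), D.conn_add (s0.diffAt x) (s1.diffAt x),
      D.conn_smul ((hγ Y hY).mdiffAt x) (hZ.diffAt x),
      D.conn_smul ((hγ Z hZ).mdiffAt x) (hY.diffAt x),
      D.conn_smul (hYZ'.mdiffAt x) (hG.diffAt x), ← D.inner_leeSharp D' g x z]
    simp only [map_add, map_smul, _root_.add_apply, _root_.smul_apply, smul_eq_mul]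
  rw [c6, c5]
  linear_combination (-g.1.inner x (Z x) z) * c1 - g.1.inner x (Y x) z * c2
    - D.leeDiff D' g x z * c3 - g.1.inner x (Y x) (Z x) * c4

/-- The change of the curvature. With `b = schoutenDiff`, the curvature changes by `b(v,w) - b(w,v)`
times the identity and by the Kulkarni-Nomizu product of `b` and the metric. -/
lemma inner_curv (x : M) (v w u z : TangentSpace (𝓡 m) x) :
    g.1.inner x (D'.curv x v w u) z = g.1.inner x (D.curv x v w u) z
      + (D.schoutenDiff D' g x v w - D.schoutenDiff D' g x w v) * g.1.inner x u z
      + D.schoutenDiff D' g x v u * g.1.inner x w z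
      - D.schoutenDiff D' g x w u * g.1.inner x v z
      - g.1.inner x w u * D.schoutenDiff D' g x v z
      + g.1.inner x v u * D.schoutenDiff D' g x w z := by
  obtain ⟨X, hX, rfl⟩ := exists_smoothField v
  obtain ⟨Y, hY, rfl⟩ := exists_smoothField w
  obtain ⟨Z, hZ, rfl⟩ := exists_smoothField u
  have nabI : ∀ {Y Z : ∀ z : M, TangentSpace (𝓡 m) z}, SmoothField Y → SmoothField Z → ∀ w,
      g.1.inner x (D'.nab Y Z x) w = g.1.inner x (D.conn Z x (Y x)) w
      + D.leeDiff D' g x (Y x) * g.1.inner x (Z x) w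
      + D.leeDiff D' g x (Z x) * g.1.inner x (Y x) w
      - g.1.inner x (Y x) (Z x) * D.leeDiff D' g x w :=
    fun hY hZ w => D.inner_conn D' g (hZ.diffAt x) _ w
  have nabG : ∀ {Y Z : ∀ z : M, TangentSpace (𝓡 m) z}, SmoothField Y → SmoothField Z →
      D.leeDiff D' g x (D'.nab Y Z x) = D.leeDiff D' g x (D.conn Z x (Y x))
      + 2 * D.leeDiff D' g x (Y x) * D.leeDiff D' g x (Z x)
      - g.1.inner x (Y x) (Z x) * D.leeDiff D' g x (D.leeSharp D' g x) := by
    intro Y Z hY hZ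
    have h := nabI hY hZ (D.leeSharp D' g x)
    simp only [inner_leeSharp'] at h
    rw [h]; ring
  have br : g.1.inner x (D'.conn Z x (VectorField.mlieBracket (𝓡 m) X Y x)) z
      = g.1.inner x (D.conn Z x (VectorField.mlieBracket (𝓡 m) X Y x)) z
      + (D.leeDiff D' g x (D.conn Y x (X x)) - D.leeDiff D' g x (D.conn X x (Y x)))
        * g.1.inner x (Z x) z
      + D.leeDiff D' g x (Z x)
        * (g.1.inner x (D.conn Y x (X x)) z - g.1.inner x (D.conn X x (Y x)) z)
      - (g.1.inner x (D.conn Y x (X x)) (Z x) - g.1.inner x (D.conn X x (Y x)) (Z x))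
        * D.leeDiff D' g x z := by
    rw [D.inner_conn D' g (hZ.diffAt x)]
    simp only [D.mlieBracket_eq (hX.diffAt x) (hY.diffAt x), map_sub, _root_.sub_apply]
  rw [D'.curv_apply hX hY hZ, D.curv_apply hX hY hZ]
  simp only [curvField, map_sub, _root_.sub_apply]
  rw [D.inner_conn_nab D' g hX hY hZ, D.inner_conn_nab D' g hY hX hZ, br, nabI hY hZ, nabI hX hZ,
    nabI hY hZ, nabI hX hZ, nabG hY hZ, nabG hX hZ]
  simp only [schoutenDiff_apply]
  have s1 := inner_symm' g.1 x (Y x) (X x)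
  have s2 := inner_symm' g.1 x (Z x) (X x)
  have s3 := inner_symm' g.1 x (Z x) (Y x)
  rw [s1, s2, s3]
  ring

end WeylStructure

/-! ### The Schouten-Weyl tensor -/

section SchoutenWeyl

variable {m : ℕ} {M : Type*} [TopologicalSpace M] [T2Space M]
  [ChartedSpace (EuclideanSpace ℝ (Fin m)) M] [IsManifold (𝓡 m) ∞ M]
  {c : ConformalStructure m M}

lemma metricTrace_mul_inner (g : Metric m M) {x : M} (α : TangentSpace (𝓡 m) x →ₗ[ℝ] ℝ)
    (w : TangentSpace (𝓡 m) x) :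
    metricTrace g x (fun a b => α a * g.inner x w b) = α w := by
  have h := metricTrace_mul (g := g) (fun a => α a) (g.inner x w).toLinearMap
  refine h.trans ?_
  refine (inner_symm' g x w _).trans ?_
  exact inner_sharp α w

lemma metricTrace_inner_mul (g : Metric m M) {x : M} (β : TangentSpace (𝓡 m) x →ₗ[ℝ] ℝ)
    (w : TangentSpace (𝓡 m) x) :
    metricTrace g x (fun a b => g.inner x a w * β b) = β w := by
  rw [← metricTrace_mul_inner g β w, ← metricTrace_swap]
  refine metricTrace_congr fun i j => ?_
  rw [mul_comm, inner_symm']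

/-- The symmetric trace-free part of a bilinear form. It is independent of the metric of the
conformal class, see `symTraceFree_eq`. -/
def symTraceFree (g : Metric m M) (x : M)
    (A : TangentSpace (𝓡 m) x →ₗ[ℝ] TangentSpace (𝓡 m) x →ₗ[ℝ] ℝ) :
    TangentSpace (𝓡 m) x →ₗ[ℝ] TangentSpace (𝓡 m) x →ₗ[ℝ] ℝ :=
  (1 / 2 : ℝ) • (A + A.flip) - (metricTrace g x (fun v w => A v w) / m) • innerL g x

lemma symTraceFree_apply (g : Metric m M) {x : M}
    (A : TangentSpace (𝓡 m) x →ₗ[ℝ] TangentSpace (𝓡 m) x →ₗ[ℝ] ℝ) (v w : TangentSpace (𝓡 m) x) :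
    symTraceFree g x A v w
      = (A v w + A w v) / 2 - metricTrace g x (fun v w => A v w) / m * g.inner x v w := by
  simp only [symTraceFree, LinearMap.sub_apply, LinearMap.smul_apply, LinearMap.add_apply,
    LinearMap.flip_apply, smul_eq_mul, innerL_apply]
  ring

lemma ScalesBy.metricTrace_mul_inner {g g' : Metric m M} {x : M} {t : ℝ} (h : ScalesBy g g' x t)
    (B : TangentSpace (𝓡 m) x → TangentSpace (𝓡 m) x → ℝ) (v w : TangentSpace (𝓡 m) x) :
    metricTrace g' x B * g'.inner x v w = metricTrace g x B * g.inner x v w := by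
  have e : Real.exp (-2 * t) * Real.exp (2 * t) = 1 := by rw [← Real.exp_add]; simp
  rw [h.metricTrace_eq, h v w, smul_eq_mul]
  linear_combination (metricTrace g x B * g.inner x v w) * e

lemma exists_scalesBy (g g' : c.metrics) (x : M) : ∃ t, ScalesBy g.1 g'.1 x t := by
  obtain ⟨u, -, h⟩ := (c.mem_iff g.1 g.2 g'.1).1 g'.2
  exact ⟨u x, h x⟩

lemma metricTrace_mul_inner_eq (g g' : c.metrics) {x : M}
    (B : TangentSpace (𝓡 m) x → TangentSpace (𝓡 m) x → ℝ) (v w : TangentSpace (𝓡 m) x) :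
    metricTrace g'.1 x B * g'.1.inner x v w = metricTrace g.1 x B * g.1.inner x v w := by
  obtain ⟨t, h⟩ := exists_scalesBy g g' x
  exact h.metricTrace_mul_inner B v w

lemma symTraceFree_eq (g g' : c.metrics) {x : M}
    (A : TangentSpace (𝓡 m) x →ₗ[ℝ] TangentSpace (𝓡 m) x →ₗ[ℝ] ℝ) :
    symTraceFree g'.1 x A = symTraceFree g.1 x A := by
  ext v w
  have := metricTrace_mul_inner_eq g g' (fun v w => A v w) v w
  rw [symTraceFree_apply, symTraceFree_apply]
  linear_combination (-1 / (m : ℝ)) * this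

lemma smoothFun_symTraceFree (g : Metric m M)
    {A : ∀ x : M, TangentSpace (𝓡 m) x →ₗ[ℝ] TangentSpace (𝓡 m) x →ₗ[ℝ] ℝ}
    (hA : ∀ X Y, SmoothField X → SmoothField Y → SmoothFun m (fun x => A x (X x) (Y x)))
    {X Y : ∀ z : M, TangentSpace (𝓡 m) z} (hX : SmoothField X) (hY : SmoothField Y) :
    SmoothFun m (fun x => symTraceFree g x (A x) (X x) (Y x)) := by
  simp only [symTraceFree_apply, div_eq_mul_inv]
  exact (((hA X Y hX hY).add (hA Y X hY hX)).mul contMDiff_const).sub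
    (((smoothFun_metricTrace g hA).mul contMDiff_const).mul (smoothFun_inner g hX hY))

namespace WeylStructure

variable (D D' : WeylStructure c) (g : c.metrics)

lemma ricci_change (x : M) (v w : TangentSpace (𝓡 m) x) :
    D'.ricci x v w = D.ricci x v w + D.schoutenDiff D' g x w v
      - (m - 1) * D.schoutenDiff D' g x v w
      - metricTrace g.1 x (fun a b => D.schoutenDiff D' g x a b) * g.1.inner x v w := by
  rw [D'.ricci_eq g.1, D.ricci_eq g.1]
  simp only [D.inner_curv D' g, sub_mul]
  have e1 : ∀ v w : TangentSpace (𝓡 m) x,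
      metricTrace g.1 x (fun a b => D.schoutenDiff D' g x a v * g.1.inner x w b)
        = D.schoutenDiff D' g x w v := fun v w =>
    metricTrace_mul_inner g.1 ((D.schoutenDiff D' g x).flip v) w
  rw [metricTrace_add, metricTrace_sub, metricTrace_sub, metricTrace_add, metricTrace_add,
    metricTrace_sub, e1, metricTrace_mul_inner g.1 (D.schoutenDiff D' g x v) w, e1,
    metricTrace_const_mul, metricTrace_const_mul, metricTrace_metric,
    metricTrace_inner_mul g.1 (D.schoutenDiff D' g x v) w]
  ring

lemma scal_change (x : M) :
    D'.scal g x = D.scal g x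
      - 2 * (m - 1) * metricTrace g.1 x (fun a b => D.schoutenDiff D' g x a b) := by
  have h : D'.ricci x = fun v w => D.ricci x v w + D.schoutenDiff D' g x w v
      - (m - 1) * D.schoutenDiff D' g x v w
      - metricTrace g.1 x (fun a b => D.schoutenDiff D' g x a b) * g.1.inner x v w := by
    funext v w
    exact D.ricci_change D' g x v w
  rw [scal, h, metricTrace_sub, metricTrace_sub, metricTrace_add, metricTrace_const_mul,
    metricTrace_const_mul, metricTrace_metric,
    metricTrace_swap (fun v w => D.schoutenDiff D' g x v w), scal]
  ring

lemma faraday_change [NeZero m] (x : M) (v w : TangentSpace (𝓡 m) x) :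
    D'.faraday x v w
      = D.faraday x v w + (D.schoutenDiff D' g x v w - D.schoutenDiff D' g x w v) := by
  have hm : (m : ℝ) ≠ 0 := NeZero.ne _
  rw [D'.faraday_eq g.1, D.faraday_eq g.1]
  simp only [D.inner_curv D' g]
  have s : ∀ a b : TangentSpace (𝓡 m) x, g.1.inner x a b = g.1.inner x b a := inner_symm' g.1 x
  have e1 : ∀ v w : TangentSpace (𝓡 m) x,
      metricTrace g.1 x (fun a b => g.1.inner x w a * D.schoutenDiff D' g x v b)
        = D.schoutenDiff D' g x v w := fun v w => by
    simp only [s w]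
    exact metricTrace_inner_mul g.1 (D.schoutenDiff D' g x v) w
  rw [metricTrace_add, metricTrace_sub, metricTrace_sub, metricTrace_add, metricTrace_add,
    metricTrace_const_mul, metricTrace_metric, e1, e1,
    metricTrace_mul_inner g.1 (D.schoutenDiff D' g x v) w,
    metricTrace_mul_inner g.1 (D.schoutenDiff D' g x w) v]
  field_simp
  ring

lemma covForm_change {α : ∀ z : M, TangentSpace (𝓡 m) z →L[ℝ] ℝ} (hα : SmoothForm α) (x : M)
    (v w : TangentSpace (𝓡 m) x) :
    D'.covForm α x v w = D.covForm α x v w - D.leeDiff D' g x v * α x w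
      - D.leeDiff D' g x w * α x v + g.1.inner x v w * α x (D.leeSharp D' g x) := by
  have h1 := D'.covForm_apply hα v (smoothField_sext w)
  have h2 := D.covForm_apply hα v (smoothField_sext w)
  rw [D.conn_eq D' g ((smoothField_sext w).diffAt x)] at h1
  simp only [sext_apply_self, map_add, map_sub, map_smul, smul_eq_mul] at h1 h2
  rw [h1, h2]
  ring

lemma covForm_add {α β : ∀ z : M, TangentSpace (𝓡 m) z →L[ℝ] ℝ} (hα : SmoothForm α)
    (hβ : SmoothForm β) (x : M) (v w : TangentSpace (𝓡 m) x) :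
    D.covForm (α + β) x v w = D.covForm α x v w + D.covForm β x v w := by
  have hw := smoothField_sext w
  have hαβ : SmoothForm (α + β) := fun X hX => (hα X hX).add (hβ X hX)
  have h1 := D.covForm_apply hα v hw
  have h2 := D.covForm_apply hβ v hw
  have h3 := D.covForm_apply hαβ v hw
  simp only [sext_apply_self, Pi.add_apply, _root_.add_apply] at h1 h2 h3
  rw [dfun_add ((hα _ hw).mdiffAt x) ((hβ _ hw).mdiffAt x)] at h3
  rw [h1, h2, h3]
  ring

lemma hess_one (x : M) (v w : TangentSpace (𝓡 m) x) :
    D.hess g 1 (fun _ => 1) x v w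
      = D.covForm (D.lee g) x v w + D.lee g x v * D.lee g x w := by
  have h : D.derivL g 1 (fun _ => (1 : ℝ)) = D.lee g := by
    funext z
    ext u
    rw [derivL_apply, deriv, dfun_const]
    ring
  rw [D.hess_eq g 1 contMDiff_const, ← derivL_apply, h]
  ring

/-- The change of the Hessian on the section of `L` with coefficient `1`: up to multiples of the
metric, it is `schoutenDiff`. -/
lemma hess_one_change (x : M) (v w : TangentSpace (𝓡 m) x) :
    D'.hess g 1 (fun _ => 1) x v w = D.hess g 1 (fun _ => 1) x v w + D.schoutenDiff D' g x v w
      + (D'.lee g x (D.leeSharp D' g x) - 1 / 2 * D.leeDiff D' g x (D.leeSharp D' g x))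
        * g.1.inner x v w := by
  have h : D'.lee g = D.lee g + D.leeDiff D' g := by
    funext z
    simp [leeDiff]
  have h' : ∀ u, D'.lee g x u = D.lee g x u + D.leeDiff D' g x u := fun u => by
    rw [leeDiff_apply]; ring
  rw [hess_one, hess_one, D.covForm_change D' g (D'.smoothForm_lee g), schoutenDiff_apply]
  conv_lhs => rw [h, D.covForm_add (D.smoothForm_lee g) (D.smoothForm_leeDiff D' g), ← h]
  rw [h' v, h' w]
  ring

lemma hessZero_one_change [NeZero m] (x : M) (v w : TangentSpace (𝓡 m) x) :
    D'.hessZero g 1 (fun _ => 1) x v w = D.hessZero g 1 (fun _ => 1) x v w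
      + symTraceFree g.1 x (D.schoutenDiff D' g x) v w := by
  have hm : (m : ℝ) ≠ 0 := NeZero.ne _
  have h : D'.hess g 1 (fun _ => 1) x = fun v w => D.hess g 1 (fun _ => 1) x v w
      + D.schoutenDiff D' g x v w
      + (D'.lee g x (D.leeSharp D' g x) - 1 / 2 * D.leeDiff D' g x (D.leeSharp D' g x))
        * g.1.inner x v w := by
    funext v w
    exact D.hess_one_change D' g x v w
  rw [hessZero, hessZero, h, metricTrace_add, metricTrace_add, metricTrace_const_mul,
    metricTrace_metric, symTraceFree_apply]
  beta_reduce
  rw [inner_symm' g.1 x w v]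
  field_simp
  ring

lemma schoutenDiff_eq (g g' : c.metrics) (x : M) :
    D.schoutenDiff D' g' x = D.schoutenDiff D' g x := by
  obtain ⟨t, h⟩ := exists_scalesBy g g' x
  have e : Real.exp (-2 * t) * Real.exp (2 * t) = 1 := by rw [← Real.exp_add]; simp
  ext v w
  have h1 : D.leeDiff D' g' = D.leeDiff D' g := funext fun z => D.leeDiff_eq D' g g' z
  have h2 : D.leeSharp D' g' x = Real.exp (-2 * t) • D.leeSharp D' g x := by
    rw [leeSharp, h.sharp_eq, h1, leeSharp]
  rw [schoutenDiff_apply, schoutenDiff_apply, h1, h2, map_smul, h v w, smul_eq_mul]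
  linear_combination (1 / 2 * D.leeDiff D' g x (D.leeSharp D' g x) * g.1.inner x v w) * e

/-- The tensor `scal · c` is independent of the metric. -/
lemma scal_mul_inner_eq (g g' : c.metrics) (x : M) (v w : TangentSpace (𝓡 m) x) :
    D.scal g' x * g'.1.inner x v w = D.scal g x * g.1.inner x v w :=
  metricTrace_mul_inner_eq g g' (D.ricci x) v w

end WeylStructure

lemma unitDensity_self [NeZero m] (g : c.metrics) (k : ℝ) :
    (unitDensity g k).1 g = fun _ => (1 : ℝ) := by
  funext x
  show confRatio g.1 g.1 x ^ (k / 2) = 1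
  rw [confRatio_self, Real.one_rpow]

/-- The tensor `𝓜 - Hess_0` of a Möbius structure, expressed by the data `D₀`, `h` of the definition
of a Möbius structure; the Hessian has disappeared. -/
lemma MobiusStructure.exists_schoutenZero_eq [NeZero m] (P : MobiusStructure c) :
    ∃ (D₀ : WeylStructure c) (h : TraceFreeForm c 0), ∀ (D : WeylStructure c) (g : c.metrics)
      (x : M) (v w : TangentSpace (𝓡 m) x), P.schoutenZero D g x v w
        = h.1 g x v w - symTraceFree g.1 x (D₀.schoutenDiff D g x) v w := by
  obtain ⟨D₀, h, hP⟩ := P.isMobius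
  refine ⟨D₀, h, fun D g x v w => ?_⟩
  rw [MobiusStructure.schoutenZero, hP, unitDensity_self, D₀.hessZero_one_change D g]
  ring

variable (P : m = 2 → MobiusStructure c) (D D' : WeylStructure c)

/-- The Schouten-Weyl tensor is a smooth bilinear form, and it does not depend on the metric of the
conformal class. -/
lemma exists_schouten_form [NeZero m] :
    ∃ S : ∀ x : M, TangentSpace (𝓡 m) x →ₗ[ℝ] TangentSpace (𝓡 m) x →ₗ[ℝ] ℝ,
      (∀ X Y, SmoothField X → SmoothField Y → SmoothFun m (fun x => S x (X x) (Y x))) ∧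
      ∀ (g : c.metrics) x v w, schouten P D g x v w = S x v w := by
  obtain ⟨g₀, hg₀⟩ := c.nonempty
  set g : c.metrics := ⟨g₀, hg₀⟩
  have zero : ∃ S : ∀ x : M, TangentSpace (𝓡 m) x →ₗ[ℝ] TangentSpace (𝓡 m) x →ₗ[ℝ] ℝ,
      (∀ X Y, SmoothField X → SmoothField Y → SmoothFun m (fun x => S x (X x) (Y x))) ∧
      ∀ (g : c.metrics) x v w, schoutenZero P D g x v w = S x v w := by
    by_cases h2 : m = 2
    · obtain ⟨D₀, h, hP⟩ := (P h2).exists_schoutenZero_eq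
      refine ⟨fun x => h.1 g x - symTraceFree g.1 x (D₀.schoutenDiff D g x), fun X Y hX hY => ?_,
        fun g' x v w => ?_⟩
      · exact (h.2.1 g X Y hX hY).sub (smoothFun_symTraceFree g.1
          (fun X Y hX hY => D₀.smoothFun_schoutenDiff D g hX hY) hX hY)
      · obtain ⟨t, ht⟩ := exists_scalesBy g g' x
        have := h.2.2.2.2 g g' x t ht v w
        rw [zero_mul, Real.exp_zero, one_mul] at this
        rw [schoutenZero, dif_pos h2, hP, symTraceFree_eq g g', D₀.schoutenDiff_eq D g g', this]
        rfl
    · refine ⟨fun x => (1 / ((m : ℝ) - 2)) • symTraceFree g.1 x (D.ricciL x), fun X Y hX hY => ?_,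
        fun g' x v w => ?_⟩
      · exact contMDiff_const.mul (smoothFun_symTraceFree g.1
          (fun X Y hX hY => D.smoothFun_ricci g.1 hX hY) hX hY)
      · rw [schoutenZero, dif_neg h2]
        beta_reduce
        rw [← symTraceFree_eq g g', LinearMap.smul_apply, LinearMap.smul_apply,
          symTraceFree_apply, smul_eq_mul]
        rfl
  obtain ⟨S, hS, hS'⟩ := zero
  refine ⟨fun x => S x + (D.scal g x / (2 * m * (m - 1))) • innerL g.1 x
    - (1 / 2 : ℝ) • D.faradayL x, fun X Y hX hY => ?_, fun g' x v w => ?_⟩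
  · have h1 : SmoothFun m (fun x => D.scal g x / (2 * m * (m - 1))) := by
      simp only [div_eq_mul_inv]
      exact (D.smoothFun_scal g).mul contMDiff_const
    exact ((hS X Y hX hY).add (h1.mul (smoothFun_inner g.1 hX hY))).sub
      (contMDiff_const.mul (D.smoothFun_faraday g.1 hX hY))
  · have h1 := D.scal_mul_inner_eq g g' x v w
    simp only [LinearMap.sub_apply, LinearMap.add_apply, LinearMap.smul_apply, smul_eq_mul,
      innerL_apply]
    rw [schouten, hS', show D.faradayL x v w = D.faraday x v w from rfl]
    linear_combination (1 / (2 * m * (m - 1)) : ℝ) * h1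

lemma schoutenZero_change [NeZero m] (g : c.metrics) (x : M)
    (v w : TangentSpace (𝓡 m) x) :
    schoutenZero P D' g x v w
      = schoutenZero P D g x v w - symTraceFree g.1 x (D.schoutenDiff D' g x) v w := by
  by_cases h2 : m = 2
  · simp only [schoutenZero, dif_pos h2, MobiusStructure.schoutenZero, unitDensity_self]
    rw [D.hessZero_one_change D' g]
    ring
  · have hm0 : (m : ℝ) ≠ 0 := NeZero.ne _
    have hm2 : (m : ℝ) - 2 ≠ 0 := sub_ne_zero.2 (by exact_mod_cast h2)
    simp only [schoutenZero, dif_neg h2]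
    rw [D.ricci_change D' g x v w, D.ricci_change D' g x w v, D.scal_change D' g,
      symTraceFree_apply, inner_symm' g.1 x w v]
    field_simp
    ring

/-- The Schouten-Weyl tensor of `∇'` is that of `∇` minus `∇γ - γ ⊗ γ + ½ |γ|² c`, also for Möbius
surfaces. -/
lemma schouten_change (hm : 2 ≤ m) (g : c.metrics) (x : M) (v w : TangentSpace (𝓡 m) x) :
    schouten P D' g x v w = schouten P D g x v w - D.schoutenDiff D' g x v w := by
  have : NeZero m := ⟨by omega⟩
  have hm0 : (m : ℝ) ≠ 0 := NeZero.ne _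
  have hm1 : (m : ℝ) - 1 ≠ 0 := sub_ne_zero.2 (by exact_mod_cast (by omega : m ≠ 1))
  simp only [schouten]
  rw [schoutenZero_change P D D', D.scal_change D' g, D.faraday_change D' g,
    symTraceFree_apply]
  field_simp
  ring

end SchoutenWeyl

/-! ### Covariant derivatives along a map -/

namespace WeylStructure

variable {m n : ℕ} {M N : Type*} [TopologicalSpace M] [T2Space M]
  [ChartedSpace (EuclideanSpace ℝ (Fin m)) M] [IsManifold (𝓡 m) ∞ M]
  [TopologicalSpace N] [T2Space N]
  [ChartedSpace (EuclideanSpace ℝ (Fin n)) N] [IsManifold (𝓡 n) ∞ N]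
  {c : ConformalStructure m M} (D D' : WeylStructure c)

lemma conn_ext_eq_sum {x : M} (v u : TangentSpace (𝓡 m) x) :
    D.conn (ext v) x u = ∑ i, coord i v • D.conn (sext (coordVec x i)) x u := by
  have hadd : ∀ v w : TangentSpace (𝓡 m) x,
      D.conn (ext (v + w)) x u = D.conn (ext v) x u + D.conn (ext w) x u := fun v w => by
    rw [D.conn_congr (diffFieldAt_ext _) (ext_add v w)]
    exact D.conn_add (diffFieldAt_ext v) (diffFieldAt_ext w) u
  have hsmul : ∀ (a : ℝ) (v : TangentSpace (𝓡 m) x),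
      D.conn (ext (a • v)) x u = a • D.conn (ext v) x u := fun a v => by
    rw [D.conn_congr (diffFieldAt_ext _) (ext_smul a v)]
    refine (D.conn_smul (f := fun _ => a) mdifferentiableAt_const (diffFieldAt_ext v) u).trans ?_
    rw [dfun_const, zero_smul, add_zero]
  have h := linearMap_eq_sum_coord
    (⟨⟨fun v => D.conn (ext v) x u, hadd⟩, hsmul⟩ : TangentSpace (𝓡 m) x →ₗ[ℝ] _) v
  refine h.trans (Finset.sum_congr rfl fun i _ => ?_)
  rw [← conn_sext]
  rfl

variable {ι : N → M}

/-- The components of a field along `ι` in the standard trivialization of `TM` at `ι y`. -/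
def alongCoeff (ι : N → M) (V : ∀ z : N, TangentSpace (𝓡 m) (ι z)) (y : N) (i : Fin m)
    (z : N) : ℝ :=
  (trivializationAt (EuclideanSpace ℝ (Fin m)) (TangentSpace (𝓡 m) : M → Type _) (ι y)
    ⟨ι z, V z⟩).2 i

lemma alongCoeff_self (V : ∀ z : N, TangentSpace (𝓡 m) (ι z)) (y : N) (i : Fin m) :
    alongCoeff ι V y i y = coord i (V y) := by
  rw [alongCoeff, triv_self]; rfl

lemma eventually_eq_sum_alongCoeff (hι : ContMDiff (𝓡 n) (𝓡 m) ∞ ι)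
    (V : ∀ z : N, TangentSpace (𝓡 m) (ι z)) (y : N) :
    ∀ᶠ z in 𝓝 y, V z = ∑ i, alongCoeff ι V y i z • sext (coordVec (ι y) i) (ι z) := by
  have h1 : ∀ᶠ z in 𝓝 y, ∀ i, sext (m := m) (coordVec (ι y) i) (ι z)
      = ext (coordVec (ι y) i) (ι z) :=
    Filter.eventually_all.2 fun i => hι.continuous.continuousAt.eventually (sext_eventuallyEq _)
  filter_upwards [h1, hι.continuous.continuousAt.preimage_mem_nhds
    ((trivializationAt (EuclideanSpace ℝ (Fin m)) (TangentSpace (𝓡 m) : M → Type _)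
      (ι y)).open_baseSet.mem_nhds (mem_baseSet (ι y)))] with z h2 h3
  simp only [h2]
  exact eq_sum_triv_ext V h3

variable {V W : ∀ z : N, TangentSpace (𝓡 m) (ι z)} {y : N}

lemma mdiffAt_triv (hV : DiffAlongAt n ι V y) :
    MDifferentiableAt (𝓡 n) 𝓘(ℝ, EuclideanSpace ℝ (Fin m)) (fun z =>
      (trivializationAt (EuclideanSpace ℝ (Fin m)) (TangentSpace (𝓡 m) : M → Type _) (ι y)
        ⟨ι z, V z⟩).2) y :=
  ((mdifferentiableAt_totalSpace (𝓡 m) (fun z => (⟨ι z, V z⟩ : TangentBundle (𝓡 m) M))).1 hV).2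

lemma mdiffAt_alongCoeff (hV : DiffAlongAt n ι V y) (i : Fin m) :
    MDifferentiableAt (𝓡 n) 𝓘(ℝ) (alongCoeff ι V y i) y :=
  MDifferentiableAt.comp y
    ((EuclideanSpace.proj (𝕜 := ℝ) i : EuclideanSpace ℝ (Fin m) →L[ℝ] ℝ).differentiableAt
      |>.mdifferentiableAt) (mdiffAt_triv hV)

lemma _root_.ConfGeom.triv_symm_self {x : M} (v : TangentSpace (𝓡 m) x) :
    (trivializationAt (EuclideanSpace ℝ (Fin m)) (TangentSpace (𝓡 m) : M → Type _) x).symm x v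
      = v := by
  have h := (trivializationAt (EuclideanSpace ℝ (Fin m))
    (TangentSpace (𝓡 m) : M → Type _) x).symm_proj_apply ⟨x, v⟩ (mem_baseSet x)
  rwa [triv_self] at h

/-- The derivative along `ι` in terms of a frame of globally smooth fields. -/
lemma along_eq (hV : DiffAlongAt n ι V y) (X : TangentSpace (𝓡 n) y) :
    D.along ι V y X = ∑ i, mvfderiv (𝓡 n) (alongCoeff ι V y i) y X • coordVec (ι y) i
      + ∑ i, coord i (V y) • D.conn (sext (coordVec (ι y) i)) (ι y)
        (mfderiv (𝓡 n) (𝓡 m) ι y X) := by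
  simp only [along]
  rw [conn_ext_eq_sum]
  congr 1
  set t := trivializationAt (EuclideanSpace ℝ (Fin m)) (TangentSpace (𝓡 m) : M → Type _) (ι y)
    with ht
  refine (triv_symm_self _).trans ?_
  refine (sum_coord (x := ι y) _).symm.trans (Finset.sum_congr rfl fun i _ => ?_)
  congr 1
  have h := mvfderiv_comp_apply y (I := 𝓘(ℝ, EuclideanSpace ℝ (Fin m))) (I' := 𝓡 n)
    (g := (EuclideanSpace.proj (𝕜 := ℝ) i : EuclideanSpace ℝ (Fin m) →L[ℝ] ℝ))
    (f := fun z => (t ⟨ι z, V z⟩).2) (ContinuousLinearMap.differentiableAt _).mdifferentiableAt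
    (mdiffAt_triv hV) X
  refine Eq.trans ?_ h.symm
  simp only [mvfderiv, mfderiv_eq_fderiv, ContinuousLinearMap.fderiv]
  rfl

/-- The derivative of a one-form on a field along `ι`. -/
lemma dfun_form_along (hι : ContMDiff (𝓡 n) (𝓡 m) ∞ ι)
    {α : ∀ z : M, TangentSpace (𝓡 m) z →L[ℝ] ℝ} (hα : SmoothForm α) (hV : DiffAlongAt n ι V y)
    (X : TangentSpace (𝓡 n) y) :
    mvfderiv (𝓡 n) (fun z => α (ι z) (V z)) y X
      = D.covForm α (ι y) (mfderiv (𝓡 n) (𝓡 m) ι y X) (V y) + α (ι y) (D.along ι V y X) := by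
  have hιy : MDifferentiableAt (𝓡 n) (𝓡 m) ι y := hι.mdifferentiable (by simp) y
  set a : Fin m → M → ℝ := fun i z => α z (sext (coordVec (ι y) i) z) with ha
  have has : ∀ i, SmoothFun m (a i) := fun i => hα _ (smoothField_sext _)
  have h1 : ∀ᶠ z in 𝓝 y, α (ι z) (V z) = ∑ i, alongCoeff ι V y i z * a i (ι z) := by
    filter_upwards [eventually_eq_sum_alongCoeff hι V y] with z hz
    conv_lhs => rw [hz]
    simp only [map_sum, map_smul, smul_eq_mul, ha]
  have hai : ∀ i, MDifferentiableAt (𝓡 n) 𝓘(ℝ) (fun z => a i (ι z)) y := fun i =>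
    MDifferentiableAt.comp y ((has i).mdiffAt (ι y)) hιy
  rw [dfun_congr h1, dfun_sum (f := fun i z => alongCoeff ι V y i z * a i (ι z))
    fun i _ => (mdiffAt_alongCoeff hV i).mul (hai i), D.along_eq hV,
    map_add, map_sum, map_sum]
  have h2 : D.covForm α (ι y) (mfderiv (𝓡 n) (𝓡 m) ι y X) (V y) = ∑ i, coord i (V y) *
    (mvfderiv (𝓡 m) (a i) (ι y) (mfderiv (𝓡 n) (𝓡 m) ι y X) - α (ι y)
      (D.conn (sext (coordVec (ι y) i)) (ι y) (mfderiv (𝓡 n) (𝓡 m) ι y X))) := rfl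
  rw [h2, ← Finset.sum_add_distrib, ← Finset.sum_add_distrib]
  refine Finset.sum_congr rfl fun i _ => ?_
  rw [dfun_mul (mdiffAt_alongCoeff hV i) (hai i), dfun_comp ((has i).mdiffAt (ι y)) hιy,
      alongCoeff_self]
  simp only [ha, sext_apply_self, map_smul, smul_eq_mul]
  ring

/-- The derivative along `ι` is determined by its values on differentials of functions, which do not
involve trivializations. Its properties are deduced from this description. -/
lemma dfun_along (hι : ContMDiff (𝓡 n) (𝓡 m) ∞ ι) {f : M → ℝ} (hf : SmoothFun m f)
    (hV : DiffAlongAt n ι V y) (X : TangentSpace (𝓡 n) y) :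
    mvfderiv (𝓡 m) f (ι y) (D.along ι V y X)
      = mvfderiv (𝓡 n) (fun z => mvfderiv (𝓡 m) f (ι z) (V z)) y X
        - D.covForm (mvfderiv (𝓡 m) f) (ι y) (mfderiv (𝓡 n) (𝓡 m) ι y X) (V y) := by
  rw [D.dfun_form_along hι (smoothForm_mvfderiv hf) hV]
  ring

lemma mdiffAt_form_along (hι : ContMDiff (𝓡 n) (𝓡 m) ∞ ι)
    {α : ∀ z : M, TangentSpace (𝓡 m) z →L[ℝ] ℝ} (hα : SmoothForm α) (hV : DiffAlongAt n ι V y) :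
    MDifferentiableAt (𝓡 n) 𝓘(ℝ) (fun z => α (ι z) (V z)) y := by
  have hιy : MDifferentiableAt (𝓡 n) (𝓡 m) ι y := hι.mdifferentiable (by simp) y
  have h1 : (fun z => α (ι z) (V z)) =ᶠ[𝓝 y]
      fun z => ∑ i, alongCoeff ι V y i z * α (ι z) (sext (coordVec (ι y) i) (ι z)) := by
    filter_upwards [eventually_eq_sum_alongCoeff hι V y] with z hz
    conv_lhs => rw [hz]
    simp only [map_sum, map_smul, smul_eq_mul]
  refine MDifferentiableAt.congr_of_eventuallyEq ?_ h1
  have h2 : ∀ i, MDifferentiableAt (𝓡 n) 𝓘(ℝ)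
      (fun z => α (ι z) (sext (coordVec (ι y) i) (ι z))) y := fun i =>
    MDifferentiableAt.comp y ((hα _ (smoothField_sext (coordVec (ι y) i))).mdiffAt (ι y)) hιy
  classical
  have : ∀ s : Finset (Fin m), MDifferentiableAt (𝓡 n) 𝓘(ℝ)
      (fun z => ∑ i ∈ s, alongCoeff ι V y i z * α (ι z) (sext (coordVec (ι y) i) (ι z))) y := by
    intro s
    induction s using Finset.induction_on with
    | empty => simpa using mdifferentiableAt_const
    | insert i s hi ih =>
      simp only [Finset.sum_insert hi]
      exact ((mdiffAt_alongCoeff hV i).mul (h2 i)).add ih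
  exact this _

lemma along_add (hι : ContMDiff (𝓡 n) (𝓡 m) ∞ ι) (hV : DiffAlongAt n ι V y)
    (hW : DiffAlongAt n ι W y) (hVW : DiffAlongAt n ι (fun z => V z + W z) y)
    (X : TangentSpace (𝓡 n) y) :
    D.along ι (fun z => V z + W z) y X = D.along ι V y X + D.along ι W y X := by
  refine eq_of_dfun_eq fun f hf => ?_
  have hf' := smoothForm_mvfderiv hf
  rw [map_add, D.dfun_along hι hf hVW, D.dfun_along hι hf hV, D.dfun_along hι hf hW]
  simp only [map_add]
  rw [dfun_add (mdiffAt_form_along hι hf' hV) (mdiffAt_form_along hι hf' hW)]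
  ring

lemma along_smul (hι : ContMDiff (𝓡 n) (𝓡 m) ∞ ι) {a : N → ℝ}
    (ha : MDifferentiableAt (𝓡 n) 𝓘(ℝ) a y) (hV : DiffAlongAt n ι V y)
    (haV : DiffAlongAt n ι (fun z => a z • V z) y) (X : TangentSpace (𝓡 n) y) :
    D.along ι (fun z => a z • V z) y X
      = a y • D.along ι V y X + mvfderiv (𝓡 n) a y X • V y := by
  refine eq_of_dfun_eq fun f hf => ?_
  have hf' := smoothForm_mvfderiv hf
  rw [map_add, map_smul, map_smul, D.dfun_along hι hf haV, D.dfun_along hι hf hV]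
  simp only [map_smul, smul_eq_mul]
  rw [dfun_mul ha (mdiffAt_form_along hι hf' hV)]
  ring

/-- The derivative along `ι` without the trivialization at `ι y`, which is the identity of
`T_{ι y}M`. -/
lemma along_eq_add (V : ∀ z : N, TangentSpace (𝓡 m) (ι z)) (X : TangentSpace (𝓡 n) y) :
    D.along ι V y X = @id (TangentSpace (𝓡 m) (ι y)) (mvfderiv (𝓡 n) (fun z =>
      (trivializationAt (EuclideanSpace ℝ (Fin m)) (TangentSpace (𝓡 m) : M → Type _) (ι y)
        ⟨ι z, V z⟩).2) y X)
      + D.conn (ext (V y)) (ι y) (mfderiv (𝓡 n) (𝓡 m) ι y X) :=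
  congrArg (· + _) (triv_symm_self (x := ι y) _)

lemma along_add_right (V : ∀ z : N, TangentSpace (𝓡 m) (ι z)) (X X' : TangentSpace (𝓡 n) y) :
    D.along ι V y (X + X') = D.along ι V y X + D.along ι V y X' := by
  rw [along_eq_add, along_eq_add, along_eq_add, map_add, map_add, map_add]
  exact add_add_add_comm _ _ _ _

lemma along_smul_right (V : ∀ z : N, TangentSpace (𝓡 m) (ι z)) (a : ℝ)
    (X : TangentSpace (𝓡 n) y) : D.along ι V y (a • X) = a • D.along ι V y X := by
  rw [along_eq_add, along_eq_add, map_smul, map_smul, map_smul]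
  exact (smul_add _ _ _).symm

lemma dfun_inner_comp (hι : ContMDiff (𝓡 n) (𝓡 m) ∞ ι) (g : c.metrics)
    (hV : DiffAlongAt n ι V y) {Y : ∀ z : M, TangentSpace (𝓡 m) z} (hY : SmoothField Y)
    (X : TangentSpace (𝓡 n) y) :
    mvfderiv (𝓡 n) (fun z => g.1.inner (ι z) (V z) (Y (ι z))) y X
      = g.1.inner (ι y) (D.along ι V y X) (Y (ι y))
        + g.1.inner (ι y) (V y) (D.conn Y (ι y) (mfderiv (𝓡 n) (𝓡 m) ι y X))
        - 2 * D.lee g (ι y) (mfderiv (𝓡 n) (𝓡 m) ι y X) * g.1.inner (ι y) (V y) (Y (ι y)) := by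
  have hα : SmoothForm (fun z => g.1.inner z (Y z)) := fun U hU => smoothFun_inner g.1 hY hU
  have h := D.dfun_form_along hι hα hV X
  have hW := smoothField_sext (V y)
  have h2 := D.covForm_apply hα (mfderiv (𝓡 n) (𝓡 m) ι y X) hW
  have h3 := D.dfun_inner g (hY.diffAt (ι y)) (hW.diffAt (ι y)) (mfderiv (𝓡 n) (𝓡 m) ι y X)
  rw [sext_apply_self] at h2 h3
  simp only [inner_symm' g.1 _ (V _) _]
  rw [h, h2, h3, inner_symm' g.1 (ι y) (D.along ι V y X)]
  ring

/-- Compatibility of the derivative along `ι` with the metrics of the conformal class. -/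
lemma dfun_inner_along (hι : ContMDiff (𝓡 n) (𝓡 m) ∞ ι) (g : c.metrics)
    (hV : DiffAlongAt n ι V y) (hW : DiffAlongAt n ι W y) (X : TangentSpace (𝓡 n) y) :
    mvfderiv (𝓡 n) (fun z => g.1.inner (ι z) (V z) (W z)) y X
      = g.1.inner (ι y) (D.along ι V y X) (W y) + g.1.inner (ι y) (V y) (D.along ι W y X)
        - 2 * D.lee g (ι y) (mfderiv (𝓡 n) (𝓡 m) ι y X) * g.1.inner (ι y) (V y) (W y) := by
  set E : Fin m → ∀ z : M, TangentSpace (𝓡 m) z := fun i => sext (coordVec (ι y) i) with hE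
  have hEs : ∀ i, SmoothField (E i) := fun i => smoothField_sext _
  have h1 : ∀ᶠ z in 𝓝 y, g.1.inner (ι z) (V z) (W z)
      = ∑ i, alongCoeff ι W y i z * g.1.inner (ι z) (V z) (E i (ι z)) := by
    filter_upwards [eventually_eq_sum_alongCoeff hι W y] with z hz
    conv_lhs => rw [hz]
    simp only [map_sum, map_smul, smul_eq_mul, hE]
  have h2 : ∀ i, MDifferentiableAt (𝓡 n) 𝓘(ℝ)
      (fun z => g.1.inner (ι z) (V z) (E i (ι z))) y := fun i =>
    diffAt_inner_along g.1 hV (((hEs i).along hι).diffAt y)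
  have hWy : W y = ∑ i, coord i (W y) • E i (ι y) := by
    simp only [hE, sext_apply_self]
    exact (sum_coord _).symm
  rw [dfun_congr h1, dfun_sum
    (f := fun i z => alongCoeff ι W y i z * g.1.inner (ι z) (V z) (E i (ι z)))
    fun i _ => (mdiffAt_alongCoeff hW i).mul (h2 i), D.along_eq hW]
  have hgW : ∀ u, g.1.inner (ι y) u (W y)
      = ∑ i, coord i (W y) * g.1.inner (ι y) u (E i (ι y)) := fun u => by
    conv_lhs => rw [hWy]
    simp only [map_sum, map_smul, smul_eq_mul]
  rw [hgW, hgW]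
  simp only [map_add, map_sum, map_smul, smul_eq_mul]
  rw [Finset.mul_sum, ← Finset.sum_add_distrib, ← Finset.sum_add_distrib, ← Finset.sum_sub_distrib]
  refine Finset.sum_congr rfl fun i _ => ?_
  rw [dfun_mul (mdiffAt_alongCoeff hW i) (h2 i), D.dfun_inner_comp hι g hV (hEs i), alongCoeff_self]
  simp only [hE, sext_apply_self]
  ring

/-- The derivative along `ι` is torsion-free. -/
lemma along_torsion (hι : ContMDiff (𝓡 n) (𝓡 m) ∞ ι) {X Y : ∀ z : N, TangentSpace (𝓡 n) z}
    (hX : SmoothField X) (hY : SmoothField Y) (y : N) :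
    D.along ι (fun z => mfderiv (𝓡 n) (𝓡 m) ι z (Y z)) y (X y)
      - D.along ι (fun z => mfderiv (𝓡 n) (𝓡 m) ι z (X z)) y (Y y)
      = mfderiv (𝓡 n) (𝓡 m) ι y (VectorField.mlieBracket (𝓡 n) X Y y) := by
  refine eq_of_dfun_eq fun f hf => ?_
  have hιd : ∀ z, MDifferentiableAt (𝓡 n) (𝓡 m) ι z := fun z => hι.mdifferentiable (by simp) z
  have hfι : SmoothFun n (fun z => f (ι z)) := hf.comp hι
  have h := dfun_mlieBracket hX hY hfι y
  simp only [fun z (v : TangentSpace (𝓡 n) z) => dfun_comp (hf.mdiffAt (ι z)) (hιd z) v] at h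
  rw [h, map_sub, D.dfun_along hι hf ((SmoothField.mfderiv hι hY).diffAt y),
    D.dfun_along hι hf ((SmoothField.mfderiv hι hX).diffAt y), D.covForm_dfun_symm hf]
  ring

/-- The formula `conn_eq` for fields along `ι`. -/
lemma along_change (g : c.metrics) (V : ∀ z : N, TangentSpace (𝓡 m) (ι z)) (y : N)
    (X : TangentSpace (𝓡 n) y) :
    D'.along ι V y X = D.along ι V y X
      + D.leeDiff D' g (ι y) (mfderiv (𝓡 n) (𝓡 m) ι y X) • V y
      + D.leeDiff D' g (ι y) (V y) • mfderiv (𝓡 n) (𝓡 m) ι y X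
      - g.1.inner (ι y) (mfderiv (𝓡 n) (𝓡 m) ι y X) (V y) • D.leeSharp D' g (ι y) := by
  simp only [along]
  rw [D.conn_eq D' g (diffFieldAt_ext (V y)), ext_apply_self]
  abel

/-- The derivative along `ι` of a smooth field is smooth, in weak form. -/
lemma smoothFun_inner_along_mfderiv (hι : ContMDiff (𝓡 n) (𝓡 m) ∞ ι) (g : c.metrics)
    (hV : SmoothAlong n ι V) (hW : SmoothAlong n ι W) {X : ∀ z : N, TangentSpace (𝓡 n) z}
    (hX : SmoothField X) :
    SmoothFun n (fun z => g.1.inner (ι z) (D.along ι V z (X z)) (W z)) := by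
  refine smoothFun_of_eventuallyEq fun y => ?_
  obtain ⟨b, hb, -, hWb⟩ := hW.exists_coeff hι y
  set E : Fin m → ∀ z : M, TangentSpace (𝓡 m) z := fun i => sext (coordVec (ι y) i) with hE
  have hEs : ∀ i, SmoothField (E i) := fun i => smoothField_sext _
  have h1 : ∀ i, SmoothFun n (fun z => g.1.inner (ι z) (D.along ι V z (X z)) (E i (ι z))) := by
    intro i
    have e : ∀ z, g.1.inner (ι z) (D.along ι V z (X z)) (E i (ι z))
        = mvfderiv (𝓡 n) (fun z => g.1.inner (ι z) (V z) (E i (ι z))) z (X z)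
        - g.1.inner (ι z) (V z) (D.conn (E i) (ι z) (mfderiv (𝓡 n) (𝓡 m) ι z (X z)))
        + 2 * D.lee g (ι z) (mfderiv (𝓡 n) (𝓡 m) ι z (X z))
          * g.1.inner (ι z) (V z) (E i (ι z)) := fun z => by
      rw [D.dfun_inner_comp hι g (hV.diffAt z) (hEs i)]
      ring
    simp only [e]
    have i1 := smoothFun_inner_along g.1 hV ((hEs i).along hι)
    have i2 := SmoothField.mfderiv hι hX
    have i3 := smoothFun_form_along hι (B := fun z => (LinearMap.mk₂ ℝ
      (fun u w => g.1.inner z u (D.conn (E i) z w)) (fun _ _ _ => by simp) (fun _ _ _ => by simp)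
      (fun _ _ _ => by simp) (fun _ _ _ => by simp)))
      (fun U U' hU hU' => smoothFun_inner g.1 hU (D.smoothField_nab hU' (hEs i))) hV i2
    exact ((i1.deriv hX).sub i3).add
      ((contMDiff_const.mul (smoothFun_oneForm_along hι (D.smoothForm_lee g) i2)).mul i1)
  refine ⟨fun z => ∑ i, b i z * g.1.inner (ι z) (D.along ι V z (X z)) (E i (ι z)),
    smoothFun_sum (fun i _ => (hb i).mul (h1 i)) y, ?_⟩
  filter_upwards [hWb] with z hz
  rw [hz]
  simp only [map_sum, map_smul, smul_eq_mul, hE]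

end WeylStructure

/-! ### The Weyl structure induced on a submanifold -/

section Induced

variable {m n : ℕ} {M N : Type*} [TopologicalSpace M] [T2Space M]
  [ChartedSpace (EuclideanSpace ℝ (Fin m)) M] [IsManifold (𝓡 m) ∞ M]
  [TopologicalSpace N] [T2Space N]
  [ChartedSpace (EuclideanSpace ℝ (Fin n)) N] [IsManifold (𝓡 n) ∞ N]
  {c : ConformalStructure m M} {cN : ConformalStructure n N} {ι : N → M}

lemma tangentPart_add (ι : N → M) (g : Metric m M) (gN : Metric n N) (y : N)
    (v w : TangentSpace (𝓡 m) (ι y)) :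
    tangentPart ι g gN y (v + w) = tangentPart ι g gN y v + tangentPart ι g gN y w := by
  simp only [tangentPart, map_add, _root_.add_apply, mul_add, add_smul, Finset.sum_add_distrib]

lemma tangentPart_smul (ι : N → M) (g : Metric m M) (gN : Metric n N) (y : N) (a : ℝ)
    (v : TangentSpace (𝓡 m) (ι y)) :
    tangentPart ι g gN y (a • v) = a • tangentPart ι g gN y v := by
  simp only [tangentPart, map_smul, _root_.smul_apply, smul_eq_mul, Finset.smul_sum, smul_smul,
    mul_left_comm a]

/-- The tangential projection as a linear map. -/
def tangentPartL (ι : N → M) (g : Metric m M) (gN : Metric n N) (y : N) :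
    TangentSpace (𝓡 m) (ι y) →ₗ[ℝ] TangentSpace (𝓡 n) y :=
  ⟨⟨tangentPart ι g gN y, tangentPart_add ι g gN y⟩, tangentPart_smul ι g gN y⟩

/-- The tangential projection is the adjoint of the differential of `ι`. -/
lemma inner_tangentPart (g : Metric m M) (gN : Metric n N) (y : N)
    (w : TangentSpace (𝓡 m) (ι y)) (v : TangentSpace (𝓡 n) y) :
    gN.inner y (tangentPart ι g gN y w) v
      = g.inner (ι y) w (mfderiv (𝓡 n) (𝓡 m) ι y v) :=
  inner_sharp ((innerL g (ι y) w).comp (mfderiv (𝓡 n) (𝓡 m) ι y).toLinearMap) v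

lemma IsPullback.tangentPart_mfderiv {g : Metric m M} {gN : Metric n N} (hp : IsPullback ι g gN)
    (y : N) (v : TangentSpace (𝓡 n) y) :
    tangentPart ι g gN y (mfderiv (𝓡 n) (𝓡 m) ι y v) = v :=
  eq_of_inner_eq gN y fun w => by rw [inner_tangentPart, hp]

lemma IsPullback.scalesBy {g g' : Metric m M} {gN gN' : Metric n N} (hp : IsPullback ι g gN)
    (hp' : IsPullback ι g' gN') {y : N} {t : ℝ} (h : ScalesBy g g' (ι y) t) :
    ScalesBy gN gN' y t := fun v w => by rw [hp, hp', h]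

/-- The orthogonal splitting depends only on the conformal structure. -/
lemma IsPullback.tangentPart_eq {g g' : Metric m M} {gN gN' : Metric n N}
    (hp : IsPullback ι g gN) (hp' : IsPullback ι g' gN') {y : N} {t : ℝ}
    (h : ScalesBy g g' (ι y) t) (w : TangentSpace (𝓡 m) (ι y)) :
    tangentPart ι g' gN' y w = tangentPart ι g gN y w :=
  eq_of_inner_eq gN' y fun v => by
    rw [inner_tangentPart, h, hp.scalesBy hp' h, inner_tangentPart]

/-- A family of endomorphisms of the tangent spaces is smooth as a section of the bundle of
endomorphisms if it maps smooth fields to smooth fields. -/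
lemma contMDiff_hom_of_forall {A : ∀ x : M, TangentSpace (𝓡 m) x →L[ℝ] TangentSpace (𝓡 m) x}
    (hA : ∀ X, SmoothField X → SmoothField (fun x => A x (X x))) :
    ContMDiff (𝓡 m) ((𝓡 m).prod 𝓘(ℝ, EuclideanSpace ℝ (Fin m) →L[ℝ] EuclideanSpace ℝ (Fin m))) ∞
      (fun x => (⟨x, A x⟩ : TotalSpace (EuclideanSpace ℝ (Fin m) →L[ℝ] EuclideanSpace ℝ (Fin m))
        fun x : M => TangentSpace (𝓡 m) x →L[ℝ] TangentSpace (𝓡 m) x)) := by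
  intro x
  refine (contMDiffAt_hom_bundle _).2 ⟨contMDiffAt_id, ?_⟩
  set t := trivializationAt (EuclideanSpace ℝ (Fin m)) (TangentSpace (𝓡 m) : M → Type _) x with ht
  set E := EuclideanSpace ℝ (Fin m)
  have hi : ∀ i : Fin m, ContMDiffAt (𝓡 m) 𝓘(ℝ, E) ∞
      (fun z => (t ⟨z, A z (sext (coordVec x i) z)⟩).2) x := fun i =>
    (contMDiffAt_section _).1 (hA _ (smoothField_sext (coordVec x i)) x)
  have hsum : ContMDiffAt (𝓡 m) 𝓘(ℝ, E →L[ℝ] E) ∞ (fun z => ∑ i : Fin m,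
      ContinuousLinearMap.smulRightL ℝ E E (EuclideanSpace.proj i)
        ((t ⟨z, A z (sext (coordVec x i) z)⟩).2)) x :=
    contMDiffAt_finsetSum fun i _ =>
      (ContinuousLinearMap.contMDiff _).contMDiffAt.comp x (hi i)
  refine hsum.congr_of_eventuallyEq ?_
  have h1 : ∀ᶠ z in 𝓝 x, ∀ i, sext (m := m) (coordVec x i) z = ext (coordVec x i) z :=
    Filter.eventually_all.2 fun i => sext_eventuallyEq _
  filter_upwards [h1, t.open_baseSet.mem_nhds (mem_baseSet x)] with z hz hzb
  ext1 v
  have hv : v = ∑ i, v i • (EuclideanSpace.single i (1 : ℝ) : E) := by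
    have := (EuclideanSpace.basisFun (Fin m) ℝ).sum_repr v
    simpa using this.symm
  conv_lhs => rw [hv]
  rw [map_sum, _root_.sum_apply]
  refine Finset.sum_congr rfl fun i _ => ?_
  rw [map_smul, hz i, ext_eq_symmL _ hzb]
  simp only [ContinuousLinearMap.inCoordinates, ContinuousLinearMap.comp_apply]
  rw [Trivialization.continuousLinearMapAt_apply, Trivialization.coe_linearMapAt_of_mem _ hzb]
  rfl

namespace WeylStructure

variable (D : WeylStructure c)

/-- The Lee form is determined by the metric compatibility for a single field that does not vanish
at `x`. -/
lemma lee_eq_of_dfun (g : c.metrics) {Y : ∀ z : M, TangentSpace (𝓡 m) z} {x : M}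
    (hY : SmoothField Y) (hYx : Y x ≠ 0) {v : TangentSpace (𝓡 m) x} {a : ℝ}
    (h : mvfderiv (𝓡 m) (fun z => g.1.inner z (Y z) (Y z)) x v
      = g.1.inner x (D.conn Y x v) (Y x) + g.1.inner x (Y x) (D.conn Y x v)
        - 2 * a * g.1.inner x (Y x) (Y x)) : D.lee g x v = a := by
  have h1 := D.dfun_inner g (hY.diffAt x) (hY.diffAt x) v
  have h2 := (g.1.pos x _ hYx).ne'
  have h3 : (D.lee g x v - a) * g.1.inner x (Y x) (Y x) = 0 := by linarith
  rcases mul_eq_zero.1 h3 with h4 | h4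
  · linarith
  · exact absurd h4 h2

/-- The covariant derivative `(∇_X Y)^N` for fields tangent to the submanifold. -/
def inducedConn (hι : ContMDiff (𝓡 n) (𝓡 m) ∞ ι) (g : Metric m M) (gN : Metric n N)
    (hp : IsPullback ι g gN) :
    CovariantDerivative (𝓡 n) (EuclideanSpace ℝ (Fin n)) (TangentSpace (𝓡 n) : N → Type _) where
  toFun σ y :=
    haveI : FiniteDimensional ℝ (TangentSpace (𝓡 n) y) :=
      inferInstanceAs (FiniteDimensional ℝ (EuclideanSpace ℝ (Fin n)))
    haveI : T2Space (TangentSpace (𝓡 n) y) := inferInstanceAs (T2Space (EuclideanSpace ℝ (Fin n)))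
    LinearMap.toContinuousLinearMap
      ⟨⟨fun X => tangentPart ι g gN y
          (D.along ι (fun z => mfderiv (𝓡 n) (𝓡 m) ι z (σ z)) y X),
        fun X X' => by rw [along_add_right, tangentPart_add]⟩,
        fun a X => (congrArg (tangentPart ι g gN y) (D.along_smul_right _ a X)).trans
          (tangentPart_smul ι g gN y a _)⟩
  isCovariantDerivativeOnUniv := by
    constructor
    · intro σ σ' y hσ hσ' _
      ext1 X
      have h := D.along_add hι (DiffFieldAt.mfderiv hι hσ) (DiffFieldAt.mfderiv hι hσ')
        (by
          have := DiffFieldAt.mfderiv hι (mdifferentiableAt_add_section hσ hσ')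
          simpa only [Pi.add_apply, map_add] using this) X
      have h2 := congrArg (tangentPart ι g gN y) h
      rw [tangentPart_add] at h2
      refine Eq.trans ?_ h2
      simp only [← map_add]
      rfl
    · intro σ a y hσ ha _
      ext1 X
      have h := D.along_smul hι ha (DiffFieldAt.mfderiv hι hσ)
        (by
          have := DiffFieldAt.mfderiv hι (ha.smul_section hσ)
          simpa only [Pi.smul_apply', map_smul] using this) X
      have h2 := congrArg (tangentPart ι g gN y) h
      rw [tangentPart_add, tangentPart_smul, tangentPart_smul, hp.tangentPart_mfderiv] at h2
      refine Eq.trans ?_ h2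
      simp only [← map_smul]
      rfl

lemma inducedConn_apply (hι : ContMDiff (𝓡 n) (𝓡 m) ∞ ι) {g : Metric m M} {gN : Metric n N}
    (hp : IsPullback ι g gN) (σ : ∀ y : N, TangentSpace (𝓡 n) y) (y : N)
    (X : TangentSpace (𝓡 n) y) : D.inducedConn hι g gN hp σ y X = tangentPart ι g gN y
      (D.along ι (fun z => mfderiv (𝓡 n) (𝓡 m) ι z (σ z)) y X) := rfl

lemma inner_inducedConn (hι : ContMDiff (𝓡 n) (𝓡 m) ∞ ι) {g : Metric m M} {gN : Metric n N}
    (hp : IsPullback ι g gN) (σ : ∀ y : N, TangentSpace (𝓡 n) y) (y : N)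
    (X Y : TangentSpace (𝓡 n) y) : gN.inner y (D.inducedConn hι g gN hp σ y X) Y
      = g.inner (ι y) (D.along ι (fun z => mfderiv (𝓡 n) (𝓡 m) ι z (σ z)) y X)
        (mfderiv (𝓡 n) (𝓡 m) ι y Y) := by
  rw [inducedConn_apply, inner_tangentPart]

lemma dfun_inner_inducedConn (hι : ContMDiff (𝓡 n) (𝓡 m) ∞ ι) {g : c.metrics} {gN : Metric n N}
    (hp : IsPullback ι g.1 gN) {Y Z : ∀ y : N, TangentSpace (𝓡 n) y} {y : N}
    (hY : DiffFieldAt Y y) (hZ : DiffFieldAt Z y) (v : TangentSpace (𝓡 n) y) :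
    mvfderiv (𝓡 n) (fun z => gN.inner z (Y z) (Z z)) y v
      = gN.inner y (D.inducedConn hι g.1 gN hp Y y v) (Z y)
        + gN.inner y (Y y) (D.inducedConn hι g.1 gN hp Z y v)
        - 2 * D.lee g (ι y) (mfderiv (𝓡 n) (𝓡 m) ι y v) * gN.inner y (Y y) (Z y) := by
  rw [inner_symm' gN y (Y y), inner_inducedConn, inner_inducedConn]
  simp only [hp _ (Y _) (Z _)]
  rw [D.dfun_inner_along hι g (DiffFieldAt.mfderiv hι hY) (DiffFieldAt.mfderiv hι hZ),
    inner_symm' g.1 (ι y) (mfderiv (𝓡 n) (𝓡 m) ι y (Y y)) (D.along ι _ y v)]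

variable (cN) in
/-- The logarithm `u` of the conformal factor, `g' = e^{2u} g`. -/
def logFactor (g g' : cN.metrics) : N → ℝ := ((cN.mem_iff g.1 g.2 g'.1).1 g'.2).choose

lemma smoothFun_logFactor (g g' : cN.metrics) : SmoothFun n (logFactor cN g g') :=
  ((cN.mem_iff g.1 g.2 g'.1).1 g'.2).choose_spec.1

lemma scalesBy_logFactor (g g' : cN.metrics) (y : N) :
    ScalesBy g.1 g'.1 y (logFactor cN g g' y) :=
  ((cN.mem_iff g.1 g.2 g'.1).1 g'.2).choose_spec.2 y

/-- The Weyl structure `(∇_X Y)^N` on a conformal submanifold. Its Lee form in the metric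
`gN = ι^* g` is the pull-back of that of `∇`; in another metric `e^{2u} gN` of the class, `du` is
subtracted. -/
def induced (hι : ContMDiff (𝓡 n) (𝓡 m) ∞ ι) (g : c.metrics) (gN : cN.metrics)
    (hp : IsPullback ι g.1 gN.1) : WeylStructure cN where
  conn := D.inducedConn hι g.1 gN.1 hp
  smooth := ⟨⟨fun {σ} hσ => by
    have hσ' : SmoothField σ := contMDiffOn_univ.1 hσ
    refine contMDiffOn_univ.2 (contMDiff_hom_of_forall fun X hX => ?_)
    refine smoothField_of_inner gN.1 fun W hW => ?_
    simp only [inducedConn_apply, inner_tangentPart]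
    exact D.smoothFun_inner_along_mfderiv hι g (SmoothField.mfderiv hι hσ')
      (SmoothField.mfderiv hι hW) hX⟩⟩
  torsion_free := by
    have h : (D.inducedConn hι g.1 gN.1 hp).torsion = 0 := by
      ext y v w
      have h1 := CovariantDerivative.torsion_apply (D.inducedConn hι g.1 gN.1 hp)
        ((smoothField_sext v).diffAt y) ((smoothField_sext w).diffAt y)
      rw [sext_apply_self, sext_apply_self] at h1
      have h2 := congrArg (tangentPartL ι g.1 gN.1 y)
        (D.along_torsion hι (smoothField_sext v) (smoothField_sext w) y)
      rw [map_sub, sext_apply_self, sext_apply_self] at h2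
      rw [h1]
      refine sub_eq_zero.2 (h2.trans ?_)
      exact hp.tangentPart_mfderiv y _
    intro X Y y hX hY
    exact (CovariantDerivative.torsion_eq_zero_iff _).1 h hX hY
  lee g' y := (D.lee g (ι y)).comp (mfderiv (𝓡 n) (𝓡 m) ι y)
    - mvfderiv (𝓡 n) (logFactor cN gN g') y
  conformal g' Y Z y hY hZ v := by
    have hu := smoothFun_logFactor gN g'
    have h := scalesBy_logFactor gN g'
    have he : MDifferentiableAt (𝓡 n) 𝓘(ℝ) (fun z => 2 * logFactor cN gN g' z) y :=
      SmoothFun.mdiffAt (contMDiff_const.mul hu) y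
    have he' : MDifferentiableAt (𝓡 n) 𝓘(ℝ) (fun z => Real.exp (2 * logFactor cN gN g' z)) y :=
      SmoothFun.mdiffAt (Real.contDiff_exp.contMDiff.comp (contMDiff_const.mul hu)) y
    have hYZ : MDifferentiableAt (𝓡 n) 𝓘(ℝ) (fun z => gN.1.inner z (Y z) (Z z)) y :=
      diffAt_inner_along (ι := id) gN.1 hY hZ
    simp only [h _ _ _]
    rw [dfun_mul he' hYZ, dfun_exp he, dfun_const_mul 2 (hu.mdiffAt y),
      D.dfun_inner_inducedConn hι hp hY hZ]
    simp only [_root_.sub_apply, ContinuousLinearMap.comp_apply]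
    ring

lemma induced_lee (hι : ContMDiff (𝓡 n) (𝓡 m) ∞ ι) (g : c.metrics) (gN : cN.metrics)
    (hp : IsPullback ι g.1 gN.1) (y : N) (v : TangentSpace (𝓡 n) y) :
    (D.induced hι g gN hp).lee gN y v
      = D.lee g (ι y) (mfderiv (𝓡 n) (𝓡 m) ι y v) := by
  by_cases hv : v = 0
  · simp [hv]
  obtain ⟨Y, hY, hYv⟩ := exists_smoothField v
  exact (D.induced hι g gN hp).lee_eq_of_dfun gN hY (by rwa [hYv])
    (D.dfun_inner_inducedConn hι hp (hY.diffAt y) (hY.diffAt y) v)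

/-- For every pair of a metric of the class on `M` and its pull-back, and not only for the pair that
is used in the definition, the Lee form of the induced Weyl structure is a pull-back. -/
lemma induced_lee_of_isPullback (hι : ContMDiff (𝓡 n) (𝓡 m) ∞ ι) (g : c.metrics) (gN : cN.metrics)
    (hp : IsPullback ι g.1 gN.1) {g' : c.metrics} {gN' : cN.metrics}
    (hp' : IsPullback ι g'.1 gN'.1) (y : N) (v : TangentSpace (𝓡 n) y) :
    (D.induced hι g gN hp).lee gN' y v = D.lee g' (ι y) (mfderiv (𝓡 n) (𝓡 m) ι y v) := by
  obtain ⟨u, hu, h⟩ := (c.mem_iff g.1 g.2 g'.1).1 g'.2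
  have hιy : MDifferentiableAt (𝓡 n) (𝓡 m) ι y := hι.mdifferentiable (by simp) y
  have huι : SmoothFun n (fun z => u (ι z)) := hu.comp hι
  rw [(D.induced hι g gN hp).lee_gauge huι fun z => hp.scalesBy hp' (h (ι z)), induced_lee,
    D.lee_gauge hu h, dfun_comp (SmoothFun.mdiffAt hu (ι y)) hιy]

/-- The horizontal Hessian is the Hessian of the induced Weyl structure. -/
lemma induced_hess (hι : ContMDiff (𝓡 n) (𝓡 m) ∞ ι) (g : c.metrics) (gN : cN.metrics)
    (hp : IsPullback ι g.1 gN.1) {g' : c.metrics} {gN' : cN.metrics}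
    (hp' : IsPullback ι g'.1 gN'.1) (k : ℝ) (f : N → ℝ) (y : N) :
    (D.induced hι g gN hp).hess gN' k f y = D.horizontalHess ι g' gN'.1 k f y := by
  obtain ⟨u, -, h⟩ := (c.mem_iff g.1 g.2 g'.1).1 g'.2
  have hd : ∀ f z v, (D.induced hι g gN hp).deriv gN' k f z v = D.derivAlong ι g' k f z v :=
    fun f z v => by rw [deriv, derivAlong, D.induced_lee_of_isPullback hι g gN hp hp']
  funext v w
  simp only [hess, horizontalHess, hd, hp.tangentPart_eq hp' (h (ι y))]
  rfl

end WeylStructure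

end Induced

/-! ### Conformal invariance of the Laplacian -/

namespace WeylStructure

section Laplacian

variable {m : ℕ} {M : Type*} [TopologicalSpace M] [T2Space M]
  [ChartedSpace (EuclideanSpace ℝ (Fin m)) M] [IsManifold (𝓡 m) ∞ M]
  {c : ConformalStructure m M} (D D' : WeylStructure c) (g : c.metrics)

lemma derivL_change (k : ℝ) (f : M → ℝ) :
    D'.derivL g k f = D.derivL g k f + fun z => (k * f z) • D.leeDiff D' g z := by
  funext z
  simp only [derivL, Pi.add_apply, leeDiff]
  module

lemma covForm_smul {a : M → ℝ} (ha : SmoothFun m a)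
    {α : ∀ z : M, TangentSpace (𝓡 m) z →L[ℝ] ℝ} (hα : SmoothForm α) (x : M)
    (v w : TangentSpace (𝓡 m) x) :
    D.covForm (fun z => a z • α z) x v w
      = a x * D.covForm α x v w + mvfderiv (𝓡 m) a x v * α x w := by
  have hw := smoothField_sext w
  have haα : SmoothForm (fun z => a z • α z) := fun X hX => ha.mul (hα X hX)
  have h1 := D.covForm_apply hα v hw
  have h3 := D.covForm_apply haα v hw
  simp only [sext_apply_self, _root_.smul_apply, smul_eq_mul] at h1 h3
  rw [dfun_mul (ha.mdiffAt x) ((hα _ hw).mdiffAt x), sext_apply_self] at h3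
  rw [h1, h3]
  ring

/-- The trace of the Hessian on densities of weight `1 - m/2` changes only by a term of order zero:
the terms of order one, `(2k - 2 + m) (∇_{γ^♯} s)`, cancel for this weight. -/
lemma metricTrace_hess_change {k : ℝ} (hk : k = 1 - m / 2) {f : M → ℝ} (hf : SmoothFun m f)
    (x : M) : metricTrace g.1 x (D'.hess g k f x) = metricTrace g.1 x (D.hess g k f x)
      + k * metricTrace g.1 x (fun v w => D.schoutenDiff D' g x v w) * f x := by
  have hγ := D.smoothForm_leeDiff D' g
  have hδ := D.smoothForm_derivL g k hf
  have hδ' := D'.smoothForm_derivL g k hf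
  have hkf : SmoothFun m (fun z => k * f z) := contMDiff_const.mul hf
  have hkγ : SmoothForm (fun z => (k * f z) • D.leeDiff D' g z) := fun X hX => hkf.mul (hγ X hX)
  have hd' : ∀ v, D'.deriv g k f x v = D.deriv g k f x v + k * f x * D.leeDiff D' g x v :=
    fun v => by
      simp only [deriv, leeDiff_apply]
      ring
  have hdf : ∀ v, mvfderiv (𝓡 m) f x v = D.deriv g k f x v - k * D.lee g x v * f x := fun v => by
    rw [deriv]; ring
  have hlee : ∀ v, D'.lee g x v = D.lee g x v + D.leeDiff D' g x v := fun v => by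
    rw [leeDiff_apply]; ring
  have h : D'.hess g k f x = fun v w => D.hess g k f x v w
      + k * f x * D.schoutenDiff D' g x v w
      + (k - 1) * (D.leeDiff D' g x v * D.derivL g k f x w)
      + (k - 1) * (D.leeDiff D' g x w * D.derivL g k f x v)
      + (k ^ 2 * f x - k * f x) * (D.leeDiff D' g x v * D.leeDiff D' g x w)
      + (D.deriv g k f x (D.leeSharp D' g x)
        + k * f x / 2 * D.leeDiff D' g x (D.leeSharp D' g x)) * g.1.inner x v w := by
    funext v w
    rw [D'.hess_eq g k hf, D.hess_eq g k hf, D.covForm_change D' g hδ', D.derivL_change D' g,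
      D.covForm_add hδ hkγ, D.covForm_smul hkf hγ, ← D.derivL_change D' g, derivL_apply,
      derivL_apply, derivL_apply, derivL_apply, derivL_apply, hd', hd', hd',
      dfun_const_mul k (hf.mdiffAt x), hdf, hlee, schoutenDiff_apply]
    ring
  have hs : ∀ α : TangentSpace (𝓡 m) x →L[ℝ] ℝ,
      metricTrace g.1 x (fun v w => D.leeDiff D' g x v * α w) = α (D.leeSharp D' g x) :=
    fun α => metricTrace_mul (g := g.1) (D.leeDiff D' g x) α.toLinearMap
  rw [h, metricTrace_add (fun v w => _ + _ + _ + _ + _), metricTrace_add (fun v w => _ + _ + _ + _),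
    metricTrace_add (fun v w => _ + _ + _), metricTrace_add (fun v w => _ + _),
    metricTrace_add (D.hess g k f x), metricTrace_const_mul, metricTrace_const_mul,
    metricTrace_const_mul, metricTrace_const_mul, metricTrace_const_mul,
    metricTrace_swap (fun v w => D.leeDiff D' g x v * D.derivL g k f x w), hs, hs,
    metricTrace_metric, derivL_apply]
  rw [hk]
  ring

end Laplacian

end WeylStructure

/-! ### Independence of the Weyl structure -/

section Independence

variable {m n : ℕ} {M N : Type*} [TopologicalSpace M] [T2Space M]
  [ChartedSpace (EuclideanSpace ℝ (Fin m)) M] [IsManifold (𝓡 m) ∞ M]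
  [TopologicalSpace N] [T2Space N]
  [ChartedSpace (EuclideanSpace ℝ (Fin n)) N] [IsManifold (𝓡 n) ∞ N]
  {c : ConformalStructure m M} {cN : ConformalStructure n N} {ι : N → M}

/-- The normal projection as a linear map. -/
def normalPartL (ι : N → M) (g : Metric m M) (gN : Metric n N) (y : N) :
    TangentSpace (𝓡 m) (ι y) →ₗ[ℝ] TangentSpace (𝓡 m) (ι y) :=
  LinearMap.id - (mfderiv (𝓡 n) (𝓡 m) ι y).toLinearMap ∘ₗ tangentPartL ι g gN y

lemma normalPartL_apply (ι : N → M) (g : Metric m M) (gN : Metric n N) (y : N)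
    (w : TangentSpace (𝓡 m) (ι y)) : normalPartL ι g gN y w = normalPart ι g gN y w := rfl

lemma IsPullback.normalPart_mfderiv {g : Metric m M} {gN : Metric n N} (hp : IsPullback ι g gN)
    (y : N) (v : TangentSpace (𝓡 n) y) :
    normalPart ι g gN y (mfderiv (𝓡 n) (𝓡 m) ι y v) = 0 := by
  rw [normalPart, hp.tangentPart_mfderiv, sub_self]

lemma IsPullback.inner_normalPart_mfderiv {g : Metric m M} {gN : Metric n N}
    (hp : IsPullback ι g gN) (y : N) (w : TangentSpace (𝓡 m) (ι y)) (v : TangentSpace (𝓡 n) y) :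
    g.inner (ι y) (normalPart ι g gN y w) (mfderiv (𝓡 n) (𝓡 m) ι y v) = 0 := by
  rw [normalPart, map_sub, _root_.sub_apply, ← hp, inner_tangentPart, sub_self]

lemma IsPullback.inner_normalPart {g : Metric m M} {gN : Metric n N}
    (hp : IsPullback ι g gN) (y : N) (v w : TangentSpace (𝓡 m) (ι y)) :
    g.inner (ι y) (normalPart ι g gN y v) (normalPart ι g gN y w)
      = g.inner (ι y) (normalPart ι g gN y v) w := by
  conv_lhs => rw [normalPart.eq_def ι g gN y w, map_sub, hp.inner_normalPart_mfderiv, sub_zero]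

namespace WeylStructure

variable (D D' : WeylStructure c)

/-- The trace of the fundamental form is `n H`. -/
lemma nsmul_meanCurv [NeZero n] (g : Metric m M) (gN : Metric n N) (y : N) :
    (n : ℝ) • D.meanCurv ι g gN y = metricTrace gN y (D.fundForm ι g gN y) := by
  rw [meanCurv, smul_smul, mul_one_div_cancel (Nat.cast_ne_zero.2 (NeZero.ne n)), one_smul]

/-- The mean curvature is normal. -/
lemma normalPart_meanCurv {g : Metric m M} {gN : Metric n N} (hp : IsPullback ι g gN) (y : N) :
    normalPart ι g gN y (D.meanCurv ι g gN y) = D.meanCurv ι g gN y := by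
  have h : ∀ w, normalPartL ι g gN y (normalPart ι g gN y w) = normalPart ι g gN y w := fun w => by
    conv_lhs => rw [normalPart, map_sub, normalPartL_apply, normalPartL_apply,
      hp.normalPart_mfderiv, sub_zero]
  rw [meanCurv, ← normalPartL_apply, map_smul, ← metricTrace_map]
  simp only [fundForm, h]
  rfl

section Change

variable (hι : ContMDiff (𝓡 n) (𝓡 m) ∞ ι) (g : c.metrics) (gN : cN.metrics)
  (hp : IsPullback ι g.1 gN.1)

lemma leeDiff_induced (y : N) :
    (D.induced hι g gN hp).leeDiff (D'.induced hι g gN hp) gN y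
      = (D.leeDiff D' g (ι y)).comp (mfderiv (𝓡 n) (𝓡 m) ι y) := by
  ext1 v
  rw [leeDiff_apply, induced_lee, induced_lee]
  rfl

lemma leeSharp_induced (y : N) :
    (D.induced hι g gN hp).leeSharp (D'.induced hι g gN hp) gN y
      = tangentPart ι g.1 gN.1 y (D.leeSharp D' g (ι y)) := by
  refine eq_of_inner_eq gN.1 y fun w => ?_
  rw [inner_leeSharp, inner_tangentPart, inner_leeSharp, leeDiff_induced]
  rfl

/-- The covariant derivative of the restriction of a one-form: it differs from the restriction of
the covariant derivative by the values of the one-form on the fundamental form. -/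
lemma covForm_induced {α : ∀ z : M, TangentSpace (𝓡 m) z →L[ℝ] ℝ} (hα : SmoothForm α) (y : N)
    (v w : TangentSpace (𝓡 n) y) :
    (D.induced hι g gN hp).covForm (fun z => (α (ι z)).comp (mfderiv (𝓡 n) (𝓡 m) ι z)) y v w
      = D.covForm α (ι y) (mfderiv (𝓡 n) (𝓡 m) ι y v) (mfderiv (𝓡 n) (𝓡 m) ι y w)
        + α (ι y) (D.fundForm ι g.1 gN.1 y v w) := by
  have hαN : SmoothForm (fun z => (α (ι z)).comp (mfderiv (𝓡 n) (𝓡 m) ι z)) := fun X hX =>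
    smoothFun_oneForm_along hι hα (SmoothField.mfderiv hι hX)
  have h := D.dfun_form_along hι hα (DiffFieldAt.mfderiv hι (diffFieldAt_ext w)) v
  rw [ext_apply_self] at h
  rw [covForm_ext _ hαN, fundForm, normalPart, map_sub]
  refine (congrArg (· - _) h).trans (add_sub_assoc _ _ _)

/-- As the fundamental form changes by `-c ⊗ (γ^♯)^⊥`, the mean curvature changes by `-(γ^♯)^⊥`. -/
lemma meanCurv_change [NeZero n] (g : c.metrics) (gN : cN.metrics) (hp : IsPullback ι g.1 gN.1)
    (y : N) :
    D'.meanCurv ι g.1 gN.1 y = D.meanCurv ι g.1 gN.1 y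
      - normalPart ι g.1 gN.1 y (D.leeSharp D' g (ι y)) := by
  have h : D'.fundForm ι g.1 gN.1 y = fun v w => D.fundForm ι g.1 gN.1 y v w
      - gN.1.inner y v w • normalPart ι g.1 gN.1 y (D.leeSharp D' g (ι y)) := by
    funext v w
    have h1 := congrArg (normalPartL ι g.1 gN.1 y) (D.along_change D' g
      (fun z => mfderiv (𝓡 n) (𝓡 m) ι z (ext w z)) y v)
    rw [map_sub, map_add, map_add, map_smul, map_smul, map_smul, normalPartL_apply,
      normalPartL_apply, normalPartL_apply, normalPartL_apply, normalPartL_apply,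
      hp.normalPart_mfderiv, hp.normalPart_mfderiv, smul_zero, smul_zero, add_zero, add_zero,
      ← hp, ext_apply_self] at h1
    exact h1
  rw [meanCurv, meanCurv, h, metricTrace_sub, metricTrace_smul_const, metricTrace_metric,
    smul_sub, smul_smul, one_div_mul_cancel (Nat.cast_ne_zero.2 (NeZero.ne n)), one_smul]

/-- Independence of the Weyl structure. The traces of the Hessian, of the Schouten-Weyl tensor and
the square of the mean curvature change by terms that involve `γ(H)` and the squares of the
tangential and of the normal part of `γ`, and these cancel. -/
theorem indLaplace_change [NeZero n] (hι : ContMDiff (𝓡 n) (𝓡 m) ∞ ι) (g : c.metrics)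
    (gN : cN.metrics) (hp : IsPullback ι g.1 gN.1) (hm : 2 ≤ m)
    (P : m = 2 → MobiusStructure c) {f : N → ℝ}
    (hf : SmoothFun n f) (y : N) :
    D'.indLaplace P ι g gN.1 f y = D.indLaplace P ι g gN.1 f y := by
  set DN := D.induced hι g gN hp with hDN
  set DN' := D'.induced hι g gN hp with hDN'
  set G := D.leeSharp D' g (ι y) with hG
  set γ := D.leeDiff D' g (ι y) with hγ
  have h1 := DN.metricTrace_hess_change DN' gN rfl hf y
  -- on `N` the horizontal Hessians are the Hessians of the induced Weyl structures
  have h1a : metricTrace gN.1 y (D'.horizontalHess ι g gN.1 (1 - n / 2) f y)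
      = metricTrace gN.1 y (DN'.hess gN (1 - n / 2) f y) := by
    rw [← D'.induced_hess hι g gN hp hp]
  have h1b : metricTrace gN.1 y (D.horizontalHess ι g gN.1 (1 - n / 2) f y)
      = metricTrace gN.1 y (DN.hess gN (1 - n / 2) f y) := by
    rw [← D.induced_hess hι g gN hp hp]
  -- the square of the tangential part of `γ`
  have hs : metricTrace gN.1 y (fun v w => γ (mfderiv (𝓡 n) (𝓡 m) ι y v)
      * γ (mfderiv (𝓡 n) (𝓡 m) ι y w))
      = γ (mfderiv (𝓡 n) (𝓡 m) ι y (tangentPart ι g.1 gN.1 y G)) := by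
    rw [← D.leeSharp_induced D' hι g gN hp]
    have := metricTrace_mul (g := gN.1) (DN.leeDiff DN' gN y) (DN.leeDiff DN' gN y).toLinearMap
    rw [leeSharp]
    rw [D.leeDiff_induced D' hι g gN hp] at this ⊢
    exact this
  set τ := metricTrace gN.1 y (fun v w => D.covForm (D.leeDiff D' g) (ι y)
    (mfderiv (𝓡 n) (𝓡 m) ι y v) (mfderiv (𝓡 n) (𝓡 m) ι y w)) with hτ
  -- the trace of the tensor `∇γ - γ ⊗ γ + ½ |γ|² c` of `N`, and below that of `M`
  have h2 : metricTrace gN.1 y (fun v w => DN.schoutenDiff DN' gN y v w)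
      = τ + n * γ (D.meanCurv ι g.1 gN.1 y)
        + (n / 2 - 1) * γ (mfderiv (𝓡 n) (𝓡 m) ι y (tangentPart ι g.1 gN.1 y G)) := by
    have e : (fun v w => DN.schoutenDiff DN' gN y v w) = fun v w =>
        D.covForm (D.leeDiff D' g) (ι y)
          (mfderiv (𝓡 n) (𝓡 m) ι y v) (mfderiv (𝓡 n) (𝓡 m) ι y w)
        + γ (D.fundForm ι g.1 gN.1 y v w)
        - γ (mfderiv (𝓡 n) (𝓡 m) ι y v) * γ (mfderiv (𝓡 n) (𝓡 m) ι y w)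
        + 1 / 2 * γ (mfderiv (𝓡 n) (𝓡 m) ι y (tangentPart ι g.1 gN.1 y G))
          * gN.1.inner y v w := by
      funext v w
      rw [schoutenDiff_apply, D.leeSharp_induced D' hι g gN hp,
        show DN.leeDiff DN' gN = _ from funext (D.leeDiff_induced D' hι g gN hp),
        D.covForm_induced hι g gN hp (D.smoothForm_leeDiff D' g)]
      rfl
    have e2 : metricTrace gN.1 y (fun v w => γ (D.fundForm ι g.1 gN.1 y v w))
        = n * γ (D.meanCurv ι g.1 gN.1 y) := by
      refine (metricTrace_map (g := gN.1) γ.toLinearMap (D.fundForm ι g.1 gN.1 y)).trans ?_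
      rw [← nsmul_meanCurv, map_smul]
      rfl
    rw [e, metricTrace_add (fun v w => _ + _ - _), metricTrace_sub (fun v w => _ + _),
      metricTrace_add, metricTrace_const_mul, metricTrace_metric, hs, e2]
    ring
  have h3 : metricTrace gN.1 y (fun v w => schouten P D' g (ι y)
        (mfderiv (𝓡 n) (𝓡 m) ι y v) (mfderiv (𝓡 n) (𝓡 m) ι y w))
      = metricTrace gN.1 y (fun v w => schouten P D g (ι y)
        (mfderiv (𝓡 n) (𝓡 m) ι y v) (mfderiv (𝓡 n) (𝓡 m) ι y w))
        - (τ - γ (mfderiv (𝓡 n) (𝓡 m) ι y (tangentPart ι g.1 gN.1 y G)) + n / 2 * γ G) := by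
    simp only [schouten_change P D D' hm, schoutenDiff_apply]
    rw [metricTrace_sub, metricTrace_add (fun v w => _ - _), metricTrace_sub,
      metricTrace_const_mul, hs]
    simp only [← hp _ _ _]
    rw [metricTrace_metric]
    ring
  -- the change of the mean curvature
  have h4 : g.1.inner (ι y) (D'.meanCurv ι g.1 gN.1 y) (D'.meanCurv ι g.1 gN.1 y)
      = g.1.inner (ι y) (D.meanCurv ι g.1 gN.1 y) (D.meanCurv ι g.1 gN.1 y)
        - 2 * γ (D.meanCurv ι g.1 gN.1 y)
        + (γ G - γ (mfderiv (𝓡 n) (𝓡 m) ι y (tangentPart ι g.1 gN.1 y G))) := by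
    have e1 : g.1.inner (ι y) (D.meanCurv ι g.1 gN.1 y) (normalPart ι g.1 gN.1 y G)
        = γ (D.meanCurv ι g.1 gN.1 y) := by
      rw [← D.normalPart_meanCurv hp, hp.inner_normalPart, inner_leeSharp']
    have e2 : g.1.inner (ι y) (normalPart ι g.1 gN.1 y G) (normalPart ι g.1 gN.1 y G)
        = γ G - γ (mfderiv (𝓡 n) (𝓡 m) ι y (tangentPart ι g.1 gN.1 y G)) := by
      rw [hp.inner_normalPart, inner_leeSharp', normalPart, map_sub]
    rw [D.meanCurv_change D' g gN hp]
    simp only [map_sub, _root_.sub_apply]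
    rw [e1, e2, inner_symm' g.1 (ι y) (normalPart ι g.1 gN.1 y G), e1]
    ring
  simp only [indLaplace]
  rw [h1a, h1b, h1, h2, h3, h4]
  ring

end Change

end WeylStructure

end Independence

/-! ### Change of the metric in the conformal class -/

namespace WeylStructure

section Gauge

variable {m : ℕ} {M : Type*} [TopologicalSpace M] [T2Space M]
  [ChartedSpace (EuclideanSpace ℝ (Fin m)) M] [IsManifold (𝓡 m) ∞ M]
  {c : ConformalStructure m M} (D : WeylStructure c)

lemma mdiffAt_deriv_ext (g : c.metrics) (k : ℝ) {f : M → ℝ} (hf : SmoothFun m f) {x : M}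
    (w : TangentSpace (𝓡 m) x) :
    MDifferentiableAt (𝓡 m) 𝓘(ℝ) (fun z => D.deriv g k f z (ext w z)) x := by
  have h := SmoothFun.mdiffAt (D.smoothForm_derivL g k hf _ (smoothField_sext w)) x
  refine h.congr_of_eventuallyEq ?_
  filter_upwards [sext_eventuallyEq w] with z hz
  rw [← derivL_apply, hz]

/-- The covariant derivative on `L^k` is well-defined: coefficients of weight `k` have derivatives
of weight `k`. -/
lemma deriv_gauge {g g' : c.metrics} {u : M → ℝ} (hu : SmoothFun m u)
    (h : ∀ x, ScalesBy g.1 g'.1 x (u x)) (k : ℝ) {f : M → ℝ} {x : M}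
    (hf : MDifferentiableAt (𝓡 m) 𝓘(ℝ) f x) (v : TangentSpace (𝓡 m) x) :
    D.deriv g' k (fun z => Real.exp (k * u z) * f z) x v
      = Real.exp (k * u x) * D.deriv g k f x v := by
  have he : MDifferentiableAt (𝓡 m) 𝓘(ℝ) (fun z => k * u z) x :=
    SmoothFun.mdiffAt (contMDiff_const.mul hu) x
  have he' : MDifferentiableAt (𝓡 m) 𝓘(ℝ) (fun z => Real.exp (k * u z)) x :=
    SmoothFun.mdiffAt (Real.contDiff_exp.contMDiff.comp (contMDiff_const.mul hu)) x
  rw [deriv, deriv, dfun_mul he' hf, dfun_exp he, dfun_const_mul k (hu.mdiffAt x),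
    D.lee_gauge hu h]
  ring

/-- The Hessian maps sections of `L^k` to sections of `S²T^*M ⊗ L^k`. -/
lemma hess_gauge {g g' : c.metrics} {u : M → ℝ} (hu : SmoothFun m u)
    (h : ∀ x, ScalesBy g.1 g'.1 x (u x)) (k : ℝ) {f : M → ℝ} (hf : SmoothFun m f) (x : M)
    (v w : TangentSpace (𝓡 m) x) :
    D.hess g' k (fun z => Real.exp (k * u z) * f z) x v w
      = Real.exp (k * u x) * D.hess g k f x v w := by
  have e : (fun z => D.deriv g' k (fun z => Real.exp (k * u z) * f z) z (ext w z))
      = fun z => Real.exp (k * u z) * D.deriv g k f z (ext w z) :=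
    funext fun z => D.deriv_gauge hu h k (hf.mdiffAt z) _
  rw [hess, hess, e, D.deriv_gauge hu h k (D.mdiffAt_deriv_ext g k hf w),
    D.deriv_gauge hu h k (hf.mdiffAt x)]
  ring

lemma derivL_add (g : c.metrics) (k : ℝ) {f f' : M → ℝ} (hf : SmoothFun m f)
    (hf' : SmoothFun m f') :
    D.derivL g k (f + f') = D.derivL g k f + D.derivL g k f' := by
  funext z
  ext v
  have h := dfun_add (hf.mdiffAt z) (hf'.mdiffAt z) v
  simp only [derivL_apply, Pi.add_apply, _root_.add_apply, deriv]
  refine (congrArg (· + _) h).trans ?_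
  ring

lemma hess_add (g : c.metrics) (k : ℝ) {f f' : M → ℝ} (hf : SmoothFun m f)
    (hf' : SmoothFun m f') (x : M) (v w : TangentSpace (𝓡 m) x) :
    D.hess g k (f + f') x v w = D.hess g k f x v w + D.hess g k f' x v w := by
  rw [D.hess_eq g k (hf.add hf'), D.hess_eq g k hf, D.hess_eq g k hf', ← derivL_apply,
    ← derivL_apply, ← derivL_apply, D.derivL_add g k hf hf',
    D.covForm_add (D.smoothForm_derivL g k hf) (D.smoothForm_derivL g k hf'), Pi.add_apply,
    _root_.add_apply]
  ring

lemma derivL_smul (g : c.metrics) (k r : ℝ) {f : M → ℝ} (hf : SmoothFun m f) :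
    D.derivL g k (r • f) = fun z => r • D.derivL g k f z := by
  funext z
  ext v
  have h := dfun_const_mul r (hf.mdiffAt z) v
  simp only [derivL_apply, Pi.smul_apply, _root_.smul_apply, smul_eq_mul, deriv]
  refine (congrArg (· + _) h).trans ?_
  ring

lemma hess_smul (g : c.metrics) (k r : ℝ) {f : M → ℝ} (hf : SmoothFun m f) (x : M)
    (v w : TangentSpace (𝓡 m) x) :
    D.hess g k (r • f) x v w = r * D.hess g k f x v w := by
  have h : SmoothFun m (r • f) := contMDiff_const.mul hf
  rw [D.hess_eq g k h, D.hess_eq g k hf, ← derivL_apply,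
    ← derivL_apply, D.derivL_smul g k r hf,
    D.covForm_smul (a := fun _ => r) contMDiff_const (D.smoothForm_derivL g k hf), dfun_const,
    _root_.smul_apply, smul_eq_mul]
  ring

lemma smoothFun_metricTrace_hess (g : c.metrics) (k : ℝ) {f : M → ℝ} (hf : SmoothFun m f) :
    SmoothFun m (fun x => metricTrace g.1 x (D.hess g k f x)) := by
  have hδ := D.smoothForm_derivL g k hf
  have e : ∀ x, D.hess g k f x = fun v w => (D.covForm (D.derivL g k f) x
      + (k • (D.lee g x).toLinearMap).smulRight (D.derivL g k f x).toLinearMap) v w := fun x => by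
    funext v w
    rw [D.hess_eq g k hf, ← derivL_apply]
    rfl
  simp only [e]
  refine smoothFun_metricTrace g.1 fun X Y hX hY => ?_
  exact (D.smoothFun_covForm hδ hX hY).add
    ((contMDiff_const.mul (D.smoothFun_lee g hX)).mul (hδ Y hY))

end Gauge

end WeylStructure

/-! ### Laplace structures from Weyl structures -/

section LaplaceStructures

variable {m : ℕ} {M : Type*} [TopologicalSpace M] [T2Space M]
  [ChartedSpace (EuclideanSpace ℝ (Fin m)) M] [IsManifold (𝓡 m) ∞ M]
  {c : ConformalStructure m M}

lemma ScalesBy.unique [NeZero m] {g g' : Metric m M} {x : M} {s t : ℝ} (hs : ScalesBy g g' x s)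
    (ht : ScalesBy g g' x t) : s = t := by
  have h := (confRatio_scale g g g' x s hs).symm.trans (confRatio_scale g g g' x t ht)
  rw [confRatio_self, mul_one, mul_one, Real.exp_eq_exp] at h
  linarith

/-- The section of `L^k` with coefficient `F` in the metric `g` (for `m = 0` the coefficients of
`unitDensity` are junk, whence the hypothesis of `densityOf_self`). -/
def densityOf (g : c.metrics) (k : ℝ) {F : M → ℝ} (hF : SmoothFun m F) : Density c k :=
  ⟨fun g' x => (unitDensity g k).1 g' x * F x, fun g' => ((unitDensity g k).2.1 g').mul hF,
    fun g' g'' x t h => by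
      beta_reduce; rw [(unitDensity g k).2.2 g' g'' x t h, mul_assoc]⟩

lemma densityOf_self [NeZero m] (g : c.metrics) (k : ℝ) {F : M → ℝ} (hF : SmoothFun m F) :
    (densityOf g k hF).1 g = F := by
  funext x
  show (unitDensity g k).1 g x * F x = F x
  rw [unitDensity_self, one_mul]

/-- A density is determined by its coefficient in one metric. -/
lemma Density.ext_of_eq {k : ℝ} {s s' : Density c k} (g : c.metrics) (h : s.1 g = s'.1 g) :
    s = s' := by
  refine Subtype.ext (funext fun g' => funext fun x => ?_)
  obtain ⟨t, ht⟩ := exists_scalesBy g g' x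
  rw [s.2.2 g g' x t ht, s'.2.2 g g' x t ht, h]

/-- The Laplace structure `tr Hess + σ` of a Weyl structure and a section `σ` of `L⁻²`. -/
def WeylStructure.laplaceStructure [NeZero m] (D : WeylStructure c) (σ : Density c (-2)) :
    LaplaceStructure c where
  op :=
    { toFun := fun l => ⟨fun g x => metricTrace g.1 x (D.hess g (1 - m / 2) (l.1 g) x)
          + σ.1 g x * l.1 g x,
        fun g => (D.smoothFun_metricTrace_hess g _ (l.2.1 g)).add ((σ.2.1 g).mul (l.2.1 g)),
        fun g g' x t ht => by
          obtain ⟨u, hu, h⟩ := (c.mem_iff g.1 g.2 g'.1).1 g'.2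
          -- the scaling at the point `x` is extended to a function, as the Hessian is not pointwise
          obtain rfl : u x = t := ScalesBy.unique (h x) ht
          have hl : l.1 g' = fun z => Real.exp ((1 - m / 2) * u z) * l.1 g z :=
            funext fun z => l.2.2 g g' z _ (h z)
          have hh : D.hess g' (1 - m / 2) (l.1 g') x = fun v w =>
              Real.exp ((1 - m / 2) * u x) * D.hess g (1 - m / 2) (l.1 g) x v w := by
            funext v w
            rw [hl, D.hess_gauge hu h _ (l.2.1 g)]
          have he : Real.exp ((-1 - m / 2) * u x)
              = Real.exp (-2 * u x) * Real.exp ((1 - m / 2) * u x) := by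
            rw [← Real.exp_add]
            ring_nf
          beta_reduce
          rw [hh, metricTrace_const_mul, ht.metricTrace_eq, smul_eq_mul, σ.2.2 g g' x _ ht,
            l.2.2 g g' x _ ht, he]
          ring⟩
      map_add' := fun l l' => Subtype.ext (funext fun g => funext fun x => by
        have h : D.hess g (1 - m / 2) ((l + l').1 g) x = fun v w =>
            D.hess g (1 - m / 2) (l.1 g) x v w + D.hess g (1 - m / 2) (l'.1 g) x v w :=
          funext fun v => funext fun w => D.hess_add g _ (l.2.1 g) (l'.2.1 g) x v w
        show metricTrace g.1 x (D.hess g (1 - m / 2) ((l + l').1 g) x)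
            + σ.1 g x * (l.1 g x + l'.1 g x)
          = (metricTrace g.1 x (D.hess g (1 - m / 2) (l.1 g) x) + σ.1 g x * l.1 g x)
            + (metricTrace g.1 x (D.hess g (1 - m / 2) (l'.1 g) x) + σ.1 g x * l'.1 g x)
        rw [h, metricTrace_add]
        ring)
      map_smul' := fun r l => Subtype.ext (funext fun g => funext fun x => by
        have h : D.hess g (1 - m / 2) ((r • l).1 g) x = fun v w =>
            r * D.hess g (1 - m / 2) (l.1 g) x v w :=
          funext fun v => funext fun w => D.hess_smul g _ r (l.2.1 g) x v w
        show metricTrace g.1 x (D.hess g (1 - m / 2) ((r • l).1 g) x)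
            + σ.1 g x * (r * l.1 g x)
          = r * (metricTrace g.1 x (D.hess g (1 - m / 2) (l.1 g) x) + σ.1 g x * l.1 g x)
        rw [h, metricTrace_const_mul]
        ring) }
  isLaplace := ⟨D, σ, fun _ _ _ => rfl⟩

lemma LaplaceStructure.ext_of_op {Λ Λ' : LaplaceStructure c} (h : ∀ l, Λ.op l = Λ'.op l) :
    Λ = Λ' := by
  cases Λ
  cases Λ'
  congr
  exact LinearMap.ext h

end LaplaceStructures

section Submanifold

variable {m n : ℕ} {M N : Type*} [TopologicalSpace M] [T2Space M]
  [ChartedSpace (EuclideanSpace ℝ (Fin m)) M] [IsManifold (𝓡 m) ∞ M]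
  [TopologicalSpace N] [T2Space N]
  [ChartedSpace (EuclideanSpace ℝ (Fin n)) N] [IsManifold (𝓡 n) ∞ N]
  {c : ConformalStructure m M} {cN : ConformalStructure n N} {ι : N → M}

/-- The square of the length of a field along `ι` is smooth as soon as the products of the field
with smooth fields on `M` are. -/
lemma smoothFun_inner_self_along (hι : ContMDiff (𝓡 n) (𝓡 m) ∞ ι) (g : Metric m M)
    {V : ∀ z : N, TangentSpace (𝓡 m) (ι z)}
    (hV : ∀ W, SmoothField W → SmoothFun n (fun z => g.inner (ι z) (V z) (W (ι z)))) :
    SmoothFun n (fun z => g.inner (ι z) (V z) (V z)) := by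
  refine smoothFun_of_eventuallyEq fun y => ?_
  set E : Fin m → ∀ z : M, TangentSpace (𝓡 m) z := fun i => sext (coordVec (ι y) i) with hE
  have hEs : ∀ i, SmoothField (E i) := fun i => smoothField_sext _
  set A : N → Matrix (Fin m) (Fin m) ℝ :=
    fun z => Matrix.of fun i j => g.inner (ι z) (E i (ι z)) (E j (ι z)) with hA
  have hAs : ∀ i j, SmoothFun n (fun z => A z i j) := fun i j =>
    (smoothFun_inner g (hEs i) (hEs j)).comp hι
  have hAy : A y = gram g (ι y) := by
    ext i j
    simp [hA, hE, sext_apply_self, gram_apply]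
  have hu : IsUnit (A y).det := by rw [hAy]; exact isUnit_det_gram g _
  refine ⟨fun z => ∑ i, ∑ j, (A z)⁻¹ i j * g.inner (ι z) (V z) (E j (ι z))
    * g.inner (ι z) (V z) (E i (ι z)), ?_, ?_⟩
  · exact contMDiffAt_finsetSum fun i _ => contMDiffAt_finsetSum fun j _ =>
      ((contMDiffAt_matrix_inv hAs hu i j).mul (hV _ (hEs j) y)).mul (hV _ (hEs i) y)
  · filter_upwards [(contMDiff_matrix_det hAs).continuous.continuousAt.eventually_ne
      hu.ne_zero] with z hz
    have h := inner_expand g (fun i => E i (ι z)) (isUnit_iff_ne_zero.2 hz) (V z) (V z)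
    refine h.trans ?_
    simp only [map_sum, map_smul, _root_.sum_apply, _root_.smul_apply, smul_eq_mul]
    refine Finset.sum_congr rfl fun i _ => Finset.sum_congr rfl fun j _ => ?_
    rw [inner_symm' g (ι z) (E i (ι z)) (V z)]

lemma smoothFun_metricTrace_along (hι : ContMDiff (𝓡 n) (𝓡 m) ∞ ι) (gN : Metric n N)
    {B : ∀ x : M, TangentSpace (𝓡 m) x →ₗ[ℝ] TangentSpace (𝓡 m) x →ₗ[ℝ] ℝ}
    (hB : ∀ X Y, SmoothField X → SmoothField Y → SmoothFun m (fun x => B x (X x) (Y x))) :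
    SmoothFun n (fun y => metricTrace gN y (fun v w => B (ι y) (mfderiv (𝓡 n) (𝓡 m) ι y v)
      (mfderiv (𝓡 n) (𝓡 m) ι y w))) :=
  smoothFun_metricTrace gN (B := fun y => (B (ι y)).compl₁₂
    (mfderiv (𝓡 n) (𝓡 m) ι y).toLinearMap (mfderiv (𝓡 n) (𝓡 m) ι y).toLinearMap)
    fun _ _ hX hY => smoothFun_form_along hι hB (SmoothField.mfderiv hι hX)
      (SmoothField.mfderiv hι hY)

namespace WeylStructure

variable (D : WeylStructure c)

/-- The coefficient of order zero of the operator `indLaplace`. -/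
def indPotential (P : m = 2 → MobiusStructure c) (ι : N → M) (g : c.metrics) (gN : Metric n N)
    (y : N) : ℝ :=
  (1 - n / 2) * metricTrace gN y (fun v w => schouten P D g (ι y)
      (mfderiv (𝓡 n) (𝓡 m) ι y v) (mfderiv (𝓡 n) (𝓡 m) ι y w))
    + (1 - n / 2) * n / 2
      * g.1.inner (ι y) (D.meanCurv ι g.1 gN y) (D.meanCurv ι g.1 gN y)

/-- The coefficient of order zero is a section of `L⁻²`. -/
lemma indPotential_gauge [NeZero m] (P : m = 2 → MobiusStructure c) {g g' : c.metrics}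
    {gN gN' : Metric n N} (hp : IsPullback ι g.1 gN) (hp' : IsPullback ι g'.1 gN') {y : N} {t : ℝ}
    (h : ScalesBy g.1 g'.1 (ι y) t) :
    D.indPotential P ι g' gN' y = Real.exp (-2 * t) * D.indPotential P ι g gN y := by
  have hN := hp.scalesBy hp' h
  obtain ⟨S, -, hS⟩ := exists_schouten_form P D
  have hB : D.fundForm ι g'.1 gN' y = D.fundForm ι g.1 gN y := by
    funext v w
    rw [fundForm, fundForm, normalPart, normalPart, hp.tangentPart_eq hp' h]
  have hH : D.meanCurv ι g'.1 gN' y = Real.exp (-2 * t) • D.meanCurv ι g.1 gN y := by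
    rw [meanCurv, meanCurv, hB, hN.metricTrace_eq, smul_comm]
  have hexp : Real.exp (2 * t) * Real.exp (-2 * t) = 1 := by
    rw [← Real.exp_add]; simp
  simp only [indPotential, hS, hN.metricTrace_eq, hH, h _ _, map_smul, _root_.smul_apply,
    smul_eq_mul]
  linear_combination ((1 - n / 2) * n / 2 * Real.exp (-2 * t)
    * g.1.inner (ι y) (D.meanCurv ι g.1 gN y) (D.meanCurv ι g.1 gN y)) * hexp

lemma smoothFun_indPotential [NeZero m] (P : m = 2 → MobiusStructure c)
    (hι : ContMDiff (𝓡 n) (𝓡 m) ∞ ι) (g : c.metrics) (gN : cN.metrics)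
    (hp : IsPullback ι g.1 gN.1) : SmoothFun n (D.indPotential P ι g gN.1) := by
  obtain ⟨S, hS, hSe⟩ := exists_schouten_form P D
  have h1 : SmoothFun n (fun y => metricTrace gN.1 y (fun v w => schouten P D g (ι y)
      (mfderiv (𝓡 n) (𝓡 m) ι y v) (mfderiv (𝓡 n) (𝓡 m) ι y w))) := by
    simp only [hSe]
    exact smoothFun_metricTrace_along hι gN.1 hS
  have h2 : SmoothFun n (fun y => g.1.inner (ι y) (D.meanCurv ι g.1 gN.1 y)
      (D.meanCurv ι g.1 gN.1 y)) := by
    refine smoothFun_inner_self_along hι g.1 fun W hW => ?_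
    -- a one-form on the fundamental form is the difference of two covariant derivatives
    have hα : SmoothForm (fun z => g.1.inner z (W z)) := fun U hU => smoothFun_inner g.1 hW hU
    have e : ∀ y, g.1.inner (ι y) (D.meanCurv ι g.1 gN.1 y) (W (ι y)) = 1 / n *
        (metricTrace gN.1 y (fun v w => (D.induced hι g gN hp).covForm (fun z =>
            (g.1.inner (ι z) (W (ι z))).comp (mfderiv (𝓡 n) (𝓡 m) ι z)) y v w)
          - metricTrace gN.1 y (fun v w => D.covForm (fun z => g.1.inner z (W z)) (ι y)
            (mfderiv (𝓡 n) (𝓡 m) ι y v) (mfderiv (𝓡 n) (𝓡 m) ι y w))) := fun y => by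
      rw [← metricTrace_sub, inner_symm', meanCurv, map_smul, smul_eq_mul]
      congr 1
      refine (metricTrace_map (g := gN.1) (g.1.inner (ι y) (W (ι y))).toLinearMap
        (D.fundForm ι g.1 gN.1 y)).symm.trans ?_
      congr 1
      funext v w
      rw [D.covForm_induced hι g gN hp hα]
      exact (add_sub_cancel_left _ _).symm
    simp only [e]
    refine contMDiff_const.mul ((smoothFun_metricTrace gN.1 fun X Y hX hY =>
      (D.induced hι g gN hp).smoothFun_covForm (fun U hU =>
        smoothFun_oneForm_along hι hα (SmoothField.mfderiv hι hU)) hX hY).sub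
      (smoothFun_metricTrace_along hι gN.1 fun X Y hX hY => D.smoothFun_covForm hα hX hY))
  exact (contMDiff_const.mul h1).add (contMDiff_const.mul h2)

section Pullback

variable (hι : ContMDiff (𝓡 n) (𝓡 m) ∞ ι) (g : c.metrics) (gN : cN.metrics)
  (hp : IsPullback ι g.1 gN.1)

/-- On `N` only the Hessian of the induced Weyl structure and a potential matter. -/
lemma indLaplace_eq (P : m = 2 → MobiusStructure c) {g' : c.metrics} {gN' : cN.metrics}
    (hp' : IsPullback ι g'.1 gN'.1) (f : N → ℝ) (y : N) :
    D.indLaplace P ι g' gN'.1 f y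
      = metricTrace gN'.1 y ((D.induced hι g gN hp).hess gN' (1 - n / 2) f y)
        + D.indPotential P ι g' gN'.1 y * f y := by
  rw [D.induced_hess hι g gN hp hp']
  simp only [indLaplace, indPotential]
  ring

end Pullback

end WeylStructure

/-! ### The induced Laplace structure -/

namespace WeylStructure

variable (D : WeylStructure c)

/-- The operator `indLaplace` is the Laplace structure `tr Hess + σ` of the induced Weyl structure,
for the section `σ` of `L⁻²` with coefficient `indPotential`. Uniqueness holds because a density is
determined by its coefficient in a single metric that is a pull-back. -/
lemma exists_unique_induces [NeZero m] [NeZero n] (P : m = 2 → MobiusStructure c)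
    (hι : IsConformalSubmanifold c cN ι) : ∃! Λ : LaplaceStructure cN, D.Induces P ι Λ := by
  have hs : ContMDiff (𝓡 n) (𝓡 m) ∞ ι := hι.isSmoothEmbedding.contMDiff
  obtain ⟨g₀, hg₀⟩ := c.nonempty
  obtain ⟨gN₀, hgN₀, hp⟩ := hι.induced g₀ hg₀
  set g : c.metrics := ⟨g₀, hg₀⟩
  set gN : cN.metrics := ⟨gN₀, hgN₀⟩
  refine ⟨(D.induced hs g gN hp).laplaceStructure
    (densityOf gN (-2) (D.smoothFun_indPotential P hs g gN hp)), ?_, ?_⟩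
  · intro g' gN' hp' l y
    obtain ⟨t, ht⟩ := exists_scalesBy g g' (ι y)
    rw [D.indLaplace_eq hs g gN hp P hp', D.indPotential_gauge P hp hp' ht]
    have h := (densityOf gN (-2) (D.smoothFun_indPotential P hs g gN hp)).2.2 gN gN' y t
      (IsPullback.scalesBy hp hp' ht)
    rw [densityOf_self] at h
    rw [← h]
    rfl
  · intro Λ hΛ
    refine LaplaceStructure.ext_of_op fun l => Density.ext_of_eq gN (funext fun y => ?_)
    rw [hΛ g gN hp, D.indLaplace_eq hs g gN hp P hp]
    have h := congrFun (densityOf_self gN (-2) (D.smoothFun_indPotential P hs g gN hp)) y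
    exact congrArg (fun a => _ + a * l.1 gN y) h.symm

end WeylStructure

end Submanifold

end

end ConfGeom

theorem proposition4p14 {m n : ℕ} (hn : 1 ≤ n) (hnm : n < m)
    {M : Type*} [TopologicalSpace M] [T2Space M] [SecondCountableTopology M]
    [ChartedSpace (EuclideanSpace ℝ (Fin m)) M] [IsManifold (𝓡 m) ∞ M]
    {N : Type*} [TopologicalSpace N] [T2Space N] [SecondCountableTopology N]
    [ChartedSpace (EuclideanSpace ℝ (Fin n)) N] [IsManifold (𝓡 n) ∞ N]
    (c : ConfGeom.ConformalStructure m M) (P : m = 2 → ConfGeom.MobiusStructure c)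
    (cN : ConfGeom.ConformalStructure n N) (ι : N → M)
    (hι : ConfGeom.IsConformalSubmanifold c cN ι) :
    (∀ D : ConfGeom.WeylStructure c,
      ∃! Λ : ConfGeom.LaplaceStructure cN, D.Induces P ι Λ) ∧
    (∀ (D D' : ConfGeom.WeylStructure c) (g : c.metrics) (gN : cN.metrics),
      ConfGeom.IsPullback ι g.1 gN.1 → ∀ (l : ConfGeom.Density cN (1 - n / 2)) (y : N),
        D.indLaplace P ι g gN.1 (l.1 gN) y = D'.indLaplace P ι g gN.1 (l.1 gN) y) := by
  have : NeZero n := ⟨by omega⟩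
  have : NeZero m := ⟨by omega⟩
  exact ⟨fun D => D.exists_unique_induces P hι, fun D D' g gN hp l y =>
    (D.indLaplace_change D' hι.isSmoothEmbedding.contMDiff g gN hp (by omega) P (l.2.1 gN) y).symm⟩
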